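/- Let $\xi:[-1,1]\to\mathbb{R}$ be an even convex, three times differentiable function with $\xi''(s)>0$ for $s\in(0,1]$ and $\xi'''(s)\ge 0$ for $s\in[0,1]$; let $t\in[0,1]$ and $h\in\mathbb{R}$. For $N\ge 1$ let $S_N=\{\sigma\in\mathbb{R}^N:\sum_{i\le N}\sigma_i^2=N\}$, let $\lambda_N$ be the uniform probability measure on $S_N$, and let $R(\sigma,\tau)=N^{-1}\sigma\cdot\tau$. Let $X_N^1,X_N^2$ be jointly Gaussian centered (and jointly measurable) processes on $S_N$ with $$\mathbb{E}X_N^j(\sigma)X_N^j(\tau)=N\xi(R(\sigma,\tau))\quad(j=1,2),\qquad \mathbb{E}X_N^1(\sigma)X_N^2(\tau)=tN\xi(R(\sigma,\tau)),$$ and set $-H_N^j(\sigma)=X_N^j(\sigma)+h\sum_{i\le N}\sigma_i$. For $u\in[-1,1]$ and $\alpha>0$ define $$Z_{N,u,\alpha}=\int_{|R(\sigma^1,\sigma^2)-u|<\alpha}\exp\bigl(-H_N^1(\sigma^1)-H_N^2(\sigma^2)\bigr)\,d\lambda_N(\sigma^1)\,d\lambda_N(\sigma^2),\qquad p_{N,u,\alpha}=\frac1N\mathbb{E}\log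 Z_{N,u,\alpha}.$$ Let $x$ be a distribution function on $[0,1]$ (nondecreasing, right-continuous, with values in $[0,1]$ and $x(1)=1$), let $\lambda\in\mathbb{R}$, let $b>\int_0^1\xi''(s)x(s)\,ds+|\lambda|$, and let $u\in[-1,1]$. Put $\eta=1$ if $u\ge 0$ and $\eta=-1$ if $u<0$, $$d(q)=\int_q^1\xi''(s)x(s)\,ds,\qquad \phi_{|u|}(q)=d(|u|)+\frac{1-t}{1+t}\bigl(d(q)-d(|u|)\bigr),$$ \begin{align*} T_u(x,b,\lambda)&=\log\sqrt{\frac{b^2}{b^2-\lambda^2}}+\frac{1+t}{2}\int_0^{|u|}\frac{\xi''(s)}{b-\eta\lambda-d(s)}\,ds+\frac{1-t}{2}\int_0^{|u|}\frac{\xi''(s)}{b+\eta\lambda-\phi_{|u|}(s)}\,ds\\ &\quad+\frac12\int_{|u|}^1\frac{\xi''(s)}{b-\lambda-d(s)}\,ds+\frac12\int_{|u|}^1\frac{\xi''(s)}{b+\lambda-d(s)}\,ds-\lambda u+b-1-\log b-\int_0^1 q\,\xi''(q)x(q)\,dq, \end{align*} and $$\mathcal{P}_u(x,b,\lambda)=\begin{cases}T_u(x,b,\lambda)+\dfrac{h^2}{b-\lambda-d(0)},&u\in[0,1],\\[2mm]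 T_u(x,b,\lambda)+\dfrac{h^2}{b-\lambda-\phi_{|u|}(0)},&u\in[-1,0).\end{cases}$$ Then for all $N\ge 2$ and $\alpha>0$ one has $Z_{N,u,\alpha}>0$ almost surely and $\log Z_{N,u,\alpha}$ is integrable (so $p_{N,u,\alpha}$ is well defined), and $$\limsup_{\alpha\downarrow 0}\ \limsup_{N\to\infty}\ p_{N,u,\alpha}\le\mathcal{P}_u(x,b,\lambda).$$ -/

import Mathlib

open MeasureTheory ProbabilityTheory Filter Topology Set

noncomputable section

namespace SphericalSpinGlass

/-- The second derivative `ξ''` of a function `ξ` on `[-1,1]` (one-sided at the endpoints). -/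
def xi2 (ξ : ℝ → ℝ) (s : ℝ) : ℝ := iteratedDerivWithin 2 ξ (Icc (-1) 1) s

/-- The third derivative `ξ'''` of a function `ξ` on `[-1,1]` (one-sided at the endpoints). -/
def xi3 (ξ : ℝ → ℝ) (s : ℝ) : ℝ := iteratedDerivWithin 3 ξ (Icc (-1) 1) s

/-- The standing assumptions on `ξ`: a three times differentiable even convex function on `[-1,1]`
with `ξ'' > 0` on `(0,1]` and `ξ''' ≥ 0` on `[0,1]`.  (The first two fields together say that
`ξ, ξ', ξ''` are differentiable on `[-1,1]`.)  Only the values of `ξ` on `[-1,1]` matter. -/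
structure IsMixture (ξ : ℝ → ℝ) : Prop where
  contDiffOn_two : ContDiffOn ℝ 2 ξ (Icc (-1) 1)
  differentiableOn_xi2 : DifferentiableOn ℝ (xi2 ξ) (Icc (-1) 1)
  even : ∀ s ∈ Icc (-1 : ℝ) 1, ξ (-s) = ξ s
  convexOn : ConvexOn ℝ (Icc (-1) 1) ξ
  xi2_pos : ∀ s ∈ Ioc (0 : ℝ) 1, 0 < xi2 ξ s
  xi3_nonneg : ∀ s ∈ Icc (0 : ℝ) 1, 0 ≤ xi3 ξ s

/-- `x` is (on `[0,1]`) the distribution function of a probability measure on `[0,1]`. -/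
structure IsDistributionFunction (x : ℝ → ℝ) : Prop where
  monotoneOn : MonotoneOn x (Icc 0 1)
  zero_le : 0 ≤ x 0
  rightContinuous : ∀ q ∈ Ico (0 : ℝ) 1, ContinuousWithinAt x (Ici q) q
  at_one : x 1 = 1

/-- The configuration space `S_N`, the sphere of radius `√N` in `ℝ^N`. -/
abbrev Config (N : ℕ) : Type :=
  Metric.sphere (0 : EuclideanSpace ℝ (Fin N)) (√(N : ℝ))

/-- The overlap `R(σ,τ) = N⁻¹ σ·τ`. -/
def overlap {N : ℕ} (σ τ : Config N) : ℝ :=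
  (N : ℝ)⁻¹ * inner ℝ (σ : EuclideanSpace ℝ (Fin N)) (τ : EuclideanSpace ℝ (Fin N))

/-- The dilation of the unit sphere onto `S_N`. -/
def dilate (N : ℕ) (v : Metric.sphere (0 : EuclideanSpace ℝ (Fin N)) 1) : Config N :=
  ⟨√(N : ℝ) • (v : EuclideanSpace ℝ (Fin N)), by
    have hv : ‖(v : EuclideanSpace ℝ (Fin N))‖ = 1 := norm_eq_of_mem_sphere v
    simp [norm_smul, hv, abs_of_nonneg (Real.sqrt_nonneg _)]⟩

/-- The uniform probability measure `λ_N` on `S_N` (for `N ≥ 1`): the image under the dilation of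
the normalized surface measure of the unit sphere. -/
def uniformMeasure (N : ℕ) : Measure (Config N) :=
  ((((volume : Measure (EuclideanSpace ℝ (Fin N))).toSphere univ)⁻¹ •
    (volume : Measure (EuclideanSpace ℝ (Fin N))).toSphere)).map (dilate N)

/-- `X 0 = X_N^1` and `X 1 = X_N^2` are two jointly Gaussian, centered processes on `S_N`,
each with covariance `N ξ(R)`, and with cross-covariance `t N ξ(R)`; they are jointly measurable
in the configuration and the randomness, so that the partition function is a random variable. -/
structure IsCoupledPair {Ω : Type*} [MeasurableSpace Ω] (P : Measure Ω) (ξ : ℝ → ℝ) (t : ℝ)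
    (N : ℕ) (X : Fin 2 → Config N → Ω → ℝ) : Prop where
  measurable : ∀ j, Measurable (fun p : Config N × Ω => X j p.1 p.2)
  gaussian : IsGaussianProcess (fun i : Fin 2 × Config N => X i.1 i.2) P
  centered : ∀ j σ, ∫ ω, X j σ ω ∂P = 0
  covariance : ∀ i j σ τ, ∫ ω, X i σ ω * X j τ ω ∂P =
    (if i = j then 1 else t) * (N * ξ (overlap σ τ))

/-- `-H_N(σ) = X_N(σ) + h ∑_i σ_i` for one realization `Y` of the process `X_N`. -/
def negHamiltonian {N : ℕ} (h : ℝ) (Y : Config N → ℝ) (σ : Config N) : ℝ :=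
  Y σ + h * ∑ i, (σ : EuclideanSpace ℝ (Fin N)) i

/-- The coupled partition function `Z_{N,u,α}`. -/
def coupledPartition {Ω : Type*} {N : ℕ} (h : ℝ) (X : Fin 2 → Config N → Ω → ℝ) (u α : ℝ)
    (ω : Ω) : ℝ :=
  ∫ s in {s : Config N × Config N | |overlap s.1 s.2 - u| < α},
    Real.exp (negHamiltonian h (fun σ => X 0 σ ω) s.1 + negHamiltonian h (fun σ => X 1 σ ω) s.2)
    ∂((uniformMeasure N).prod (uniformMeasure N))

/-- The coupled free energy `p_{N,u,α} = N⁻¹ E log Z_{N,u,α}`. -/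
def coupledFreeEnergy {Ω : Type*} [MeasurableSpace Ω] (P : Measure Ω) {N : ℕ} (h : ℝ)
    (X : Fin 2 → Config N → Ω → ℝ) (u α : ℝ) : ℝ :=
  (N : ℝ)⁻¹ * (∫ ω, Real.log (coupledPartition h X u α ω) ∂P)

/-- `d(q) = ∫_q^1 ξ''(s) x(s) ds`. -/
def dFun (ξ x : ℝ → ℝ) (q : ℝ) : ℝ := ∫ s in q..1, xi2 ξ s * x s

/-- `φ_v(q) = d(v) + (1-t)/(1+t) (d(q) - d(v))`, used for `v = |u|`. -/
def phiFun (ξ x : ℝ → ℝ) (t v q : ℝ) : ℝ :=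
  dFun ξ x v + (1 - t) / (1 + t) * (dFun ξ x q - dFun ξ x v)

/-- A sign `η ∈ {1,-1}` with `u = η |u|`. -/
def eta (u : ℝ) : ℝ := if 0 ≤ u then 1 else -1

/-- The functional `T_u(x,b,λ)`, with `l` for `λ`. -/
def TFun (ξ x : ℝ → ℝ) (t u b l : ℝ) : ℝ :=
  Real.log √(b ^ 2 / (b ^ 2 - l ^ 2))
    + (1 + t) / 2 * (∫ s in (0 : ℝ)..|u|, xi2 ξ s / (b - eta u * l - dFun ξ x s))
    + (1 - t) / 2 * (∫ s in (0 : ℝ)..|u|, xi2 ξ s / (b + eta u * l - phiFun ξ x t |u| s))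
    + 1 / 2 * (∫ s in |u|..1, xi2 ξ s / (b - l - dFun ξ x s))
    + 1 / 2 * (∫ s in |u|..1, xi2 ξ s / (b + l - dFun ξ x s))
    - l * u + b - 1 - Real.log b - (∫ q in (0 : ℝ)..1, q * xi2 ξ q * x q)

/-- The functional `P_u(x,b,λ)`, with `l` for `λ`. -/
def PFun (ξ x : ℝ → ℝ) (t h u b l : ℝ) : ℝ :=
  if 0 ≤ u then TFun ξ x t u b l + h ^ 2 / (b - l - dFun ξ x 0)
  else TFun ξ x t u b l + h ^ 2 / (b - l - phiFun ξ x t |u| 0)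

end SphericalSpinGlass

end

set_option linter.unusedSectionVars false

open scoped ENNReal Pointwise

noncomputable section

namespace SphericalSpinGlass

section

/-! ### Centred Gaussian measures and integration by parts -/

/-! This is Guerra's replica symmetry breaking bound for two replicas whose overlap is held near u,
proved with a nested recursion of Gaussian averages and powers in place of random cascades.

Comparison. In `recE` a level with exponent r in (0,1] sends G to E G(· + g)^r. Two families of
noises, with covariances A_i and B_i, are joined along sin φ a + cos φ b for φ in [0,π/2]; this
parametrization is smooth up to both endpoints. Integration by parts turns the φ-derivative of an
average into sin φ cos φ ∑ (A-B)_{kl} ∂_k∂_l. The inequality `HeatIneq` therefore travels from the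
innermost level outward: averaging replaces D by D-(A-B), and a concave power only helps as long as
the entries of D and the first derivatives are nonnegative. If all partial sums of A_i-B_i are
entrywise nonnegative, the interpolation decreases; this is `recE_le_recE`.

Choice of noises. The first family consists of the Hamiltonian at an outer level followed by
constant noises whose variances are increments of `theta`; the second consists of noises linear in
the configurations, whose variances are increments of ξ'. The partial sums are then gaps
ξ(R)+θ(q)-Rξ'(q) between ξ and its tangent at q_i (at min(q_i,|u|) for the cross overlaps),
nonnegative by convexity. At the last level the gaps on the diagonal almost vanish, because ηR is
close to |u|. Sending the exponent of the Hamiltonian's level to 0 produces E log Z: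
`guerra_finite`, `guerra_pairs`.

From finitely many configurations to the sphere. Z is compared with an empirical mean over
independent samples (`IsWeight.integral_log_avgOver_le`), and Jensen's inequality for the recursion
(`lintegral_recE_le`) averages over the samples on the other side.

Evaluation. What remains are exponentials linear in the pair. The overlap constraint is relaxed by
the multiplier λ, and the spheres are replaced by Gaussian vectors with precision matrix
[[b,-λ],[-λ,b]] at the cost `pairCost`. The directions (1,±η)/√2 diagonalize both this matrix and
the noises, so that one-dimensional Gaussian integrals suffice (`recE_quadratic_le`). The exponents
x/(1+t) below |u| and x above it make the precisions follow `dFun` and `phiFun`; refining the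
partition gives the integrals (`exists_levelBound_le`). -/

lemma hasDerivAt_gaussianPDFReal_zero (v : NNReal) (hv : v ≠ 0) (x : ℝ) :
    HasDerivAt (gaussianPDFReal 0 v) (-(x / v) * gaussianPDFReal 0 v x) x := by
  have hv' : (v : ℝ) ≠ 0 := by exact_mod_cast hv
  unfold gaussianPDFReal
  have h : HasDerivAt (fun x : ℝ => -(x - 0) ^ 2 / (2 * (v : ℝ))) (-(x / v)) x := by
    have := ((((hasDerivAt_id x).sub_const 0).pow 2).neg).div_const (2 * (v : ℝ))
    refine this.congr_deriv ?_
    simp only [id_eq, sub_zero]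
    field_simp
    push_cast
    ring
  refine (h.exp.const_mul (√(2 * Real.pi * v))⁻¹).congr_deriv ?_
  ring

lemma integrable_exp_mul_abs_gaussianReal (v : NNReal) (c : ℝ) :
    Integrable (fun t : ℝ => Real.exp (c * |t|)) (gaussianReal 0 v) := by
  refine Integrable.mono' ((integrable_exp_mul_gaussianReal (μ := 0) (v := v) c).add
    (integrable_exp_mul_gaussianReal (μ := 0) (v := v) (-c))) (by fun_prop) ?_
  filter_upwards with t
  rw [Real.norm_eq_abs, abs_of_pos (Real.exp_pos _)]
  simp only [Pi.add_apply]
  rcases abs_cases t with ⟨h, _⟩ | ⟨h, _⟩ <;> rw [h]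
  · linarith [Real.exp_pos (-c * t)]
  · rw [mul_neg, ← neg_mul]; linarith [Real.exp_pos (c * t)]

lemma le_exp_abs (c t : ℝ) : |t| * Real.exp (c * |t|) ≤ Real.exp ((c + 1) * |t|) := by
  rw [add_mul, one_mul, add_comm, Real.exp_add]
  have := Real.add_one_le_exp |t|
  gcongr
  linarith

/-- One-dimensional Gaussian integration by parts. -/
lemma integral_mul_gaussianReal_eq (v : NNReal) (f f' : ℝ → ℝ)
    (hf : ∀ x, HasDerivAt f (f' x) x) {C c : ℝ} (hfb : ∀ x, |f x| ≤ C * Real.exp (c * |x|))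
    (hfb' : ∀ x, |f' x| ≤ C * Real.exp (c * |x|)) :
    ∫ x, x * f x ∂(gaussianReal 0 v) = v * ∫ x, f' x ∂(gaussianReal 0 v) := by
  by_cases hv : v = 0
  · subst hv
    simp
  have hv' : (v : ℝ) ≠ 0 := by exact_mod_cast hv
  have hfc : Continuous f := continuous_iff_continuousAt.2 fun x => (hf x).continuousAt
  have hf'm : Measurable f' := by
    have : f' = deriv f := by ext x; exact (hf x).deriv.symm
    rw [this]; exact measurable_deriv f
  have hg : ∀ {g : ℝ → ℝ}, AEStronglyMeasurable g (volume : Measure ℝ) →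
      ∀ c C : ℝ, (∀ x, |g x| ≤ C * Real.exp (c * |x|)) →
      Integrable (fun x => g x * gaussianPDFReal 0 v x) := by
    intro g hgm c C hgb
    have h1 := (integrable_exp_mul_abs_gaussianReal v c).const_mul C
    rw [gaussianReal_of_var_ne_zero 0 hv] at h1
    have h2 := (integrable_withDensity_iff (measurable_gaussianPDF 0 v)
      (Eventually.of_forall fun x => gaussianPDF_lt_top)).1 h1
    simp only [toReal_gaussianPDF] at h2
    refine h2.mono' (hgm.mul (by fun_prop)) ?_
    filter_upwards with x
    rw [norm_mul, Real.norm_eq_abs, Real.norm_eq_abs, abs_of_nonneg (gaussianPDFReal_nonneg 0 v x)]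
    exact mul_le_mul_of_nonneg_right (hgb x) (gaussianPDFReal_nonneg 0 v x)
  have hC : 0 ≤ C := by have := (abs_nonneg _).trans (hfb 0); simpa using this
  have hxf : ∀ x : ℝ, |x * f x| ≤ C * Real.exp ((c + 1) * |x|) := by
    intro x
    rw [abs_mul]
    calc |x| * |f x| ≤ |x| * (C * Real.exp (c * |x|)) := by gcongr; exact hfb x
      _ = C * (|x| * Real.exp (c * |x|)) := by ring
      _ ≤ _ := by gcongr; exact le_exp_abs c x
  -- The density ρ satisfies xρ = -vρ', so this is integration by parts on the whole line;
  -- integrability of the three products takes care of the boundary terms.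
  have key := integral_mul_deriv_eq_deriv_mul_of_integrable (u := f) (u' := f')
    (v := gaussianPDFReal 0 v) (v' := fun x => -(x / v) * gaussianPDFReal 0 v x)
    (fun x _ => hf x) (fun x _ => hasDerivAt_gaussianPDFReal_zero v hv x)
    (by
      have := (hg (g := fun x => x * f x) (by fun_prop) _ _ hxf).const_mul (-(1 / (v : ℝ)))
      refine this.congr (Eventually.of_forall fun x => ?_)
      simp only [Pi.mul_apply]; ring)
    (hg hf'm.aestronglyMeasurable _ _ hfb')
    (hg hfc.aestronglyMeasurable _ _ hfb)
  rw [integral_gaussianReal_eq_integral_smul hv, integral_gaussianReal_eq_integral_smul hv]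
  simp only [smul_eq_mul]
  have e1 : ∫ x, gaussianPDFReal 0 v x * (x * f x)
      = -v * ∫ x, f x * (-(x / v) * gaussianPDFReal 0 v x) := by
    rw [← integral_const_mul]
    congr 1; ext x; field_simp
  rw [e1, key]
  simp only [mul_comm (gaussianPDFReal 0 v _)]
  ring


variable {K : Type*} [Fintype K]

/-- `μ` is a centred Gaussian measure on `ℝ^K` with covariance matrix `A`. -/
structure IsGaussNoise (μ : Measure (K → ℝ)) (A : K → K → ℝ) : Prop where
  gaussian : IsGaussian μ
  mean : ∀ k, ∫ a, a k ∂μ = 0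
  cov : ∀ k l, ∫ a, a k * a l ∂μ = A k l

namespace IsGaussNoise

variable {μ : Measure (K → ℝ)} {A : K → K → ℝ}

lemma isProbabilityMeasure (h : IsGaussNoise μ A) : IsProbabilityMeasure μ := by
  have := h.gaussian; infer_instance

lemma memLp_eval (h : IsGaussNoise μ A) (k : K) : MemLp (fun a : K → ℝ => a k) 2 μ := by
  have := h.gaussian
  have := HasGaussianLaw.map_fun (IsGaussian.hasGaussianLaw_id (μ := μ))
    (ContinuousLinearMap.proj (R := ℝ) (φ := fun _ : K => ℝ) k)
  simpa using this.memLp_two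

lemma map_eval (h : IsGaussNoise μ A) (k : K) :
    μ.map (fun a => a k) = gaussianReal 0 (A k k).toNNReal := by
  have := h.gaussian
  have hl := HasGaussianLaw.map_fun (IsGaussian.hasGaussianLaw_id (μ := μ))
    (ContinuousLinearMap.proj (R := ℝ) (φ := fun _ : K => ℝ) k)
  have hl' : HasGaussianLaw (fun a : K → ℝ => a k) μ := by simpa using hl
  have := hl'.map_eq_gaussianReal
  rw [this, h.mean k]
  congr 2
  rw [variance_eq_sub (h.memLp_eval k), h.mean k]
  simp only [Pi.pow_apply]
  rw [← h.cov k k]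
  simp [sq]

lemma diag_nonneg (h : IsGaussNoise μ A) (k : K) : 0 ≤ A k k := by
  rw [← h.cov k k]; exact integral_nonneg fun a => mul_self_nonneg _

/-- The norm is the sup norm, so exp(c‖a‖) equals one of the exp(c|a_k|), or 1 when `K` is empty.
One-dimensional exponential moments are enough. -/
lemma integrable_exp (h : IsGaussNoise μ A) (c : ℝ) :
    Integrable (fun a : K → ℝ => Real.exp (c * ‖a‖)) μ := by
  have := h.isProbabilityMeasure
  have hk : ∀ k, Integrable (fun a : K → ℝ => Real.exp (c * |a k|)) μ := by
    intro k
    have h1 := integrable_exp_mul_abs_gaussianReal (A k k).toNNReal c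
    rw [← h.map_eval k] at h1
    exact h1.comp_measurable (measurable_pi_apply k)
  refine Integrable.mono' ((integrable_const (1 : ℝ)).add
    (integrable_finsetSum Finset.univ fun k _ => hk k)) (by fun_prop) ?_
  filter_upwards with a
  rw [Real.norm_eq_abs, abs_of_pos (Real.exp_pos _)]
  have hs : 0 ≤ ∑ k, Real.exp (c * |a k|) := Finset.sum_nonneg fun k _ => (Real.exp_pos _).le
  simp only [Pi.add_apply]
  rcases isEmpty_or_nonempty K with hK | hK
  · have : ‖a‖ = 0 := by rw [norm_eq_zero]; exact Subsingleton.elim _ _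
    rw [this]; simp
  · obtain ⟨k, hk'⟩ : ∃ k, ‖a‖ = ‖a k‖ := by
      obtain ⟨k, -, hk⟩ := Finset.exists_mem_eq_sup' Finset.univ_nonempty (fun k => ‖a k‖₊)
      refine ⟨k, ?_⟩
      rw [Pi.norm_def, ← Finset.sup'_eq_sup Finset.univ_nonempty, hk]
      rfl
    rw [hk', Real.norm_eq_abs]
    have := Finset.single_le_sum (f := fun k => Real.exp (c * |a k|))
      (fun k _ => (Real.exp_pos _).le) (Finset.mem_univ k)
    linarith

lemma integrable_of_le_exp (h : IsGaussNoise μ A) {F : Type*} [NormedAddCommGroup F]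
    {f : (K → ℝ) → F} (hf : AEStronglyMeasurable f μ) {C c : ℝ}
    (hb : ∀ a, ‖f a‖ ≤ C * Real.exp (c * ‖a‖)) : Integrable f μ :=
  ((h.integrable_exp c).const_mul C).mono' hf (Eventually.of_forall hb)

/-- Gaussian integration by parts. -/
theorem integral_eval_mul (h : IsGaussNoise μ A) (k : K) {H : (K → ℝ) → ℝ}
    (hH : Differentiable ℝ H) {C c : ℝ} (hc : 0 ≤ c) (hb : ∀ a, |H a| ≤ C * Real.exp (c * ‖a‖))
    (hb' : ∀ a, ‖fderiv ℝ H a‖ ≤ C * Real.exp (c * ‖a‖)) :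
    ∫ a, a k * H a ∂μ = ∫ a, fderiv ℝ H a (A k) ∂μ := by
  have hG := h.gaussian
  have hP := h.isProbabilityMeasure
  have hC : 0 ≤ C := by have := (abs_nonneg _).trans (hb 0); simpa using this
  set v := (A k k).toNNReal with hv
  have hvk : (v : ℝ) = A k k := Real.coe_toNNReal _ (h.diag_nonneg k)
  by_cases hz : A k k = 0
  · have h0 : ∀ᵐ a ∂μ, a k = 0 := by
      have h1 := h.map_eval k
      rw [hz, Real.toNNReal_zero, gaussianReal_zero_var] at h1
      have h2 : ∀ᵐ t ∂(μ.map (fun a : K → ℝ => a k)), t = 0 := by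
        rw [h1]
        exact (ae_dirac_iff (measurableSet_singleton (0 : ℝ))).2 rfl
      exact ae_of_ae_map (measurable_pi_apply k).aemeasurable h2
    have hA : A k = 0 := by
      ext l
      rw [← h.cov k l]
      rw [integral_eq_zero_of_ae]
      · rfl
      filter_upwards [h0] with a ha
      simp [ha]
    rw [hA]
    simp only [map_zero, integral_zero]
    apply integral_eq_zero_of_ae
    filter_upwards [h0] with a ha
    simp [ha]
  -- Regression on a_k: a = a_k e + w, where w is uncorrelated with a_k and hence independent of it
  -- by joint Gaussianity. With w frozen, the one-dimensional formula applies along the direction e.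
  · set e : K → ℝ := fun l => A k l / A k k with he
    have hek : e k = 1 := div_self hz
    have hL : HasGaussianLaw (fun a : K → ℝ =>
        ((fun _ : Unit => a k), fun l => a l - a k * e l)) μ := by
      have := HasGaussianLaw.map_fun (IsGaussian.hasGaussianLaw_id (μ := μ))
        ((ContinuousLinearMap.pi fun _ : Unit =>
            ContinuousLinearMap.proj (R := ℝ) (φ := fun _ : K => ℝ) k).prod
          (ContinuousLinearMap.pi fun l : K =>
            ContinuousLinearMap.proj (R := ℝ) (φ := fun _ : K => ℝ) l
              - (e l) • ContinuousLinearMap.proj (R := ℝ) (φ := fun _ : K => ℝ) k))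
      refine this.congr (Eventually.of_forall fun a => ?_)
      refine Prod.ext (by ext; simp) ?_
      ext l
      simp [mul_comm]
    have hind := HasGaussianLaw.indepFun_of_covariance_eval (X := fun (_ : Unit) (a : K → ℝ) => a k)
      (Y := fun l (a : K → ℝ) => a l - a k * e l) hL (by
        intro _ l
        have hm : MemLp (fun a : K → ℝ => a l - a k * e l) 2 μ :=
          (h.memLp_eval l).sub ((h.memLp_eval k).mul_const (e l))
        rw [covariance_eq_sub (h.memLp_eval k) hm, h.mean k, zero_mul, sub_zero]
        simp only [Pi.mul_apply]
        have : ∀ a : K → ℝ, a k * (a l - a k * e l) = a k * a l - (a k * a k) * e l := by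
          intro a; ring
        simp_rw [this]
        have i1 : ∀ l, Integrable (fun a : K → ℝ => a k * a l) μ := fun l =>
          (h.memLp_eval k).integrable_mul (h.memLp_eval l)
        rw [integral_sub (i1 l) ((i1 k).mul_const _), integral_mul_const, h.cov, h.cov, he]
        field_simp
        ring)
    have hind' : IndepFun (fun a : K → ℝ => a k) (fun a l => a l - a k * e l) μ :=
      hind.comp (φ := fun f : Unit → ℝ => f ()) (ψ := id) (measurable_pi_apply _) measurable_id
    have hmw : Measurable (fun (a : K → ℝ) l => a l - a k * e l) := by fun_prop
    have hlaw := (indepFun_iff_map_prod_eq_prod_map_map (measurable_pi_apply k).aemeasurable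
      hmw.aemeasurable).1 hind'
    rw [h.map_eval k] at hlaw
    set ν := μ.map (fun (a : K → ℝ) l => a l - a k * e l) with hν
    have : IsProbabilityMeasure ν := Measure.isProbabilityMeasure_map hmw.aemeasurable
    have hpm : Measurable (fun a : K → ℝ => (a k, fun l => a l - a k * e l)) := by fun_prop
    have hrec : ∀ a : K → ℝ, (a k) • e + (fun l => a l - a k * e l) = a := by
      intro a; ext l; simp
    have hDm : Measurable (fun a => fderiv ℝ H a e) := measurable_fderiv_apply_const ℝ H e
    have hbD : ∀ a, |fderiv ℝ H a e| ≤ (C * ‖e‖) * Real.exp (c * ‖a‖) := by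
      intro a
      calc |fderiv ℝ H a e| ≤ ‖fderiv ℝ H a‖ * ‖e‖ := (fderiv ℝ H a).le_opNorm e
        _ ≤ (C * Real.exp (c * ‖a‖)) * ‖e‖ := by gcongr; exact hb' a
        _ = _ := by ring
    have hi1 : Integrable (fun a => a k * H a) μ := by
      refine h.integrable_of_le_exp (C := C) (c := c + 1)
        ((measurable_pi_apply k).mul hH.continuous.measurable).aestronglyMeasurable ?_
      intro a
      rw [norm_mul]
      calc ‖a k‖ * ‖H a‖ ≤ ‖a‖ * (C * Real.exp (c * ‖a‖)) := by
            gcongr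
            · exact norm_le_pi_norm a k
            · exact hb a
        _ = C * (|‖a‖| * Real.exp (c * |‖a‖|)) := by rw [abs_norm]; ring
        _ ≤ C * Real.exp ((c + 1) * |‖a‖|) := by gcongr; exact le_exp_abs c _
        _ = _ := by rw [abs_norm]
    have hi2 : Integrable (fun a => fderiv ℝ H a e) μ :=
      h.integrable_of_le_exp hDm.aestronglyMeasurable hbD
    have trans : ∀ {f : (K → ℝ) → ℝ}, Measurable f → Integrable f μ →
        ∫ a, f a ∂μ = ∫ w, ∫ t, f (t • e + w) ∂(gaussianReal 0 v) ∂ν := by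
      intro f hfm hfi
      have hm2 : Measurable (fun p : ℝ × (K → ℝ) => f (p.1 • e + p.2)) := by fun_prop
      have h1 : ∫ a, f a ∂μ = ∫ p, f (p.1 • e + p.2) ∂((gaussianReal 0 v).prod ν) := by
        rw [← hlaw, integral_map hpm.aemeasurable hm2.aestronglyMeasurable]
        simp_rw [hrec]
      have hi : Integrable (fun p : ℝ × (K → ℝ) => f (p.1 • e + p.2))
          ((gaussianReal 0 v).prod ν) := by
        rw [← hlaw, integrable_map_measure hm2.aestronglyMeasurable hpm.aemeasurable]
        simpa [Function.comp_def, hrec] using hfi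
      rw [h1, integral_prod_symm _ hi]
    rw [trans (f := fun a => a k * H a)
      ((measurable_pi_apply k).mul hH.continuous.measurable) hi1]
    have hAe : A k = (A k k) • e := by ext l; simp [he]; field_simp
    have hA2 : (fun a => fderiv ℝ H a (A k)) = fun a => A k k * fderiv ℝ H a e := by
      ext a; rw [hAe, map_smul, smul_eq_mul, ← hAe]
    rw [hA2, integral_const_mul, trans hDm hi2, ← integral_const_mul]
    -- Since e_k = 1 the residual has no k-th coordinate, so a_k is exactly the one-dimensional
    -- variable t.
    have hw0 : ∀ᵐ w ∂ν, w k = 0 := by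
      rw [hν]
      refine (ae_map_iff hmw.aemeasurable (measurableSet_eq_fun (measurable_pi_apply k)
        measurable_const)).2 ?_
      filter_upwards with a
      simp [hek]
    apply integral_congr_ae
    filter_upwards [hw0] with w hw
    have hsimp : ∀ t : ℝ, (t • e + w) k = t := by intro t; simp [hek, hw]
    simp only [hsimp]
    rw [← hvk]
    have hn : ∀ t : ℝ, ‖t • e + w‖ ≤ ‖e‖ * |t| + ‖w‖ := by
      intro t
      calc ‖t • e + w‖ ≤ ‖t • e‖ + ‖w‖ := norm_add_le _ _
        _ = _ := by rw [norm_smul, Real.norm_eq_abs]; ring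
    have hexp : ∀ t : ℝ, Real.exp (c * ‖t • e + w‖)
        ≤ Real.exp (c * ‖w‖) * Real.exp ((c * ‖e‖) * |t|) := by
      intro t
      rw [← Real.exp_add]
      apply Real.exp_le_exp.2
      nlinarith [hn t, mul_le_mul_of_nonneg_left (hn t) hc]
    refine integral_mul_gaussianReal_eq v (fun t => H (t • e + w))
      (fun t => fderiv ℝ H (t • e + w) e)
      (C := (C + C * ‖e‖) * Real.exp (c * ‖w‖)) (c := c * ‖e‖) ?_ ?_ ?_
    · intro t
      have h1 : HasDerivAt (fun t : ℝ => t • e + w) e t := by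
        simpa using ((hasDerivAt_id t).smul_const e).add_const w
      exact ((hH (t • e + w)).hasFDerivAt.comp_hasDerivAt t h1)
    · intro t
      calc |H (t • e + w)| ≤ C * Real.exp (c * ‖t • e + w‖) := hb _
        _ ≤ (C + C * ‖e‖) * (Real.exp (c * ‖w‖) * Real.exp ((c * ‖e‖) * |t|)) := by
            gcongr
            · nlinarith [norm_nonneg e]
            · exact hexp t
        _ = _ := by ring
    · intro t
      calc _ ≤ (C * ‖e‖) * Real.exp (c * ‖t • e + w‖) := hbD _
        _ ≤ (C + C * ‖e‖) * (Real.exp (c * ‖w‖) * Real.exp ((c * ‖e‖) * |t|)) := by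
            gcongr
            · nlinarith [norm_nonneg e]
            · exact hexp t
        _ = _ := by ring

end IsGaussNoise

end

section

variable {K : Type*} [Fintype K]

/-! ### Positive functions whose logarithmic derivatives are bounded -/

/-- The derivative in the space variable. -/
def d1 (G : ℝ × (K → ℝ) → ℝ) (φ : ℝ) (y : K → ℝ) : (K → ℝ) →L[ℝ] ℝ :=
  fderiv ℝ (fun y' => G (φ, y')) y

/-- The second derivative in the space variable. -/
def d2 (G : ℝ × (K → ℝ) → ℝ) (φ : ℝ) (y : K → ℝ) : (K → ℝ) →L[ℝ] (K → ℝ) →L[ℝ] ℝ :=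
  fderiv ℝ (d1 G φ) y

/-- A positive function `G(φ,y)`, once differentiable jointly and twice in `y`, whose derivatives
are bounded by a multiple of `G`. -/
structure Tame (G : ℝ × (K → ℝ) → ℝ) (C : ℝ) : Prop where
  pos : ∀ z, 0 < G z
  diff : Differentiable ℝ G
  bound : ∀ z, ‖fderiv ℝ G z‖ ≤ C * G z
  diff2 : ∀ φ, Differentiable ℝ (d1 G φ)
  bound2 : ∀ φ y, ‖d2 G φ y‖ ≤ C * G (φ, y)

namespace Tame

variable {G : ℝ × (K → ℝ) → ℝ} {C : ℝ}

lemma nonneg (h : Tame G C) : 0 ≤ C := by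
  have h1 := (norm_nonneg _).trans (h.bound 0)
  exact nonneg_of_mul_nonneg_left h1 (h.pos 0)

lemma mono (h : Tame G C) {C' : ℝ} (hC : C ≤ C') : Tame G C' where
  pos := h.pos
  diff := h.diff
  bound z := (h.bound z).trans (mul_le_mul_of_nonneg_right hC (h.pos z).le)
  diff2 := h.diff2
  bound2 φ y := (h.bound2 φ y).trans (mul_le_mul_of_nonneg_right hC (h.pos _).le)

/-- The gradient of log G is ∇G/G, so log G is C-Lipschitz. This exponential growth bound supplies
the domination for every differentiation under the integral below. -/
lemma le_mul_exp (h : Tame G C) (z w : ℝ × (K → ℝ)) : G w ≤ G z * Real.exp (C * ‖w - z‖) := by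
  have hd : ∀ x, HasFDerivAt (fun x => Real.log (G x)) ((G x)⁻¹ • fderiv ℝ G x) x := fun x =>
    (h.diff x).hasFDerivAt.log (h.pos x).ne'
  have hb : ∀ x ∈ (univ : Set (ℝ × (K → ℝ))), ‖(G x)⁻¹ • fderiv ℝ G x‖ ≤ C := by
    intro x _
    rw [norm_smul, Real.norm_eq_abs, abs_of_pos (inv_pos.2 (h.pos x)), inv_mul_le_iff₀ (h.pos x)]
    linarith [h.bound x]
  have := convex_univ.norm_image_sub_le_of_norm_hasFDerivWithin_le
    (fun x _ => (hd x).hasFDerivWithinAt) hb (mem_univ z) (mem_univ w)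
  have h2 := (le_abs_self _).trans this
  have h3 : Real.log (G w) ≤ Real.log (G z) + C * ‖w - z‖ := by linarith
  calc G w = Real.exp (Real.log (G w)) := (Real.exp_log (h.pos w)).symm
    _ ≤ Real.exp (Real.log (G z) + C * ‖w - z‖) := Real.exp_le_exp.2 h3
    _ = _ := by rw [Real.exp_add, Real.exp_log (h.pos z)]

lemma d1_eq (h : Tame G C) (φ : ℝ) (y : K → ℝ) :
    d1 G φ y = (fderiv ℝ G (φ, y)).comp (ContinuousLinearMap.inr ℝ ℝ (K → ℝ)) := by
  have h1 : HasFDerivAt (fun y' : K → ℝ => (φ, y')) (ContinuousLinearMap.inr ℝ ℝ (K → ℝ)) y :=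
    hasFDerivAt_prodMk_right φ y
  exact ((h.diff (φ, y)).hasFDerivAt.comp y h1).fderiv

lemma hasFDerivAt_slice (h : Tame G C) (φ : ℝ) (y : K → ℝ) :
    HasFDerivAt (fun y' => G (φ, y')) (d1 G φ y) y := by
  have h1 : HasFDerivAt (fun y' : K → ℝ => (φ, y')) (ContinuousLinearMap.inr ℝ ℝ (K → ℝ)) y :=
    hasFDerivAt_prodMk_right φ y
  exact ((h.diff (φ, y)).hasFDerivAt.comp y h1).differentiableAt.hasFDerivAt

lemma norm_d1_le (h : Tame G C) (φ : ℝ) (y : K → ℝ) : ‖d1 G φ y‖ ≤ C * G (φ, y) := by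
  rw [h.d1_eq]
  calc _ ≤ ‖fderiv ℝ G (φ, y)‖ * ‖ContinuousLinearMap.inr ℝ ℝ (K → ℝ)‖ :=
        ContinuousLinearMap.opNorm_comp_le _ _
    _ ≤ ‖fderiv ℝ G (φ, y)‖ * 1 := by
        gcongr; exact ContinuousLinearMap.norm_inr_le_one ℝ ℝ (K → ℝ)
    _ ≤ _ := by rw [mul_one]; exact h.bound _

end Tame

/-- `∂_φ G + sin φ cos φ ∑ D_{kl} ∂_k∂_l G ≤ 0` on `[0,π/2]`, and `G` is nondecreasing in each
space coordinate. -/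
structure HeatIneq (G : ℝ × (K → ℝ) → ℝ) (D : K → K → ℝ) [DecidableEq K] : Prop where
  mono : ∀ φ y k, 0 ≤ d1 G φ y (Pi.single k 1)
  ineq : ∀ φ ∈ Icc 0 (Real.pi / 2), ∀ y, fderiv ℝ G (φ, y) (1, 0) + Real.sin φ * Real.cos φ *
    ∑ k, ∑ l, D k l * d2 G φ y (Pi.single l 1) (Pi.single k 1) ≤ 0

/-! ### Powers -/

section rpow

lemma norm_smul_add_smulRight_le {E F : Type*} [NormedAddCommGroup E] [NormedSpace ℝ E]
    [NormedAddCommGroup F] [NormedSpace ℝ F] (a b : ℝ) (T : E →L[ℝ] F) (S : E →L[ℝ] ℝ) (w : F) :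
    ‖a • T + (b • S).smulRight w‖ ≤ |a| * ‖T‖ + |b| * ‖S‖ * ‖w‖ := by
  refine (norm_add_le _ _).trans ?_
  rw [ContinuousLinearMap.norm_smulRight_apply, norm_smul, norm_smul, Real.norm_eq_abs,
    Real.norm_eq_abs]

variable {G : ℝ × (K → ℝ) → ℝ} {C : ℝ}

lemma Tame.fderiv_rpow (h : Tame G C) (r : ℝ) (z : ℝ × (K → ℝ)) :
    HasFDerivAt (fun z => G z ^ r) ((r * G z ^ (r - 1)) • fderiv ℝ G z) z :=
  (h.diff z).hasFDerivAt.rpow_const (Or.inl (h.pos z).ne')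

lemma Tame.d1_rpow (h : Tame G C) (r φ : ℝ) (y : K → ℝ) :
    d1 (fun z => G z ^ r) φ y = (r * G (φ, y) ^ (r - 1)) • d1 G φ y :=
  ((h.hasFDerivAt_slice φ y).rpow_const (Or.inl (h.pos _).ne')).fderiv

lemma Tame.hasFDerivAt_d1_rpow (h : Tame G C) (r φ : ℝ) (y : K → ℝ) :
    HasFDerivAt (d1 (fun z => G z ^ r) φ)
      ((r * G (φ, y) ^ (r - 1)) • d2 G φ y +
        (((r * (r - 1)) * G (φ, y) ^ (r - 2)) • d1 G φ y).smulRight (d1 G φ y)) y := by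
  have h0 : d1 (fun z => G z ^ r) φ = fun y => (r * G (φ, y) ^ (r - 1)) • d1 G φ y := by
    ext1 y; exact h.d1_rpow r φ y
  rw [h0]
  have h1 := ((h.hasFDerivAt_slice φ y).rpow_const (p := r - 1) (Or.inl (h.pos _).ne')).const_mul r
  have h2 := h1.smul (h.diff2 φ y).hasFDerivAt
  refine h2.congr_fderiv ?_
  have : r - 1 - 1 = r - 2 := by ring
  rw [this, smul_smul, mul_assoc]
  rfl

/-- Every term in the derivatives of G^r is homogeneous of degree r in G and its derivatives, so
bounds proportional to G become bounds proportional to G^r. -/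
lemma Tame.rpow (h : Tame G C) (r : ℝ) : ∃ C', Tame (fun z => G z ^ r) C' := by
  have hC := h.nonneg
  refine ⟨max (|r| * C) (|r| * C + |r * (r - 1)| * (C * C)), ?_⟩
  have hle : ∀ {a b c : ℝ}, 0 ≤ c → a ≤ b * c → ∀ d, a ≤ max b d * c ∧ a ≤ max d b * c :=
    fun hc hab d => ⟨hab.trans (mul_le_mul_of_nonneg_right (le_max_left _ _) hc),
      hab.trans (mul_le_mul_of_nonneg_right (le_max_right _ _) hc)⟩
  have e1 : ∀ z, G z ^ (r - 1) * G z = G z ^ r := by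
    intro z
    rw [Real.rpow_sub_one (h.pos z).ne', div_mul_cancel₀ _ (h.pos z).ne']
  have e2 : ∀ z, G z ^ (r - 2) * (G z * G z) = G z ^ r := by
    intro z
    have : r - 2 = (r - 1) - 1 := by ring
    rw [this, Real.rpow_sub_one (h.pos z).ne', ← e1 z]
    field_simp [(h.pos z).ne']
  refine ⟨fun z => Real.rpow_pos_of_pos (h.pos z) r, fun z => (h.fderiv_rpow r z).differentiableAt,
    fun z => ?_, fun φ y => (h.hasFDerivAt_d1_rpow r φ y).differentiableAt, fun φ y => ?_⟩
  · refine (hle (Real.rpow_pos_of_pos (h.pos z) r).le ?_ _).1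
    rw [(h.fderiv_rpow r z).fderiv, norm_smul, Real.norm_eq_abs, abs_mul,
      abs_of_pos (Real.rpow_pos_of_pos (h.pos z) _)]
    calc |r| * G z ^ (r - 1) * ‖fderiv ℝ G z‖ ≤ |r| * G z ^ (r - 1) * (C * G z) := by
          have := (Real.rpow_pos_of_pos (h.pos z) (r - 1)).le
          gcongr; exact h.bound z
      _ = |r| * C * (G z ^ (r - 1) * G z) := by ring
      _ = _ := by rw [e1]
  · refine (hle (Real.rpow_pos_of_pos (h.pos (φ, y)) r).le ?_ _).2
    have p1 := (Real.rpow_pos_of_pos (h.pos (φ, y)) (r - 1)).le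
    have p2 := (Real.rpow_pos_of_pos (h.pos (φ, y)) (r - 2)).le
    rw [d2, (h.hasFDerivAt_d1_rpow r φ y).fderiv]
    refine le_trans (norm_smul_add_smulRight_le _ _ _ _ _) ?_
    rw [abs_mul, abs_mul (r * (r - 1)), abs_of_nonneg p1, abs_of_nonneg p2]
    have b1 := h.norm_d1_le φ y
    have b2 := h.bound2 φ y
    calc |r| * G (φ, y) ^ (r - 1) * ‖d2 G φ y‖
          + |r * (r - 1)| * G (φ, y) ^ (r - 2) * ‖d1 G φ y‖ * ‖d1 G φ y‖
        ≤ |r| * G (φ, y) ^ (r - 1) * (C * G (φ, y))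
          + |r * (r - 1)| * G (φ, y) ^ (r - 2) * (C * G (φ, y)) * (C * G (φ, y)) := by
          have := (h.pos (φ, y)).le
          gcongr
      _ = |r| * C * (G (φ, y) ^ (r - 1) * G (φ, y))
          + |r * (r - 1)| * (C * C) * (G (φ, y) ^ (r - 2) * (G (φ, y) * G (φ, y))) := by ring
      _ = _ := by rw [e1, e2]; ring

variable [DecidableEq K]

/-- Besides r G^{r-1} times the old inequality, the power creates r(r-1)G^{r-2} ∑ D_{kl} ∂_kG ∂_lG.
It is nonpositive because r ≤ 1 and both D and the partial derivatives are nonnegative. This is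
where the entrywise sign of D is needed. -/
lemma HeatIneq.rpow {D : K → K → ℝ} (h : Tame G C) (hG : HeatIneq G D) (hD : ∀ k l, 0 ≤ D k l)
    {r : ℝ} (hr0 : 0 ≤ r) (hr1 : r ≤ 1) : HeatIneq (fun z => G z ^ r) D where
  mono φ y k := by
    rw [h.d1_rpow]
    have := Real.rpow_pos_of_pos (h.pos (φ, y)) (r - 1)
    exact mul_nonneg (by positivity) (hG.mono φ y k)
  ineq φ hφ y := by
    have p1 := (Real.rpow_pos_of_pos (h.pos (φ, y)) (r - 1)).le
    have p2 := (Real.rpow_pos_of_pos (h.pos (φ, y)) (r - 2)).le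
    have hsc : 0 ≤ Real.sin φ * Real.cos φ := by
      have hpi := Real.pi_pos
      exact mul_nonneg (Real.sin_nonneg_of_nonneg_of_le_pi hφ.1 (by linarith [hφ.2]))
        (Real.cos_nonneg_of_neg_pi_div_two_le_of_le (by linarith [hφ.1]) hφ.2)
    rw [(h.fderiv_rpow r _).fderiv, d2, (h.hasFDerivAt_d1_rpow r φ y).fderiv]
    simp only [smul_apply, add_apply,
      ContinuousLinearMap.smulRight_apply, smul_eq_mul, mul_add, Finset.sum_add_distrib]
    have e1 : ∑ k, ∑ l, D k l * (r * G (φ, y) ^ (r - 1) *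
        d2 G φ y (Pi.single l 1) (Pi.single k 1)) = r * G (φ, y) ^ (r - 1) *
        ∑ k, ∑ l, D k l * d2 G φ y (Pi.single l 1) (Pi.single k 1) := by
      simp_rw [Finset.mul_sum]
      refine Finset.sum_congr rfl fun k _ => Finset.sum_congr rfl fun l _ => by ring
    have e2 : ∑ k, ∑ l, D k l * (r * (r - 1) * G (φ, y) ^ (r - 2) * d1 G φ y (Pi.single l 1) *
        d1 G φ y (Pi.single k 1)) ≤ 0 := by
      refine Finset.sum_nonpos fun k _ => Finset.sum_nonpos fun l _ => ?_
      have h1 := hG.mono φ y k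
      have h2 := hG.mono φ y l
      have h3 : 0 ≤ (r * (1 - r)) * (D k l * G (φ, y) ^ (r - 2) * d1 G φ y (Pi.single l 1) *
        d1 G φ y (Pi.single k 1)) := by
        have := hD k l
        have : 0 ≤ 1 - r := by linarith
        positivity
      nlinarith [h3]
    rw [e1]
    have h4 := mul_nonneg (mul_nonneg hr0 p1) (neg_nonneg.2 (hG.ineq φ hφ y))
    have h5 := mul_nonneg hsc (neg_nonneg.2 e2)
    nlinarith [h4, h5]

end rpow

end

section

variable {K : Type*} [Fintype K]

/-! ### Averaging over Gaussian noise -/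

/-- Differentiation of a smoothed function, under an exponential bound. -/
lemma hasFDerivAt_integral_translate {Ω F : Type*} [MeasurableSpace Ω] {P : Measure Ω}
    [NormedAddCommGroup F] [NormedSpace ℝ F] [CompleteSpace F] [MeasurableSpace F] [BorelSpace F]
    [SecondCountableTopology F]
    {w : Ω → K → ℝ} (hw : Measurable w) (hexp : ∀ c : ℝ, Integrable (fun ω => Real.exp (c * ‖w ω‖)) P)
    {g : (K → ℝ) → ℝ} {C : ℝ} (hC : 0 ≤ C) (hg0 : ∀ y, 0 ≤ g y)
    (hg : ∀ y z, g z ≤ g y * Real.exp (C * ‖z - y‖))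
    {f : (K → ℝ) → F} (hf : Differentiable ℝ f) (hfb : ∀ y, ‖f y‖ ≤ C * g y)
    (hfb' : ∀ y, ‖fderiv ℝ f y‖ ≤ C * g y) (y : K → ℝ) :
    HasFDerivAt (fun y => ∫ ω, f (y + w ω) ∂P) (∫ ω, fderiv ℝ f (y + w ω) ∂P) y := by
  have hb : ∀ z ∈ Metric.ball y 1, ∀ ω, C * g (z + w ω)
      ≤ (C * g y * Real.exp C) * Real.exp (C * ‖w ω‖) := by
    intro z hz ω
    have h1 : ‖z + w ω - y‖ ≤ 1 + ‖w ω‖ := by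
      have : z + w ω - y = (z - y) + w ω := by abel
      rw [this]
      refine (norm_add_le _ _).trans ?_
      have := mem_ball_iff_norm.1 hz
      linarith
    calc C * g (z + w ω) ≤ C * (g y * Real.exp (C * ‖z + w ω - y‖)) := by gcongr; exact hg _ _
      _ ≤ C * (g y * Real.exp (C * (1 + ‖w ω‖))) := by
          have := hg0 y
          gcongr
      _ = _ := by rw [mul_add, Real.exp_add, mul_one]; ring
  have hy : y ∈ Metric.ball y 1 := Metric.mem_ball_self one_pos
  have hint := ((hexp C).const_mul (C * g y * Real.exp C))
  have hm : ∀ z, Measurable (fun ω => f (z + w ω)) := fun z =>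
    hf.continuous.measurable.comp (measurable_const.add hw)
  refine hasFDerivAt_integral_of_dominated_of_fderiv_le (Metric.ball_mem_nhds y one_pos)
    (F := fun y ω => f (y + w ω)) (F' := fun y ω => fderiv ℝ f (y + w ω))
    (bound := fun ω => (C * g y * Real.exp C) * Real.exp (C * ‖w ω‖))
    (Eventually.of_forall fun z => (hm z).aestronglyMeasurable) ?_ ?_ ?_ hint ?_
  · exact hint.mono' (hm y).aestronglyMeasurable
      (Eventually.of_forall fun ω => (hfb _).trans (hb y hy ω))
  · exact ((measurable_fderiv ℝ f).comp
      (measurable_const.add hw)).aestronglyMeasurable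
  · exact Eventually.of_forall fun ω z hz => (hfb' _).trans (hb z hz ω)
  · refine Eventually.of_forall fun ω z _ => ?_
    have h1 : HasFDerivAt (fun z => z + w ω) (ContinuousLinearMap.id ℝ (K → ℝ)) z :=
      (hasFDerivAt_id z).add_const _
    exact (hf (z + w ω)).hasFDerivAt.comp z h1

/-- The interpolated noise `sin φ a + cos φ b`. -/
def mixNoise (φ : ℝ) (p : (K → ℝ) × (K → ℝ)) : K → ℝ := Real.sin φ • p.1 + Real.cos φ • p.2

lemma norm_mixNoise_le (φ : ℝ) (p : (K → ℝ) × (K → ℝ)) : ‖mixNoise φ p‖ ≤ ‖p.1‖ + ‖p.2‖ := by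
  refine (norm_add_le _ _).trans ?_
  rw [norm_smul, norm_smul, Real.norm_eq_abs, Real.norm_eq_abs]
  have h1 := mul_le_of_le_one_left (norm_nonneg p.1) (Real.abs_sin_le_one φ)
  have h2 := mul_le_of_le_one_left (norm_nonneg p.2) (Real.abs_cos_le_one φ)
  linarith

lemma continuous_mixNoise (φ : ℝ) : Continuous (mixNoise (K := K) φ) := by
  unfold mixNoise; fun_prop

/-- Averaging over the interpolated noise. -/
def avg (μ ν : Measure (K → ℝ)) (G : ℝ × (K → ℝ) → ℝ) (z : ℝ × (K → ℝ)) : ℝ :=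
  ∫ p, G (z.1, z.2 + mixNoise z.1 p) ∂(μ.prod ν)

variable {μ ν : Measure (K → ℝ)} {A B : K → K → ℝ} {G : ℝ × (K → ℝ) → ℝ} {C : ℝ}

lemma integrable_exp_prod (hμ : IsGaussNoise μ A) (hν : IsGaussNoise ν B) (c : ℝ) :
    Integrable (fun p : (K → ℝ) × (K → ℝ) => Real.exp (c * (‖p.1‖ + ‖p.2‖))) (μ.prod ν) := by
  have := hμ.isProbabilityMeasure
  have := hν.isProbabilityMeasure
  have h := (hμ.integrable_exp c).mul_prod (hν.integrable_exp c)
  refine h.congr (Eventually.of_forall fun p => ?_)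
  simp only
  rw [← Real.exp_add, mul_add]

lemma integrable_exp_mixNoise (hμ : IsGaussNoise μ A) (hν : IsGaussNoise ν B) (φ c : ℝ) :
    Integrable (fun p => Real.exp (c * ‖mixNoise φ p‖)) (μ.prod ν) := by
  refine (integrable_exp_prod hμ hν |c|).mono' ?_ (Eventually.of_forall fun p => ?_)
  · exact (((continuous_mixNoise φ).norm.const_smul c).rexp).aestronglyMeasurable
  · rw [Real.norm_eq_abs, abs_of_pos (Real.exp_pos _)]
    apply Real.exp_le_exp.2
    calc c * ‖mixNoise φ p‖ ≤ |c| * ‖mixNoise φ p‖ :=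
          mul_le_mul_of_nonneg_right (le_abs_self c) (norm_nonneg _)
      _ ≤ _ := by gcongr; exact norm_mixNoise_le φ p

/-- The shift `(φ,y) ↦ (φ, y + sin φ a + cos φ b)`. -/
def shift (p : (K → ℝ) × (K → ℝ)) (z : ℝ × (K → ℝ)) : ℝ × (K → ℝ) := (z.1, z.2 + mixNoise z.1 p)

/-- The derivative of `shift`. -/
def shift' (p : (K → ℝ) × (K → ℝ)) (φ : ℝ) : ℝ × (K → ℝ) →L[ℝ] ℝ × (K → ℝ) :=
  ContinuousLinearMap.id ℝ _ + (ContinuousLinearMap.fst ℝ ℝ (K → ℝ)).smulRight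
    ((0 : ℝ), Real.cos φ • p.1 - Real.sin φ • p.2)

lemma hasFDerivAt_shift (p : (K → ℝ) × (K → ℝ)) (z : ℝ × (K → ℝ)) :
    HasFDerivAt (shift p) (shift' p z.1) z := by
  have h1 : HasFDerivAt (fun z : ℝ × (K → ℝ) => z.1) (ContinuousLinearMap.fst ℝ ℝ (K → ℝ)) z :=
    hasFDerivAt_fst
  have h2 : HasFDerivAt (fun z : ℝ × (K → ℝ) => z.2) (ContinuousLinearMap.snd ℝ ℝ (K → ℝ)) z :=
    hasFDerivAt_snd
  have h3 := h1.prodMk (h2.add ((h1.sin.smul_const p.1).add (h1.cos.smul_const p.2)))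
  refine h3.congr_fderiv ?_
  ext v
  · simp [shift']
  · simp [shift', sub_eq_add_neg]
  · simp [shift']
  · simp [shift']

lemma shift'_apply_zero (p : (K → ℝ) × (K → ℝ)) (φ : ℝ) :
    shift' p φ (1, 0) = (1, Real.cos φ • p.1 - Real.sin φ • p.2) := by
  simp [shift']

lemma norm_shift'_le (p : (K → ℝ) × (K → ℝ)) (φ : ℝ) : ‖shift' p φ‖ ≤ 1 + (‖p.1‖ + ‖p.2‖) := by
  refine (norm_add_le _ _).trans ?_
  refine add_le_add ContinuousLinearMap.norm_id_le ?_
  rw [ContinuousLinearMap.norm_smulRight_apply]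
  have h1 : ‖((0 : ℝ), Real.cos φ • p.1 - Real.sin φ • p.2)‖ ≤ ‖p.1‖ + ‖p.2‖ := by
    rw [Prod.norm_mk, norm_zero]
    refine max_le (by positivity) ((norm_sub_le _ _).trans ?_)
    rw [norm_smul, norm_smul, Real.norm_eq_abs, Real.norm_eq_abs]
    have h1 := mul_le_of_le_one_left (norm_nonneg p.1) (Real.abs_cos_le_one φ)
    have h2 := mul_le_of_le_one_left (norm_nonneg p.2) (Real.abs_sin_le_one φ)
    linarith
  calc _ ≤ 1 * ‖((0 : ℝ), Real.cos φ • p.1 - Real.sin φ • p.2)‖ := by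
        gcongr; exact ContinuousLinearMap.norm_fst_le ℝ ℝ (K → ℝ)
    _ ≤ _ := by rw [one_mul]; exact h1

lemma norm_shift_sub_le (p : (K → ℝ) × (K → ℝ)) (z z₀ : ℝ × (K → ℝ)) :
    ‖shift p z - z₀‖ ≤ ‖z - z₀‖ + (‖p.1‖ + ‖p.2‖) := by
  have : shift p z - z₀ = (z - z₀) + ((0 : ℝ), mixNoise z.1 p) := by
    ext <;> simp [shift]; ring
  rw [this]
  refine (norm_add_le _ _).trans ?_
  gcongr
  rw [Prod.norm_mk, norm_zero]
  exact max_le (by positivity) (norm_mixNoise_le _ _)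

namespace Tame

lemma shift_le (h : Tame G C) (p : (K → ℝ) × (K → ℝ)) (z z₀ : ℝ × (K → ℝ)) (hz : ‖z - z₀‖ ≤ 1) :
    G (shift p z) ≤ (G z₀ * Real.exp C) * Real.exp (C * (‖p.1‖ + ‖p.2‖)) := by
  refine (h.le_mul_exp z₀ (shift p z)).trans ?_
  rw [mul_assoc, ← Real.exp_add]
  have h1 := norm_shift_sub_le p z z₀
  have h2 := mul_le_mul_of_nonneg_left h1 h.nonneg
  have h3 := mul_le_mul_of_nonneg_left hz h.nonneg
  have := (h.pos z₀).le
  gcongr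
  nlinarith

lemma le_shift (h : Tame G C) (p : (K → ℝ) × (K → ℝ)) (z : ℝ × (K → ℝ)) :
    G z * Real.exp (-C * (‖p.1‖ + ‖p.2‖)) ≤ G (shift p z) := by
  have h1 := h.le_mul_exp (shift p z) z
  have h2 := norm_shift_sub_le p z z
  rw [sub_self, norm_zero, zero_add, norm_sub_rev] at h2
  have h3 : G z ≤ G (shift p z) * Real.exp (C * (‖p.1‖ + ‖p.2‖)) := by
    refine h1.trans ?_
    have := (h.pos (shift p z)).le
    have := h.nonneg
    gcongr
  rw [neg_mul, Real.exp_neg, ← div_eq_mul_inv, div_le_iff₀ (Real.exp_pos _)]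
  exact h3

lemma shift_le' (h : Tame G C) (p : (K → ℝ) × (K → ℝ)) (z : ℝ × (K → ℝ)) :
    G (shift p z) ≤ G z * Real.exp (C * (‖p.1‖ + ‖p.2‖)) := by
  have h1 := h.le_mul_exp z (shift p z)
  have h2 := norm_shift_sub_le p z z
  rw [sub_self, norm_zero, zero_add] at h2
  refine h1.trans ?_
  have := (h.pos z).le
  have := h.nonneg
  gcongr

lemma continuous (h : Tame G C) : Continuous G := h.diff.continuous

lemma measurable_shift (h : Tame G C) (z : ℝ × (K → ℝ)) : Measurable (fun p => G (shift p z)) := by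
  refine h.continuous.measurable.comp ?_
  unfold shift
  exact measurable_const.prodMk (measurable_const.add (continuous_mixNoise z.1).measurable)

lemma integrable_shift (h : Tame G C) (hμ : IsGaussNoise μ A) (hν : IsGaussNoise ν B)
    (z : ℝ × (K → ℝ)) : Integrable (fun p => G (shift p z)) (μ.prod ν) := by
  refine ((integrable_exp_prod hμ hν C).const_mul (G z)).mono'
    (h.measurable_shift z).aestronglyMeasurable (Eventually.of_forall fun p => ?_)
  rw [Real.norm_eq_abs, abs_of_pos (h.pos _)]
  exact h.shift_le' p z

lemma integrable_fderiv_comp_shift (h : Tame G C) (hμ : IsGaussNoise μ A) (hν : IsGaussNoise ν B)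
    (z : ℝ × (K → ℝ)) :
    Integrable (fun p => (fderiv ℝ G (shift p z)).comp (shift' p z.1)) (μ.prod ν) := by
  have hC := h.nonneg
  have hms : Measurable (fun p : (K → ℝ) × (K → ℝ) => shift p z) := by
    unfold shift
    exact measurable_const.prodMk (measurable_const.add (continuous_mixNoise z.1).measurable)
  refine ((integrable_exp_prod hμ hν (C + 1)).const_mul (C * G z)).mono' ?_
    (Eventually.of_forall fun p => ?_)
  · refine Measurable.aestronglyMeasurable ?_
    have m1 : Measurable (fun p : (K → ℝ) × (K → ℝ) => fderiv ℝ G (shift p z)) :=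
      (measurable_fderiv ℝ G).comp hms
    have m2 : Continuous (fun p : (K → ℝ) × (K → ℝ) => shift' p z.1) := by
      unfold shift'
      refine continuous_const.add ?_
      exact ((ContinuousLinearMap.smulRightL ℝ (ℝ × (K → ℝ)) (ℝ × (K → ℝ)))
        (ContinuousLinearMap.fst ℝ ℝ (K → ℝ))).continuous.comp (by fun_prop)
    exact (isBoundedBilinearMap_comp (𝕜 := ℝ)).continuous.measurable.comp (m1.prodMk m2.measurable)
  · refine (ContinuousLinearMap.opNorm_comp_le _ _).trans ?_
    have b1 := (h.bound (shift p z)).trans (mul_le_mul_of_nonneg_left (h.shift_le' p z) hC)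
    have b2 := norm_shift'_le p z.1
    have b3 := Real.add_one_le_exp (‖p.1‖ + ‖p.2‖)
    calc _ ≤ (C * (G z * Real.exp (C * (‖p.1‖ + ‖p.2‖)))) * Real.exp (‖p.1‖ + ‖p.2‖) := by
          have := (h.pos z).le
          gcongr
          linarith
      _ = _ := by
          rw [show (C + 1) * (‖p.1‖ + ‖p.2‖) = C * (‖p.1‖ + ‖p.2‖) + (‖p.1‖ + ‖p.2‖) by ring,
            Real.exp_add (C * _)]
          ring

lemma hasFDerivAt_avg (h : Tame G C) (hμ : IsGaussNoise μ A) (hν : IsGaussNoise ν B)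
    (z : ℝ × (K → ℝ)) :
    HasFDerivAt (avg μ ν G) (∫ p, (fderiv ℝ G (shift p z)).comp (shift' p z.1) ∂(μ.prod ν)) z := by
  have hC := h.nonneg
  have hms : ∀ z, Measurable (fun p : (K → ℝ) × (K → ℝ) => shift p z) := fun z => by
    unfold shift
    exact measurable_const.prodMk (measurable_const.add (continuous_mixNoise z.1).measurable)
  have hint := ((integrable_exp_prod hμ hν (C + 1)).const_mul (C * (G z * Real.exp C)))
  refine hasFDerivAt_integral_of_dominated_of_fderiv_le (Metric.ball_mem_nhds z one_pos)
    (F := fun z p => G (shift p z))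
    (F' := fun z p => (fderiv ℝ G (shift p z)).comp (shift' p z.1))
    (bound := fun p => (C * (G z * Real.exp C)) * Real.exp ((C + 1) * (‖p.1‖ + ‖p.2‖)))
    (Eventually.of_forall fun z => (h.measurable_shift z).aestronglyMeasurable)
    (h.integrable_shift hμ hν z) ?_ ?_ hint ?_
  · exact (h.integrable_fderiv_comp_shift hμ hν z).aestronglyMeasurable
  · refine Eventually.of_forall fun p x hx => ?_
    refine (ContinuousLinearMap.opNorm_comp_le _ _).trans ?_
    have hx' : ‖x - z‖ ≤ 1 := (mem_ball_iff_norm.1 hx).le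
    have b1 := (h.bound (shift p x)).trans (mul_le_mul_of_nonneg_left (h.shift_le p x z hx') hC)
    have b2 := norm_shift'_le p x.1
    have b3 := Real.add_one_le_exp (‖p.1‖ + ‖p.2‖)
    calc _ ≤ (C * (G z * Real.exp C * Real.exp (C * (‖p.1‖ + ‖p.2‖)))) *
          Real.exp (‖p.1‖ + ‖p.2‖) := by
          have := (h.pos z).le
          gcongr
          linarith
      _ = _ := by
          rw [show (C + 1) * (‖p.1‖ + ‖p.2‖) = C * (‖p.1‖ + ‖p.2‖) + (‖p.1‖ + ‖p.2‖) by ring,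
            Real.exp_add (C * _)]
          ring
  · refine Eventually.of_forall fun p x _ => ?_
    exact (h.diff (shift p x)).hasFDerivAt.comp x (hasFDerivAt_shift p x)

lemma d1_avg (h : Tame G C) (hμ : IsGaussNoise μ A) (hν : IsGaussNoise ν B) (φ : ℝ) (y : K → ℝ) :
    d1 (avg μ ν G) φ y = ∫ p, d1 G φ (y + mixNoise φ p) ∂(μ.prod ν) := by
  refine (hasFDerivAt_integral_translate (P := μ.prod ν) (continuous_mixNoise φ).measurable
    (integrable_exp_mixNoise hμ hν φ) (g := fun y => G (φ, y)) (f := fun y => G (φ, y))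
    (C := max C 1) (h.nonneg.trans (le_max_left _ _)) (fun y => (h.pos _).le) (fun y z => ?_)
    (fun y => (h.hasFDerivAt_slice φ y).differentiableAt) (fun y => ?_) (fun y => ?_) y).fderiv
  · have := (h.mono (le_max_left C 1)).le_mul_exp (φ, y) (φ, z)
    simpa [Prod.norm_def] using this
  · rw [Real.norm_eq_abs, abs_of_pos (h.pos _)]
    have := (h.pos (φ, y)).le
    nlinarith [le_max_right C 1]
  · exact ((h.mono (le_max_left C 1)).norm_d1_le φ y)

lemma hasFDerivAt_d1_avg (h : Tame G C) (hμ : IsGaussNoise μ A) (hν : IsGaussNoise ν B) (φ : ℝ)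
    (y : K → ℝ) :
    HasFDerivAt (d1 (avg μ ν G) φ) (∫ p, d2 G φ (y + mixNoise φ p) ∂(μ.prod ν)) y := by
  have h0 : d1 (avg μ ν G) φ = fun y => ∫ p, d1 G φ (y + mixNoise φ p) ∂(μ.prod ν) := by
    ext1 y; exact h.d1_avg hμ hν φ y
  rw [h0]
  refine (hasFDerivAt_integral_translate (P := μ.prod ν) (continuous_mixNoise φ).measurable
    (integrable_exp_mixNoise hμ hν φ) (g := fun y => G (φ, y)) (f := d1 G φ)
    (C := C) h.nonneg (fun y => (h.pos _).le) (fun y z => ?_)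
    (h.diff2 φ) (fun y => h.norm_d1_le φ y) (fun y => h.bound2 φ y) y)
  have := h.le_mul_exp (φ, y) (φ, z)
  simpa [Prod.norm_def] using this

/-- By the Lipschitz bound on log G, the average is at least E₂ G, while its derivatives are at most
C E₁ G, with E₁ and E₂ exponential moments of the noise. The ratio gives the new constant. -/
theorem avg (h : Tame G C) (hμ : IsGaussNoise μ A) (hν : IsGaussNoise ν B) :
    ∃ C', Tame (avg μ ν G) C' := by
  have hC := h.nonneg
  have := hμ.isProbabilityMeasure
  have := hν.isProbabilityMeasure
  set E₁ := ∫ p, Real.exp ((C + 1) * (‖p.1‖ + ‖p.2‖)) ∂(μ.prod ν) with hE₁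
  set E₂ := ∫ p, Real.exp (-C * (‖p.1‖ + ‖p.2‖)) ∂(μ.prod ν) with hE₂
  have hE₂pos : 0 < E₂ := integral_exp_pos (integrable_exp_prod hμ hν (-C))
  have hE₁pos : 0 < E₁ := integral_exp_pos (integrable_exp_prod hμ hν (C + 1))
  have hlow : ∀ z, G z * E₂ ≤ SphericalSpinGlass.avg μ ν G z := by
    intro z
    rw [hE₂, ← integral_const_mul]
    exact integral_mono ((integrable_exp_prod hμ hν (-C)).const_mul _)
      (h.integrable_shift hμ hν z) fun p => h.le_shift p z
  have hup : ∀ z, C * G z * E₁ ≤ (C * E₁ / E₂) * SphericalSpinGlass.avg μ ν G z := by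
    intro z
    calc C * G z * E₁ = (C * E₁ / E₂) * (G z * E₂) := by field_simp
      _ ≤ _ := by gcongr; exact hlow z
  refine ⟨C * E₁ / E₂, fun z => (mul_pos (h.pos z) hE₂pos).trans_le (hlow z),
    fun z => (h.hasFDerivAt_avg hμ hν z).differentiableAt, fun z => ?_,
    fun φ y => (h.hasFDerivAt_d1_avg hμ hν φ y).differentiableAt, fun φ y => ?_⟩
  · rw [(h.hasFDerivAt_avg hμ hν z).fderiv]
    refine le_trans ?_ (hup z)
    rw [hE₁, ← integral_const_mul]
    refine norm_integral_le_of_norm_le ((integrable_exp_prod hμ hν (C + 1)).const_mul _)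
      (Eventually.of_forall fun p => ?_)
    refine (ContinuousLinearMap.opNorm_comp_le _ _).trans ?_
    have b1 := (h.bound (shift p z)).trans (mul_le_mul_of_nonneg_left (h.shift_le' p z) hC)
    have b2 := norm_shift'_le p z.1
    have b3 := Real.add_one_le_exp (‖p.1‖ + ‖p.2‖)
    calc _ ≤ (C * (G z * Real.exp (C * (‖p.1‖ + ‖p.2‖)))) * Real.exp (‖p.1‖ + ‖p.2‖) := by
          have := (h.pos z).le
          gcongr
          linarith
      _ = _ := by
          rw [show (C + 1) * (‖p.1‖ + ‖p.2‖) = C * (‖p.1‖ + ‖p.2‖) + (‖p.1‖ + ‖p.2‖) by ring,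
            Real.exp_add (C * _)]
          ring
  · rw [d2, (h.hasFDerivAt_d1_avg hμ hν φ y).fderiv]
    refine le_trans ?_ (hup (φ, y))
    rw [hE₁, ← integral_const_mul]
    refine norm_integral_le_of_norm_le ((integrable_exp_prod hμ hν (C + 1)).const_mul _)
      (Eventually.of_forall fun p => ?_)
    refine (h.bound2 φ _).trans ?_
    have b1 := h.shift_le' p (φ, y)
    calc _ ≤ C * (G (φ, y) * Real.exp (C * (‖p.1‖ + ‖p.2‖))) := by gcongr; exact b1
      _ ≤ C * (G (φ, y) * Real.exp ((C + 1) * (‖p.1‖ + ‖p.2‖))) := by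
          have := (h.pos (φ, y)).le
          gcongr; linarith
      _ = _ := by ring

end Tame

end

/-! ### Averaging transports the differential inequality -/

section

variable {K : Type*} [Fintype K]

variable {μ ν : Measure (K → ℝ)} {A B : K → K → ℝ} {G : ℝ × (K → ℝ) → ℝ} {C : ℝ}

lemma integral_bounded_comp {Ω X : Type*} [MeasurableSpace Ω] {P : Measure Ω}
    [NormedAddCommGroup X] [NormedSpace ℝ X] [CompleteSpace X]
    {g : Ω → X} (hm : AEStronglyMeasurable g P)
    {bound : Ω → ℝ} (hb : Integrable bound P) (hle : ∀ ω, ‖g ω‖ ≤ bound ω) {L : X → ℝ}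
    (hadd : ∀ x y, L (x + y) = L x + L y) (hsmul : ∀ (c : ℝ) x, L (c • x) = c * L x) {M : ℝ}
    (hM : ∀ x, |L x| ≤ M * ‖x‖) :
    L (∫ ω, g ω ∂P) = ∫ ω, L (g ω) ∂P :=
  (ContinuousLinearMap.integral_comp_comm
    (LinearMap.mkContinuous ⟨⟨L, hadd⟩, hsmul⟩ M hM) (hb.mono' hm (Eventually.of_forall hle))).symm

lemma integral_apply_apply {Ω T E F : Type*} [MeasurableSpace Ω] {P : Measure Ω}
    [NormedAddCommGroup E] [NormedSpace ℝ E] [NormedAddCommGroup F] [NormedSpace ℝ F]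
    (g : T → E →L[ℝ] F →L[ℝ] ℝ) {w : Ω → T} (hm : AEStronglyMeasurable (fun ω => g (w ω)) P)
    {bound : Ω → ℝ} (hb : Integrable bound P) (hle : ∀ ω, ‖g (w ω)‖ ≤ bound ω) (v : E) (u : F) :
    (∫ ω, g (w ω) ∂P) v u = ∫ ω, g (w ω) v u ∂P := by
  refine integral_bounded_comp (g := fun ω => g (w ω))
    (L := fun T : E →L[ℝ] F →L[ℝ] ℝ => T v u) hm hb ?_ ?_ ?_ (M := ‖v‖ * ‖u‖) ?_
  · exact hle
  · intro x y; rfl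
  · intro x y; rfl
  · intro x
    refine (x.le_opNorm₂ v u).trans_eq (by ring)

section

variable [DecidableEq K]

lemma sum_apply_single (L : (K → ℝ) →L[ℝ] ℝ) (v : K → ℝ) :
    L v = ∑ k, v k * L (Pi.single k 1) := by
  conv_lhs => rw [pi_eq_sum_univ' v]
  rw [map_sum]
  refine Finset.sum_congr rfl fun k _ => ?_
  rw [map_smul, smul_eq_mul]

/-- Gaussian integration by parts against the space derivative. -/
lemma Tame.integral_d1_self (h : Tame G C) (hμ : IsGaussNoise μ A) (φ : ℝ) (y : K → ℝ) {s : ℝ}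
    (hs : |s| ≤ 1) :
    Integrable (fun a => d1 G φ (y + s • a) a) μ ∧
    ∫ a, d1 G φ (y + s • a) a ∂μ =
      s * ∫ a, ∑ k, ∑ l, A k l * d2 G φ (y + s • a) (Pi.single l 1) (Pi.single k 1) ∂μ := by
  have hC := h.nonneg
  have hgrow : ∀ a : K → ℝ, G (φ, y + s • a) ≤ G (φ, y) * Real.exp (C * ‖a‖) := by
    intro a
    refine (h.le_mul_exp (φ, y) _).trans ?_
    have h1 : ‖((φ, y + s • a) : ℝ × (K → ℝ)) - (φ, y)‖ ≤ ‖a‖ := by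
      simp only [Prod.mk_sub_mk, sub_self, add_sub_cancel_left, Prod.norm_mk, norm_zero]
      refine max_le (norm_nonneg _) ?_
      rw [norm_smul, Real.norm_eq_abs]
      exact mul_le_of_le_one_left (norm_nonneg a) hs
    have := (h.pos (φ, y)).le
    gcongr
  have hg0 := (h.pos (φ, y)).le
  have hnorm : ∀ k : K, ‖(Pi.single k (1 : ℝ) : K → ℝ)‖ ≤ 1 := by
    intro k
    rw [Pi.norm_single, norm_one]
  have hsm : ∀ a : K → ℝ, HasFDerivAt (fun a : K → ℝ => y + s • a)
      (s • ContinuousLinearMap.id ℝ (K → ℝ)) a := fun a =>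
    ((hasFDerivAt_id a).const_smul s).const_add y
  set Hk : K → (K → ℝ) → ℝ := fun k a => d1 G φ (y + s • a) (Pi.single k 1) with hHk
  have hd : ∀ k a, HasFDerivAt (Hk k)
      (s • (d2 G φ (y + s • a)).flip (Pi.single k 1)) a := by
    intro k a
    have h1 := ((h.diff2 φ (y + s • a)).hasFDerivAt.comp a (hsm a))
    have h2 := h1.clm_apply (hasFDerivAt_const (Pi.single k (1 : ℝ)) a)
    refine h2.congr_fderiv ?_
    ext v
    simp [d2]
  have hb : ∀ k a, |Hk k a| ≤ (C * G (φ, y)) * Real.exp (C * ‖a‖) := by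
    intro k a
    calc |Hk k a| ≤ ‖d1 G φ (y + s • a)‖ * ‖(Pi.single k (1 : ℝ) : K → ℝ)‖ :=
          (d1 G φ (y + s • a)).le_opNorm _
      _ ≤ (C * (G (φ, y) * Real.exp (C * ‖a‖))) * 1 := by
          gcongr
          · exact (h.norm_d1_le φ _).trans (mul_le_mul_of_nonneg_left (hgrow a) hC)
          · exact hnorm k
      _ = _ := by ring
  have hb2 : ∀ a (v w : K → ℝ), |d2 G φ (y + s • a) v w|
      ≤ (C * (G (φ, y) * Real.exp (C * ‖a‖))) * ‖v‖ * ‖w‖ := by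
    intro a v w
    refine ((d2 G φ (y + s • a)).le_opNorm₂ v w).trans ?_
    gcongr
    exact (h.bound2 φ _).trans (mul_le_mul_of_nonneg_left (hgrow a) hC)
  have hb' : ∀ k a, ‖fderiv ℝ (Hk k) a‖ ≤ (C * G (φ, y)) * Real.exp (C * ‖a‖) := by
    intro k a
    rw [(hd k a).fderiv]
    refine ContinuousLinearMap.opNorm_le_bound _ (by positivity) fun v => ?_
    simp only [smul_apply, ContinuousLinearMap.flip_apply, smul_eq_mul,
      norm_mul, Real.norm_eq_abs]
    calc |s| * |d2 G φ (y + s • a) v (Pi.single k 1)|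
        ≤ 1 * ((C * (G (φ, y) * Real.exp (C * ‖a‖))) * ‖v‖ * 1) := by
          gcongr
          refine (hb2 a v _).trans ?_
          gcongr
          exact hnorm k
      _ = _ := by ring
  have hm : ∀ k, Measurable (Hk k) := fun k =>
    (continuous_iff_continuousAt.2 fun a => (hd k a).continuousAt).measurable
  have hint : ∀ k, Integrable (fun a => a k * Hk k a) μ := by
    intro k
    refine hμ.integrable_of_le_exp (C := C * G (φ, y)) (c := C + 1)
      ((measurable_pi_apply k).mul (hm k)).aestronglyMeasurable fun a => ?_
    rw [norm_mul]
    calc ‖a k‖ * ‖Hk k a‖ ≤ ‖a‖ * ((C * G (φ, y)) * Real.exp (C * ‖a‖)) := by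
          gcongr
          · exact norm_le_pi_norm a k
          · exact hb k a
      _ = (C * G (φ, y)) * (|‖a‖| * Real.exp (C * |‖a‖|)) := by rw [abs_norm]; ring
      _ ≤ (C * G (φ, y)) * Real.exp ((C + 1) * |‖a‖|) := by gcongr; exact le_exp_abs C _
      _ = _ := by rw [abs_norm]
  have e1 : ∀ a : K → ℝ, d1 G φ (y + s • a) a = ∑ k, a k * Hk k a := fun a =>
    sum_apply_single _ a
  have hintD : ∀ k l, Integrable (fun a => d2 G φ (y + s • a) (Pi.single l 1) (Pi.single k 1)) μ := by
    intro k l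
    refine hμ.integrable_of_le_exp (C := C * G (φ, y)) (c := C) ?_ fun a => ?_
    · have m1 : Measurable (fun y => d2 G φ y (Pi.single l 1)) :=
        measurable_fderiv_apply_const ℝ (d1 G φ) _
      have m2 : Measurable (fun T : (K → ℝ) →L[ℝ] ℝ => T (Pi.single k (1 : ℝ))) :=
        ContinuousLinearMap.measurable_apply _
      exact (m2.comp (m1.comp (by fun_prop))).aestronglyMeasurable
    · calc _ ≤ (C * (G (φ, y) * Real.exp (C * ‖a‖))) * ‖(Pi.single l (1 : ℝ) : K → ℝ)‖ *
            ‖(Pi.single k (1 : ℝ) : K → ℝ)‖ := hb2 a _ _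
        _ ≤ (C * (G (φ, y) * Real.exp (C * ‖a‖))) * 1 * 1 := by
            gcongr
            · exact hnorm l
            · exact hnorm k
        _ = _ := by ring
  refine ⟨?_, ?_⟩
  · simp_rw [e1]
    exact integrable_finsetSum _ fun k _ => hint k
  · simp_rw [e1]
    rw [integral_finsetSum _ fun k _ => hint k, integral_finsetSum _ fun k _ =>
      integrable_finsetSum _ fun l _ => (hintD k l).const_mul _, Finset.mul_sum]
    refine Finset.sum_congr rfl fun k _ => ?_
    rw [hμ.integral_eval_mul k (fun a => (hd k a).differentiableAt) hC (hb k) (hb' k),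
      ← integral_const_mul]
    congr 1
    ext a
    rw [(hd k a).fderiv, sum_apply_single, Finset.mul_sum]
    refine Finset.sum_congr rfl fun l _ => ?_
    simp only [smul_apply, ContinuousLinearMap.flip_apply, smul_eq_mul]
    ring

lemma Tame.integrable_d2_shift (h : Tame G C) (hμ : IsGaussNoise μ A) (hν : IsGaussNoise ν B)
    (φ : ℝ) (y v w : K → ℝ) :
    Integrable (fun p => d2 G φ (y + mixNoise φ p) v w) (μ.prod ν) := by
  refine ((integrable_exp_prod hμ hν C).const_mul (C * G (φ, y) * ‖v‖ * ‖w‖)).mono' ?_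
    (Eventually.of_forall fun p => ?_)
  · have m1 : Measurable (fun y => d2 G φ y v) := measurable_fderiv_apply_const ℝ (d1 G φ) _
    have m2 : Measurable (fun T : (K → ℝ) →L[ℝ] ℝ => T w) :=
      ContinuousLinearMap.measurable_apply _
    exact (m2.comp (m1.comp (measurable_const.add
      (continuous_mixNoise φ).measurable))).aestronglyMeasurable
  · refine ((d2 G φ (y + mixNoise φ p)).le_opNorm₂ v w).trans ?_
    have h1 := (h.bound2 φ (y + mixNoise φ p)).trans
      (mul_le_mul_of_nonneg_left (h.shift_le' p (φ, y)) h.nonneg)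
    calc _ ≤ (C * (G (φ, y) * Real.exp (C * (‖p.1‖ + ‖p.2‖)))) * ‖v‖ * ‖w‖ := by gcongr
      _ = _ := by ring

lemma Tame.integrable_d1_shift (h : Tame G C) (hμ : IsGaussNoise μ A) (hν : IsGaussNoise ν B)
    (φ : ℝ) (y : K → ℝ) :
    Integrable (fun p => d1 G φ (y + mixNoise φ p)) (μ.prod ν) := by
  refine ((integrable_exp_prod hμ hν C).const_mul (C * G (φ, y))).mono' ?_
    (Eventually.of_forall fun p => ?_)
  · exact ((h.diff2 φ).continuous.measurable.comp (measurable_const.add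
      (continuous_mixNoise φ).measurable)).aestronglyMeasurable
  · have h1 := (h.norm_d1_le φ (y + mixNoise φ p)).trans
      (mul_le_mul_of_nonneg_left (h.shift_le' p (φ, y)) h.nonneg)
    exact h1.trans_eq (by ring)

lemma Tame.integrable_fderiv_shift (h : Tame G C) (hμ : IsGaussNoise μ A) (hν : IsGaussNoise ν B)
    (z : ℝ × (K → ℝ)) :
    Integrable (fun p => fderiv ℝ G (shift p z) (1, 0)) (μ.prod ν) := by
  refine ((integrable_exp_prod hμ hν C).const_mul (C * G z)).mono' ?_
    (Eventually.of_forall fun p => ?_)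
  · refine ((measurable_fderiv_apply_const ℝ G (1, 0)).comp ?_).aestronglyMeasurable
    unfold shift
    exact measurable_const.prodMk (measurable_const.add (continuous_mixNoise z.1).measurable)
  · have h1 := (h.bound (shift p z)).trans
      (mul_le_mul_of_nonneg_left (h.shift_le' p z) h.nonneg)
    refine ((fderiv ℝ G (shift p z)).le_opNorm _).trans ?_
    have : ‖((1, 0) : ℝ × (K → ℝ))‖ = 1 := by simp [Prod.norm_mk]
    rw [this, mul_one]
    exact h1.trans_eq (by ring)

/-- The motion of the noise adds the derivative of G along cos φ a - sin φ b. Integrating by parts,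
a produces sin φ ∑ A ∂∂G and b produces cos φ ∑ B ∂∂G, in total sin φ cos φ ∑ (A-B) ∂∂G. Subtracting
A-B from D compensates it exactly. -/
theorem HeatIneq.avg {D : K → K → ℝ} (h : Tame G C) (hG : HeatIneq G D)
    (hμ : IsGaussNoise μ A) (hν : IsGaussNoise ν B) :
    HeatIneq (avg μ ν G) (fun k l => D k l - (A k l - B k l)) where
  mono φ y k := by
    rw [h.d1_avg hμ hν, ContinuousLinearMap.integral_apply (h.integrable_d1_shift hμ hν φ y)]
    exact integral_nonneg fun p => hG.mono _ _ k
  ineq φ hφ y := by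
    have hPμ := hμ.isProbabilityMeasure
    have hPν := hν.isProbabilityMeasure
    set s := Real.sin φ with hs
    set c := Real.cos φ with hc
    -- the trace of the second derivative against a matrix
    set tr : (K → K → ℝ) → (K → ℝ) → ℝ := fun M y =>
      ∑ k, ∑ l, M k l * d2 G φ y (Pi.single l 1) (Pi.single k 1) with htr
    have htri : ∀ M, Integrable (fun p => tr M (y + mixNoise φ p)) (μ.prod ν) := fun M =>
      integrable_finsetSum _ fun k _ => integrable_finsetSum _ fun l _ =>
        (h.integrable_d2_shift hμ hν φ y _ _).const_mul _
    have hd2 : ∀ v w, d2 (SphericalSpinGlass.avg μ ν G) φ y v w =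
        ∫ p, d2 G φ (y + mixNoise φ p) v w ∂(μ.prod ν) := by
      intro v w
      rw [d2, (h.hasFDerivAt_d1_avg hμ hν φ y).fderiv]
      refine integral_apply_apply (d2 G φ) ?_
        ((integrable_exp_prod hμ hν C).const_mul (C * G (φ, y))) (fun p => ?_) v w
      · exact ((measurable_fderiv ℝ (d1 G φ)).comp (measurable_const.add
          (continuous_mixNoise φ).measurable)).aestronglyMeasurable
      · have h1 := (h.bound2 φ (y + mixNoise φ p)).trans
          (mul_le_mul_of_nonneg_left (h.shift_le' p (φ, y)) h.nonneg)
        exact h1.trans_eq (by ring)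
    have htravg : ∀ M : K → K → ℝ, ∑ k, ∑ l, M k l *
        d2 (SphericalSpinGlass.avg μ ν G) φ y (Pi.single l 1) (Pi.single k 1) =
        ∫ p, tr M (y + mixNoise φ p) ∂(μ.prod ν) := by
      intro M
      simp only [htr]
      rw [integral_finsetSum _ fun k _ => integrable_finsetSum _ fun l _ =>
        (h.integrable_d2_shift hμ hν φ y _ _).const_mul _]
      refine Finset.sum_congr rfl fun k _ => ?_
      rw [integral_finsetSum _ fun l _ => (h.integrable_d2_shift hμ hν φ y _ _).const_mul _]
      refine Finset.sum_congr rfl fun l _ => ?_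
      rw [hd2, integral_const_mul]
    have hi1 : Integrable (fun p : (K → ℝ) × (K → ℝ) => d1 G φ (y + mixNoise φ p) p.1)
        (μ.prod ν) := by
      refine ((integrable_exp_prod hμ hν (C + 1)).const_mul (C * G (φ, y))).mono' ?_
        (Eventually.of_forall fun p => ?_)
      · exact ((h.diff2 φ).continuous.comp (continuous_const.add
          (continuous_mixNoise φ))).clm_apply continuous_fst |>.aestronglyMeasurable
      · refine ((d1 G φ _).le_opNorm _).trans ?_
        have h1 := (h.norm_d1_le φ (y + mixNoise φ p)).trans
          (mul_le_mul_of_nonneg_left (h.shift_le' p (φ, y)) h.nonneg)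
        have h2 := Real.add_one_le_exp (‖p.1‖ + ‖p.2‖)
        have h3 := norm_nonneg p.2
        calc _ ≤ (C * (G (φ, y) * Real.exp (C * (‖p.1‖ + ‖p.2‖)))) *
              Real.exp (‖p.1‖ + ‖p.2‖) := by
              refine mul_le_mul h1 (by linarith) (norm_nonneg _) ((norm_nonneg _).trans h1)
          _ = _ := by
            rw [show (C + 1) * (‖p.1‖ + ‖p.2‖) = C * (‖p.1‖ + ‖p.2‖) + (‖p.1‖ + ‖p.2‖) by ring,
              Real.exp_add (C * _)]
            ring
    have hi2 : Integrable (fun p : (K → ℝ) × (K → ℝ) => d1 G φ (y + mixNoise φ p) p.2)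
        (μ.prod ν) := by
      refine ((integrable_exp_prod hμ hν (C + 1)).const_mul (C * G (φ, y))).mono' ?_
        (Eventually.of_forall fun p => ?_)
      · exact ((h.diff2 φ).continuous.comp (continuous_const.add
          (continuous_mixNoise φ))).clm_apply continuous_snd |>.aestronglyMeasurable
      · refine ((d1 G φ _).le_opNorm _).trans ?_
        have h1 := (h.norm_d1_le φ (y + mixNoise φ p)).trans
          (mul_le_mul_of_nonneg_left (h.shift_le' p (φ, y)) h.nonneg)
        have h2 := Real.add_one_le_exp (‖p.1‖ + ‖p.2‖)
        have h3 := norm_nonneg p.1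
        calc _ ≤ (C * (G (φ, y) * Real.exp (C * (‖p.1‖ + ‖p.2‖)))) *
              Real.exp (‖p.1‖ + ‖p.2‖) := by
              refine mul_le_mul h1 (by linarith) (norm_nonneg _) ((norm_nonneg _).trans h1)
          _ = _ := by
            rw [show (C + 1) * (‖p.1‖ + ‖p.2‖) = C * (‖p.1‖ + ‖p.2‖) + (‖p.1‖ + ‖p.2‖) by ring,
              Real.exp_add (C * _)]
            ring
    have ibp1 : ∫ p, d1 G φ (y + mixNoise φ p) p.1 ∂(μ.prod ν) =
        s * ∫ p, tr A (y + mixNoise φ p) ∂(μ.prod ν) := by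
      rw [integral_prod_symm _ hi1, integral_prod_symm _ (htri A), ← integral_const_mul]
      congr 1
      ext b
      have := (h.integral_d1_self hμ φ (y + c • b) (s := s) (Real.abs_sin_le_one φ)).2
      have e : ∀ a, y + mixNoise φ (a, b) = y + c • b + s • a := by
        intro a; simp only [mixNoise]; abel
      simp_rw [e]
      exact this
    have ibp2 : ∫ p, d1 G φ (y + mixNoise φ p) p.2 ∂(μ.prod ν) =
        c * ∫ p, tr B (y + mixNoise φ p) ∂(μ.prod ν) := by
      rw [integral_prod _ hi2, integral_prod _ (htri B), ← integral_const_mul]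
      congr 1
      ext a
      have := (h.integral_d1_self hν φ (y + s • a) (s := c) (Real.abs_cos_le_one φ)).2
      have e : ∀ b, y + mixNoise φ (a, b) = y + s • a + c • b := by
        intro b; simp only [mixNoise]; abel
      simp_rw [e]
      exact this
    -- Chain rule for the shift: the explicit dependence of G on φ, plus the velocity cos φ a - sin
    -- φ b of the mixed noise.
    have hder : fderiv ℝ (SphericalSpinGlass.avg μ ν G) (φ, y) (1, 0) =
        ∫ p, fderiv ℝ G (shift p (φ, y)) (1, 0) ∂(μ.prod ν) +
        (c * ∫ p, d1 G φ (y + mixNoise φ p) p.1 ∂(μ.prod ν) -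
        s * ∫ p, d1 G φ (y + mixNoise φ p) p.2 ∂(μ.prod ν)) := by
      have hint := h.integrable_fderiv_comp_shift hμ hν (φ, y)
      have hi3 : Integrable (fun p : (K → ℝ) × (K → ℝ) => c * d1 G φ (y + mixNoise φ p) p.1 -
          s * d1 G φ (y + mixNoise φ p) p.2) (μ.prod ν) := (hi1.const_mul c).sub (hi2.const_mul s)
      rw [(h.hasFDerivAt_avg hμ hν (φ, y)).fderiv, ContinuousLinearMap.integral_apply hint,
        ← integral_const_mul, ← integral_const_mul, ← integral_sub (hi1.const_mul c)
        (hi2.const_mul s), ← integral_add (h.integrable_fderiv_shift hμ hν (φ, y)) hi3]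
      congr 1
      ext p
      rw [ContinuousLinearMap.comp_apply, shift'_apply_zero]
      have e1 : ((1, Real.cos φ • p.1 - Real.sin φ • p.2) : ℝ × (K → ℝ)) = (1, 0) +
          ContinuousLinearMap.inr ℝ ℝ (K → ℝ) (Real.cos φ • p.1 - Real.sin φ • p.2) := by
        simp
      have e2 := congrArg (fun T => T (Real.cos φ • p.1 - Real.sin φ • p.2))
        (h.d1_eq φ (y + mixNoise φ p))
      simp only [ContinuousLinearMap.comp_apply] at e2
      rw [e1, map_add]
      have e3 : shift p (φ, y) = (φ, y + mixNoise φ p) := rfl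
      rw [e3, ← e2, map_sub, map_smul, map_smul]
      rfl
    rw [hder, ibp1, ibp2, htravg]
    have hfin : ∫ p, tr (fun k l => D k l - (A k l - B k l)) (y + mixNoise φ p) ∂(μ.prod ν) =
        ∫ p, tr D (y + mixNoise φ p) ∂(μ.prod ν) - (∫ p, tr A (y + mixNoise φ p) ∂(μ.prod ν) -
          ∫ p, tr B (y + mixNoise φ p) ∂(μ.prod ν)) := by
      have hi3 : Integrable (fun p => tr A (y + mixNoise φ p) - tr B (y + mixNoise φ p))
          (μ.prod ν) := (htri A).sub (htri B)
      rw [← integral_sub (htri A) (htri B), ← integral_sub (htri D) hi3]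
      congr 1
      ext p
      simp only [htr]
      simp only [sub_mul, Finset.sum_sub_distrib]
    rw [hfin]
    have hlast : ∫ p, fderiv ℝ G (shift p (φ, y)) (1, 0) ∂(μ.prod ν) +
        s * c * ∫ p, tr D (y + mixNoise φ p) ∂(μ.prod ν) ≤ 0 := by
      rw [← integral_const_mul, ← integral_add (h.integrable_fderiv_shift hμ hν (φ, y))
        ((htri D).const_mul _)]
      exact integral_nonpos fun p => hG.ineq φ hφ (y + mixNoise φ p)
    linarith

end

end

section

/-! ### The recursion and the comparison theorem -/

/-- The hierarchical recursion `G ↦ E G(· + g)^r` over a list of levels `(r, law of g)`, the first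
entry being the outermost one. -/
def recE {V : Type*} [AddCommMonoid V] [MeasurableSpace V] (g : V → ℝ≥0∞) :
    List (ℝ × Measure V) → V → ℝ≥0∞
  | [], y => g y
  | ℓ :: L, y => ∫⁻ a, (recE g L (y + a)) ^ ℓ.1 ∂ℓ.2

variable {K : Type*} [Fintype K]

/-- A level of the interpolation: two noises with covariances `A` and `B`, and an exponent. -/
structure Level (K : Type*) where
  r : ℝ
  A : K → K → ℝ
  B : K → K → ℝ
  μ : Measure (K → ℝ)
  ν : Measure (K → ℝ)

/-- The data of a level are consistent. -/
structure Level.Valid (ℓ : Level K) : Prop where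
  r_pos : 0 < ℓ.r
  r_le : ℓ.r ≤ 1
  hμ : IsGaussNoise ℓ.μ ℓ.A
  hν : IsGaussNoise ℓ.ν ℓ.B

/-- The difference of the two covariances. -/
def Level.diff (ℓ : Level K) (k l : K) : ℝ := ℓ.A k l - ℓ.B k l

/-- The interpolating recursion. -/
def interp (G : ℝ × (K → ℝ) → ℝ) : List (Level K) → ℝ × (K → ℝ) → ℝ
  | [] => G
  | ℓ :: L => avg ℓ.μ ℓ.ν fun z => interp G L z ^ ℓ.r

/-- All partial sums of the covariance differences, started from `D`, are entrywise nonnegative. -/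
def CumNonneg : (K → K → ℝ) → List (Level K) → Prop
  | _, [] => True
  | D, ℓ :: L => (∀ k l, 0 ≤ D k l + ℓ.diff k l) ∧ CumNonneg (fun k l => D k l + ℓ.diff k l) L

/-- The total covariance difference, started from `D`. -/
def cumDiff : (K → K → ℝ) → List (Level K) → K → K → ℝ
  | D, [] => D
  | D, ℓ :: L => cumDiff (fun k l => D k l + ℓ.diff k l) L

/-- Induction from the innermost level. The inner recursion satisfies the inequality with D + (A-B),
whose nonnegativity allows the power; the average over the level then brings the matrix back to D.
-/
lemma interp_spec [DecidableEq K] {G : ℝ × (K → ℝ) → ℝ} (hG : ∃ C, Tame G C) (L : List (Level K))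
    (hL : ∀ ℓ ∈ L, ℓ.Valid) (D : K → K → ℝ) (hD : CumNonneg D L) (hGD : HeatIneq G (cumDiff D L)) :
    (∃ C, Tame (interp G L) C) ∧ HeatIneq (interp G L) D := by
  induction L generalizing D with
  | nil => exact ⟨hG, hGD⟩
  | cons ℓ L ih =>
    obtain ⟨⟨C, hC⟩, h2⟩ := ih (fun ℓ' h => hL ℓ' (List.mem_cons_of_mem _ h)) _ hD.2 hGD
    have hℓ := hL ℓ List.mem_cons_self
    obtain ⟨C', hC'⟩ := hC.rpow ℓ.r
    have h3 := (h2.rpow hC hD.1 hℓ.r_pos.le hℓ.r_le).avg hC' hℓ.hμ hℓ.hν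
    refine ⟨hC'.avg hℓ.hμ hℓ.hν, ?_⟩
    have e : (fun k l => (D k l + ℓ.diff k l) - (ℓ.A k l - ℓ.B k l)) = D := by
      ext k l; simp [Level.diff]
    rw [e] at h3
    exact h3

/-- Outside all levels the matrix is 0, and the inequality reduces to a nonpositive φ-derivative. -/
lemma interp_antitone [DecidableEq K] {G : ℝ × (K → ℝ) → ℝ} (hG : ∃ C, Tame G C)
    (L : List (Level K)) (hL : ∀ ℓ ∈ L, ℓ.Valid) (hD : CumNonneg (fun _ _ => 0) L)
    (hGD : HeatIneq G (cumDiff (fun _ _ => 0) L)) (y : K → ℝ) :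
    interp G L (Real.pi / 2, y) ≤ interp G L (0, y) := by
  obtain ⟨⟨C, hC⟩, h⟩ := interp_spec hG L hL _ hD hGD
  have hd : ∀ φ, HasDerivAt (fun φ => interp G L (φ, y)) (fderiv ℝ (interp G L) (φ, y) (1, 0)) φ := by
    intro φ
    have h0 : HasDerivAt (fun φ' : ℝ => ((φ', y) : ℝ × (K → ℝ))) (1, 0) φ :=
      (hasDerivAt_id φ).prodMk (hasDerivAt_const φ y)
    exact (hC.diff (φ, y)).hasFDerivAt.comp_hasDerivAt φ h0
  have hpi := Real.pi_pos
  refine antitoneOn_of_deriv_nonpos (convex_Icc 0 (Real.pi / 2))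
    (fun φ _ => (hd φ).continuousAt.continuousWithinAt)
    (fun φ _ => (hd φ).differentiableAt.differentiableWithinAt) (fun φ hφ => ?_)
    (left_mem_Icc.2 (by linarith)) (right_mem_Icc.2 (by linarith)) (by linarith)
  rw [(hd φ).deriv]
  have := h.ineq φ (interior_subset hφ) y
  simpa using this

/-- At each endpoint of the path only one noise of every level survives, and the other one
integrates out to the factor 1. -/
lemma ofReal_interp_pi_div_two {G : ℝ × (K → ℝ) → ℝ} [DecidableEq K] (hG : ∃ C, Tame G C)
    (L : List (Level K)) (hL : ∀ ℓ ∈ L, ℓ.Valid) (y : K → ℝ) :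
    (∃ C, Tame (interp G L) C) ∧
    ENNReal.ofReal (interp G L (Real.pi / 2, y)) =
      recE (fun y => ENNReal.ofReal (G (Real.pi / 2, y))) (L.map fun ℓ => (ℓ.r, ℓ.μ)) y ∧
    ENNReal.ofReal (interp G L (0, y)) =
      recE (fun y => ENNReal.ofReal (G (0, y))) (L.map fun ℓ => (ℓ.r, ℓ.ν)) y := by
  induction L generalizing y with
  | nil => exact ⟨hG, rfl, rfl⟩
  | cons ℓ L ih =>
    have ih' := ih (fun ℓ' h => hL ℓ' (List.mem_cons_of_mem _ h))
    obtain ⟨C, hC⟩ := (ih' 0).1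
    have hℓ := hL ℓ List.mem_cons_self
    obtain ⟨C', hC'⟩ := hC.rpow ℓ.r
    have := hℓ.hμ.isProbabilityMeasure
    have := hℓ.hν.isProbabilityMeasure
    have hm : ∀ φ, Measurable (fun y => ENNReal.ofReal (interp G L (φ, y) ^ ℓ.r)) := fun φ =>
      ENNReal.measurable_ofReal.comp ((hC'.continuous.comp (by fun_prop : Continuous fun y : K → ℝ =>
        ((φ, y) : ℝ × (K → ℝ)))).measurable)
    have key : ∀ φ, ENNReal.ofReal (avg ℓ.μ ℓ.ν (fun z => interp G L z ^ ℓ.r) (φ, y)) =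
        ∫⁻ p, ENNReal.ofReal (interp G L (φ, y + mixNoise φ p) ^ ℓ.r) ∂(ℓ.μ.prod ℓ.ν) := by
      intro φ
      exact ofReal_integral_eq_lintegral_ofReal (hC'.integrable_shift hℓ.hμ hℓ.hν (φ, y))
        (Eventually.of_forall fun p => (hC'.pos _).le)
    have hpow : ∀ φ y, ENNReal.ofReal (interp G L (φ, y) ^ ℓ.r) =
        ENNReal.ofReal (interp G L (φ, y)) ^ ℓ.r := fun φ y =>
      (ENNReal.ofReal_rpow_of_pos (hC.pos _)).symm
    refine ⟨hC'.avg hℓ.hμ hℓ.hν, ?_, ?_⟩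
    · have e := key (Real.pi / 2)
      have e1 : ∀ p : (K → ℝ) × (K → ℝ), mixNoise (Real.pi / 2) p = p.1 := by
        intro p; simp [mixNoise]
      simp_rw [e1] at e
      have hmm : AEMeasurable (fun p : (K → ℝ) × (K → ℝ) =>
          ENNReal.ofReal (interp G L (Real.pi / 2, y + p.1) ^ ℓ.r)) (ℓ.μ.prod ℓ.ν) :=
        ((hm _).comp (measurable_const.add measurable_fst)).aemeasurable
      rw [lintegral_prod _ hmm] at e
      simp only [lintegral_const, measure_univ, mul_one] at e
      refine e.trans (lintegral_congr fun a => ?_)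
      rw [hpow, (ih' _).2.1]
    · have e := key 0
      have e1 : ∀ p : (K → ℝ) × (K → ℝ), mixNoise 0 p = p.2 := by
        intro p; simp [mixNoise]
      simp_rw [e1] at e
      have hmm : AEMeasurable (fun p : (K → ℝ) × (K → ℝ) =>
          ENNReal.ofReal (interp G L (0, y + p.2) ^ ℓ.r)) (ℓ.μ.prod ℓ.ν) :=
        ((hm _).comp (measurable_const.add measurable_snd)).aemeasurable
      rw [lintegral_prod_symm _ hmm] at e
      simp only [lintegral_const, measure_univ, mul_one] at e
      refine e.trans (lintegral_congr fun a => ?_)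
      rw [hpow, (ih' _).2.2]

/-- The function at the top of the interpolation. -/
def topFun (w δ : K → ℝ) (z : ℝ × (K → ℝ)) : ℝ :=
  ∑ k, w k * Real.exp (z.2 k - Real.sin z.1 ^ 2 * δ k / 2)

section top

variable {w δ : K → ℝ}

lemma hasFDerivAt_topFun (z : ℝ × (K → ℝ)) :
    HasFDerivAt (topFun w δ) (∑ k, (w k * Real.exp (z.2 k - Real.sin z.1 ^ 2 * δ k / 2)) •
      ((ContinuousLinearMap.proj (R := ℝ) (φ := fun _ : K => ℝ) k).comp
        (ContinuousLinearMap.snd ℝ ℝ (K → ℝ)) -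
      (Real.sin z.1 * Real.cos z.1 * δ k) • ContinuousLinearMap.fst ℝ ℝ (K → ℝ))) z := by
  unfold topFun
  refine HasFDerivAt.fun_sum fun k _ => ?_
  have h1 : HasFDerivAt (fun z : ℝ × (K → ℝ) => z.1) (ContinuousLinearMap.fst ℝ ℝ (K → ℝ)) z :=
    hasFDerivAt_fst
  have h2 : HasFDerivAt (fun z : ℝ × (K → ℝ) => z.2 k)
      ((ContinuousLinearMap.proj (R := ℝ) (φ := fun _ : K => ℝ) k).comp
        (ContinuousLinearMap.snd ℝ ℝ (K → ℝ))) z :=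
    ((ContinuousLinearMap.proj (R := ℝ) (φ := fun _ : K => ℝ) k).comp
        (ContinuousLinearMap.snd ℝ ℝ (K → ℝ))).hasFDerivAt
  have h3 := (h2.sub (((h1.sin.pow 2).mul_const (δ k / 2)))).exp.const_mul (w k)
  have h4 : (fun z : ℝ × (K → ℝ) => w k * Real.exp (z.2 k - Real.sin z.1 ^ 2 * δ k / 2)) =
      fun z => w k * Real.exp (z.2 k - Real.sin z.1 ^ 2 * (δ k / 2)) := by
    ext z; rw [mul_div_assoc]
  rw [h4]
  refine h3.congr_fderiv ?_
  refine ContinuousLinearMap.ext fun v => ?_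
  simp
  ring_nf

lemma hasFDerivAt_topFun_slice (φ : ℝ) (y : K → ℝ) :
    HasFDerivAt (fun y => topFun w δ (φ, y))
      (∑ k, (w k * Real.exp (y k - Real.sin φ ^ 2 * δ k / 2)) •
        ContinuousLinearMap.proj (R := ℝ) (φ := fun _ : K => ℝ) k) y := by
  unfold topFun
  refine HasFDerivAt.fun_sum fun k _ => ?_
  have h2 : HasFDerivAt (fun y : K → ℝ => y k)
      (ContinuousLinearMap.proj (R := ℝ) (φ := fun _ : K => ℝ) k) y :=
    (ContinuousLinearMap.proj (R := ℝ) (φ := fun _ : K => ℝ) k).hasFDerivAt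
  refine ((h2.sub_const (Real.sin φ ^ 2 * δ k / 2)).exp.const_mul (w k)).congr_fderiv ?_
  rw [smul_smul]

lemma d1_topFun (φ : ℝ) (y : K → ℝ) : d1 (topFun w δ) φ y =
    ∑ k, (w k * Real.exp (y k - Real.sin φ ^ 2 * δ k / 2)) •
        ContinuousLinearMap.proj (R := ℝ) (φ := fun _ : K => ℝ) k :=
  (hasFDerivAt_topFun_slice φ y).fderiv

lemma hasFDerivAt_d1_topFun (φ : ℝ) (y : K → ℝ) : HasFDerivAt (d1 (topFun w δ) φ)
    (∑ k, ((w k * Real.exp (y k - Real.sin φ ^ 2 * δ k / 2)) •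
        ContinuousLinearMap.proj (R := ℝ) (φ := fun _ : K => ℝ) k).smulRight
        (ContinuousLinearMap.proj (R := ℝ) (φ := fun _ : K => ℝ) k)) y := by
  have h0 : d1 (topFun w δ) φ = fun y => ∑ k, (w k * Real.exp (y k - Real.sin φ ^ 2 * δ k / 2)) •
        ContinuousLinearMap.proj (R := ℝ) (φ := fun _ : K => ℝ) k := by
    ext1 y; exact d1_topFun φ y
  rw [h0]
  refine HasFDerivAt.fun_sum fun k _ => ?_
  have h2 : HasFDerivAt (fun y : K → ℝ => y k)
      (ContinuousLinearMap.proj (R := ℝ) (φ := fun _ : K => ℝ) k) y :=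
    (ContinuousLinearMap.proj (R := ℝ) (φ := fun _ : K => ℝ) k).hasFDerivAt
  refine (((h2.sub_const (Real.sin φ ^ 2 * δ k / 2)).exp.const_mul (w k)).smul_const
    (ContinuousLinearMap.proj (R := ℝ) (φ := fun _ : K => ℝ) k)).congr_fderiv ?_
  rw [smul_smul]

lemma norm_sum_smulRight_le {E F : Type*} [NormedAddCommGroup E] [NormedSpace ℝ E]
    [NormedAddCommGroup F] [NormedSpace ℝ F] (a : K → ℝ) (S : K → E →L[ℝ] ℝ) (u : K → F)
    (hS : ∀ k, ‖S k‖ ≤ 1) (hu : ∀ k, ‖u k‖ ≤ 1) :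
    ‖∑ k, (a k • S k).smulRight (u k)‖ ≤ ∑ k, |a k| := by
  refine (norm_sum_le _ _).trans (Finset.sum_le_sum fun k _ => ?_)
  rw [ContinuousLinearMap.norm_smulRight_apply, norm_smul, Real.norm_eq_abs]
  calc |a k| * ‖S k‖ * ‖u k‖ ≤ |a k| * 1 * 1 := by
        gcongr
        · exact hS k
        · exact hu k
    _ = _ := by ring

lemma norm_proj_le_one (k : K) :
    ‖ContinuousLinearMap.proj (R := ℝ) (φ := fun _ : K => ℝ) k‖ ≤ 1 :=
  ContinuousLinearMap.opNorm_le_bound _ zero_le_one fun v => by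
    rw [one_mul]; exact norm_le_pi_norm v k

lemma tame_topFun [Nonempty K] (hw : ∀ k, 0 < w k) : ∃ C, Tame (topFun w δ) C := by
  have hδ : 0 ≤ ∑ k, |δ k| := Finset.sum_nonneg fun k _ => abs_nonneg _
  have hpos : ∀ (z : ℝ × (K → ℝ)) k, 0 < w k * Real.exp (z.2 k - Real.sin z.1 ^ 2 * δ k / 2) :=
    fun z k => mul_pos (hw k) (Real.exp_pos _)
  refine ⟨1 + ∑ k, |δ k|, fun z => Finset.sum_pos (fun k _ => hpos z k) Finset.univ_nonempty,
    fun z => (hasFDerivAt_topFun z).differentiableAt, fun z => ?_,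
    fun φ y => (hasFDerivAt_d1_topFun φ y).differentiableAt, fun φ y => ?_⟩
  · rw [(hasFDerivAt_topFun z).fderiv]
    refine (norm_sum_le _ _).trans ?_
    rw [topFun, Finset.mul_sum]
    refine Finset.sum_le_sum fun k _ => ?_
    rw [norm_smul, Real.norm_eq_abs, abs_of_pos (hpos z k), mul_comm]
    refine mul_le_mul_of_nonneg_right ?_ (hpos z k).le
    refine ContinuousLinearMap.opNorm_le_bound _ (by positivity) fun v => ?_
    have h1 : |v.2 k| ≤ ‖v‖ := (norm_le_pi_norm v.2 k).trans (norm_snd_le v)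
    have h2 : |v.1| ≤ ‖v‖ := norm_fst_le v
    have h3 : |Real.sin z.1 * Real.cos z.1 * δ k| ≤ ∑ k, |δ k| := by
      rw [abs_mul, abs_mul]
      calc |Real.sin z.1| * |Real.cos z.1| * |δ k| ≤ 1 * 1 * |δ k| := by
            gcongr
            · exact Real.abs_sin_le_one _
            · exact Real.abs_cos_le_one _
        _ ≤ _ := by
            rw [one_mul, one_mul]
            exact Finset.single_le_sum (f := fun k => |δ k|) (fun k _ => abs_nonneg _)
              (Finset.mem_univ k)
    calc _ = |v.2 k - Real.sin z.1 * Real.cos z.1 * δ k * v.1| := by simp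
      _ ≤ |v.2 k| + |Real.sin z.1 * Real.cos z.1 * δ k * v.1| := abs_sub _ _
      _ ≤ ‖v‖ + (∑ k, |δ k|) * ‖v‖ := by
          rw [abs_mul (Real.sin z.1 * Real.cos z.1 * δ k)]
          gcongr
      _ = _ := by ring
  · rw [d2, (hasFDerivAt_d1_topFun φ y).fderiv]
    refine le_trans (norm_sum_smulRight_le _ _ _ norm_proj_le_one norm_proj_le_one) ?_
    rw [topFun, add_mul, one_mul]
    have e : ∀ k, |w k * Real.exp (y k - Real.sin φ ^ 2 * δ k / 2)| =
        w k * Real.exp (y k - Real.sin φ ^ 2 * δ k / 2) := fun k => abs_of_pos (hpos (φ, y) k)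
    simp_rw [e]
    have := mul_nonneg hδ (Finset.sum_nonneg fun k (_ : k ∈ Finset.univ) => (hpos (φ, y) k).le)
    linarith

/-- Mixed second derivatives of a sum of exponentials of single coordinates vanish, and the
φ-derivative of the variance correction cancels the diagonal ones: the inequality is an equality.
Hence only the diagonal of the total covariance difference enters the correction. -/
lemma heatIneq_topFun [DecidableEq K] (hw : ∀ k, 0 < w k) (D : K → K → ℝ) :
    HeatIneq (topFun w fun k => D k k) D where
  mono φ y k := by
    rw [d1_topFun, sum_apply]
    refine Finset.sum_nonneg fun l _ => ?_
    have h1 := hw l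
    have h2 : 0 ≤ (Pi.single k (1 : ℝ) : K → ℝ) l := by
      by_cases h : l = k
      · subst h; simp
      · simp [Pi.single_eq_of_ne h]
    simp only [smul_apply, ContinuousLinearMap.proj_apply, smul_eq_mul]
    positivity
  ineq φ _ y := by
    rw [(hasFDerivAt_topFun _).fderiv, d2, (hasFDerivAt_d1_topFun φ y).fderiv]
    refine le_of_eq ?_
    dsimp only
    obtain ⟨e, he⟩ : ∃ e : K → ℝ, ∀ k, w k * Real.exp (y k - Real.sin φ ^ 2 * D k k / 2) = e k :=
      ⟨_, fun k => rfl⟩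
    simp_rw [he]
    have h2 : ∀ k l, (∑ j, ((e j) •
        ContinuousLinearMap.proj (R := ℝ) (φ := fun _ : K => ℝ) j).smulRight
        (ContinuousLinearMap.proj (R := ℝ) (φ := fun _ : K => ℝ) j)) (Pi.single l 1)
        (Pi.single k 1) = if k = l then e k else 0 := by
      intro k l
      rw [sum_apply, sum_apply]
      simp only [ContinuousLinearMap.smulRight_apply, smul_apply,
        ContinuousLinearMap.proj_apply, smul_eq_mul, Pi.single_apply]
      rw [Finset.sum_eq_single k]
      · by_cases h : k = l <;> simp [h]
      · intro b _ hb; simp [hb]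
      · simp
    simp_rw [h2]
    simp only [mul_ite, mul_zero, Finset.sum_ite_eq, Finset.mem_univ, if_true,
      sum_apply, smul_apply, sub_apply, ContinuousLinearMap.comp_apply,
      ContinuousLinearMap.coe_snd', ContinuousLinearMap.coe_fst', map_zero, smul_eq_mul, mul_one,
      zero_sub, mul_neg, Finset.sum_neg_distrib]
    rw [neg_add_eq_zero, Finset.mul_sum]
    refine Finset.sum_congr rfl fun k _ => ?_
    ring

/-- **Comparison theorem.** If at each level the accumulated covariances of the first family of
noises dominate entrywise those of the second one, the recursion for the first family, corrected by
the difference of the total variances, is at most the recursion for the second one. -/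
theorem recE_le_recE [Nonempty K] [DecidableEq K] (hw : ∀ k, 0 < w k) (L : List (Level K))
    (hL : ∀ ℓ ∈ L, ℓ.Valid) (hD : CumNonneg (fun _ _ => 0) L) :
    recE (fun y => ENNReal.ofReal (∑ k, w k *
        Real.exp (y k - cumDiff (fun _ _ => 0) L k k / 2))) (L.map fun ℓ => (ℓ.r, ℓ.μ)) 0 ≤
      recE (fun y => ENNReal.ofReal (∑ k, w k * Real.exp (y k))) (L.map fun ℓ => (ℓ.r, ℓ.ν)) 0 := by
  have h := interp_antitone (tame_topFun hw) L hL hD (heatIneq_topFun hw _) 0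
  have h2 := ofReal_interp_pi_div_two (tame_topFun (δ := fun k => cumDiff (fun _ _ => 0) L k k) hw)
    L hL 0
  have h3 := ENNReal.ofReal_le_ofReal h
  rw [h2.2.1, h2.2.2] at h3
  simpa [topFun] using h3

end top

end

section

variable {K : Type*} [Fintype K]

/-! ### Constant noise -/

/-- The law of a noise which is the same Gaussian variable of variance `v` in every coordinate. -/
def constNoise (K : Type*) (v : ℝ) : Measure (K → ℝ) :=
  (gaussianReal 0 v.toNNReal).map fun t _ => t

lemma measurable_const_pi : Measurable (fun (t : ℝ) (_ : K) => t) :=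
  measurable_pi_lambda _ fun _ => measurable_id

lemma isGaussNoise_constNoise {v : ℝ} (hv : 0 ≤ v) :
    IsGaussNoise (constNoise K v) (fun _ _ => v) where
  gaussian := by
    have : (fun (t : ℝ) (_ : K) => t) =
        ⇑(ContinuousLinearMap.pi fun _ : K => ContinuousLinearMap.id ℝ ℝ) := by
      ext t k; simp
    unfold constNoise
    rw [this]
    exact isGaussian_map _
  mean k := by
    rw [constNoise, integral_map measurable_const_pi.aemeasurable
      (measurable_pi_apply k).aestronglyMeasurable]
    exact integral_id_gaussianReal
  cov k l := by
    have hm : AEStronglyMeasurable (fun a : K → ℝ => a k * a l)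
        ((gaussianReal 0 v.toNNReal).map fun t _ => t) := by fun_prop
    rw [constNoise, integral_map measurable_const_pi.aemeasurable hm]
    have h := variance_id_gaussianReal (μ := 0) (v := v.toNNReal)
    rw [variance_eq_sub IsGaussian.memLp_two_id] at h
    have h2 : ∫ x, id x ∂(gaussianReal 0 v.toNNReal) = 0 := integral_id_gaussianReal
    rw [h2, Real.coe_toNNReal _ hv] at h
    simpa [sq] using h

lemma isProbabilityMeasure_constNoise (v : ℝ) : IsProbabilityMeasure (constNoise K v) :=
  Measure.isProbabilityMeasure_map measurable_const_pi.aemeasurable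

lemma lintegral_exp_gaussianReal {v : ℝ} (hv : 0 ≤ v) (n : ℝ) :
    ∫⁻ t, ENNReal.ofReal (Real.exp (n * t)) ∂(gaussianReal 0 v.toNNReal) =
      ENNReal.ofReal (Real.exp (n ^ 2 * v / 2)) := by
  rw [← ofReal_integral_eq_lintegral_ofReal (integrable_exp_mul_gaussianReal n)
    (Eventually.of_forall fun t => (Real.exp_pos _).le)]
  congr 1
  have := congrFun (mgf_id_gaussianReal (μ := 0) (v := v.toNNReal)) n
  simp only [mgf, id] at this
  rw [this, Real.coe_toNNReal _ hv]
  congr 1; ring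

/-- `g (y + c) = e^c g y` for constants `c`. -/
def ExpHom (g : (K → ℝ) → ℝ≥0∞) (n : ℝ) : Prop :=
  ∀ y (c : ℝ), g (y + fun _ => c) = g y * ENNReal.ofReal (Real.exp (n * c))

lemma ExpHom.recE {g : (K → ℝ) → ℝ≥0∞} (hg : ExpHom g 1) (L : List (ℝ × Measure (K → ℝ)))
    (hL : ∀ ℓ ∈ L, 0 < ℓ.1) : ExpHom (recE g L) (L.map Prod.fst).prod := by
  induction L with
  | nil => simpa [SphericalSpinGlass.recE] using hg
  | cons ℓ L ih =>
    have ih := ih fun ℓ' h => hL ℓ' (List.mem_cons_of_mem _ h)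
    have hℓ := hL ℓ List.mem_cons_self
    intro y c
    simp only [SphericalSpinGlass.recE, List.map_cons, List.prod_cons]
    have e : ∀ a : K → ℝ, SphericalSpinGlass.recE g L (y + (fun _ => c) + a) ^ ℓ.1 =
        SphericalSpinGlass.recE g L (y + a) ^ ℓ.1 *
          ENNReal.ofReal (Real.exp (ℓ.1 * (L.map Prod.fst).prod * c)) := by
      intro a
      have : y + (fun _ => c) + a = (y + a) + fun _ => c := by abel
      rw [this, ih (y + a) c, ENNReal.mul_rpow_of_nonneg _ _ hℓ.le,
        ENNReal.ofReal_rpow_of_pos (Real.exp_pos _), ← Real.exp_mul]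
      congr 3; ring
    simp_rw [e]
    rw [lintegral_mul_const' _ _ ENNReal.ofReal_ne_top]

lemma lintegral_constNoise {g : (K → ℝ) → ℝ≥0∞} {n : ℝ} (hg : ExpHom g n) {v : ℝ} (hv : 0 ≤ v)
    {r : ℝ} (hr : 0 ≤ r) (hm : Measurable g) (y : K → ℝ) :
    ∫⁻ a, g (y + a) ^ r ∂(constNoise K v) =
      g y ^ r * ENNReal.ofReal (Real.exp ((r * n) ^ 2 * v / 2)) := by
  rw [constNoise, lintegral_map (by fun_prop) measurable_const_pi]
  have e : ∀ t : ℝ, g (y + fun _ => t) ^ r = g y ^ r * ENNReal.ofReal (Real.exp ((r * n) * t)) := by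
    intro t
    rw [hg y t, ENNReal.mul_rpow_of_nonneg _ _ hr, ENNReal.ofReal_rpow_of_pos (Real.exp_pos _),
      ← Real.exp_mul]
    congr 3; ring
  simp_rw [e]
  rw [lintegral_const_mul _ (by fun_prop), lintegral_exp_gaussianReal hv]

lemma measurable_recE {V : Type*} [AddCommMonoid V] [MeasurableSpace V] [MeasurableAdd₂ V]
    {g : V → ℝ≥0∞} (hg : Measurable g) (L : List (ℝ × Measure V)) (hL : ∀ ℓ ∈ L, SFinite ℓ.2) :
    Measurable (recE g L) := by
  induction L with
  | nil => exact hg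
  | cons ℓ L ih =>
    have ih := ih fun ℓ' h => hL ℓ' (List.mem_cons_of_mem _ h)
    have := hL ℓ List.mem_cons_self
    exact Measurable.lintegral_prod_right' (f := fun p : V × V => recE g L (p.1 + p.2) ^ ℓ.1)
      (by fun_prop)

/-! ### The bound for one Gaussian vector -/

/-- A level whose first noise is constant, of variance `a`, and whose second one has law `ν`
and covariance `B`. -/
structure InnerLevel (K : Type*) where
  r : ℝ
  a : ℝ
  B : K → K → ℝ
  ν : Measure (K → ℝ)

structure InnerLevel.Valid (ℓ : InnerLevel K) : Prop where
  r_pos : 0 < ℓ.r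
  r_le : ℓ.r ≤ 1
  a_nonneg : 0 ≤ ℓ.a
  hν : IsGaussNoise ℓ.ν ℓ.B

/-- The corresponding level of the interpolation. -/
def InnerLevel.toLevel (ℓ : InnerLevel K) : Level K :=
  ⟨ℓ.r, fun _ _ => ℓ.a, ℓ.B, constNoise K ℓ.a, ℓ.ν⟩

lemma InnerLevel.Valid.toLevel {ℓ : InnerLevel K} (h : ℓ.Valid) : ℓ.toLevel.Valid :=
  ⟨h.r_pos, h.r_le, isGaussNoise_constNoise h.a_nonneg, h.hν⟩

/-- The product of the exponents. -/
def expProd (L : List (InnerLevel K)) : ℝ := (L.map InnerLevel.r).prod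

/-- The contribution of the constant noises. -/
def constSum : List (InnerLevel K) → ℝ
  | [] => 0
  | ℓ :: L => constSum L + expProd (ℓ :: L) * ℓ.a / 2

lemma expProd_pos {L : List (InnerLevel K)} (hL : ∀ ℓ ∈ L, ℓ.Valid) : 0 < expProd L := by
  induction L with
  | nil => simp [expProd]
  | cons ℓ L ih =>
    have := ih fun ℓ' h => hL ℓ' (List.mem_cons_of_mem _ h)
    have h2 := (hL ℓ List.mem_cons_self).r_pos
    simp only [expProd, List.map_cons, List.prod_cons] at this ⊢
    positivity

/-- The inner recursion is homogeneous of degree equal to its product of exponents, so a constant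
noise factors out as a Gaussian exponential moment. Its level yields p² a/2, where p is the product
of exponents from that level inward; one factor p is kept outside `constSum`. -/
lemma recE_const {g : (K → ℝ) → ℝ≥0∞} (hg : ExpHom g 1) (hm : Measurable g)
    (L : List (InnerLevel K)) (hL : ∀ ℓ ∈ L, ℓ.Valid) (y : K → ℝ) :
    recE g (L.map fun ℓ => (ℓ.r, constNoise K ℓ.a)) y =
      g y ^ expProd L * ENNReal.ofReal (Real.exp (expProd L * constSum L)) := by
  induction L generalizing y with
  | nil => simp [recE, expProd, constSum]
  | cons ℓ L ih =>
    have hL' : ∀ ℓ ∈ L, ℓ.Valid := fun ℓ' h => hL ℓ' (List.mem_cons_of_mem _ h)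
    have hℓ := hL ℓ List.mem_cons_self
    have ih := ih hL'
    have h1 := hg.recE (L.map fun ℓ => (ℓ.r, constNoise K ℓ.a)) (by
      intro ℓ' h
      obtain ⟨ℓ'', h', rfl⟩ := List.mem_map.1 h
      exact (hL' _ h').r_pos)
    have hmr : Measurable (recE g (L.map fun ℓ => (ℓ.r, constNoise K ℓ.a))) :=
      measurable_recE hm _ (by
        intro ℓ' h
        obtain ⟨ℓ'', h', rfl⟩ := List.mem_map.1 h
        have := isProbabilityMeasure_constNoise (K := K) ℓ''.a
        infer_instance)
    simp only [List.map_cons, recE]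
    rw [lintegral_constNoise h1 hℓ.a_nonneg hℓ.r_pos.le hmr, ih]
    have e : (List.map Prod.fst (List.map (fun ℓ : InnerLevel K => (ℓ.r, constNoise K ℓ.a)) L)).prod
        = expProd L := by
      simp [expProd, Function.comp_def]
    have e2 : expProd (ℓ :: L) = ℓ.r * expProd L := by simp [expProd]
    rw [e, ENNReal.mul_rpow_of_nonneg _ _ hℓ.r_pos.le, ← ENNReal.rpow_mul,
      ENNReal.ofReal_rpow_of_pos (Real.exp_pos _), ← Real.exp_mul, mul_assoc,
      ← ENNReal.ofReal_mul (Real.exp_pos _).le, ← Real.exp_add, constSum, e2, mul_comm (expProd L)]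
    congr 3
    ring

/-- The accumulated covariance differences, started from `D`. -/
def InnerCum (D : K → K → ℝ) (L : List (InnerLevel K)) : Prop :=
  CumNonneg D (L.map InnerLevel.toLevel)

/-- Jensen's inequality through the tangent of exp at the mean. The right side may be infinite, so
integrability of the exponential is not required. -/
lemma exp_integral_le {Ω : Type*} [MeasurableSpace Ω] {P : Measure Ω} [IsProbabilityMeasure P]
    {f : Ω → ℝ} (hf : Integrable f P) :
    ENNReal.ofReal (Real.exp (∫ ω, f ω ∂P)) ≤ ∫⁻ ω, ENNReal.ofReal (Real.exp (f ω)) ∂P := by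
  by_cases hi : Integrable (fun ω => Real.exp (f ω)) P
  · rw [← ofReal_integral_eq_lintegral_ofReal hi (Eventually.of_forall fun _ => (Real.exp_pos _).le)]
    apply ENNReal.ofReal_le_ofReal
    set m := ∫ ω, f ω ∂P
    have h1 : Integrable (fun ω => Real.exp m * (1 + (f ω - m))) P :=
      ((integrable_const 1).add (hf.sub (integrable_const m))).const_mul _
    have h2 : ∫ ω, Real.exp m * (1 + (f ω - m)) ∂P = Real.exp m := by
      have hs : Integrable (fun ω => f ω - m) P := hf.sub (integrable_const m)
      rw [integral_const_mul, integral_add (integrable_const 1) hs,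
        integral_sub hf (integrable_const m)]
      simp [m]
    rw [← h2]
    refine integral_mono h1 hi fun ω => ?_
    have := Real.add_one_le_exp (f ω - m)
    calc Real.exp m * (1 + (f ω - m)) ≤ Real.exp m * Real.exp (f ω - m) := by
          gcongr; linarith
      _ = Real.exp (f ω) := by rw [← Real.exp_add]; congr 1; ring
  · have : ∫⁻ ω, ENNReal.ofReal (Real.exp (f ω)) ∂P = ⊤ := by
      by_contra hne
      apply hi
      refine ⟨(Real.continuous_exp.comp_aestronglyMeasurable hf.1), ?_⟩
      rw [hasFiniteIntegral_iff_ofReal (Eventually.of_forall fun _ => (Real.exp_pos _).le)]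
      exact lt_top_iff_ne_top.2 hne
    rw [this]
    exact le_top

lemma logSumExp_bound [Nonempty K] {w : K → ℝ} (hw : ∀ k, 0 < w k) (δ : K → ℝ) :
    ∃ C, ∀ y : K → ℝ, |Real.log (∑ k, w k * Real.exp (y k - δ k / 2))| ≤ C + ‖y‖ := by
  set W := ∑ k, w k * Real.exp (- δ k / 2) with hW
  have hWpos : 0 < W := Finset.sum_pos (fun k _ => mul_pos (hw k) (Real.exp_pos _))
    Finset.univ_nonempty
  refine ⟨|Real.log W|, fun y => ?_⟩
  have hS : 0 < ∑ k, w k * Real.exp (y k - δ k / 2) :=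
    Finset.sum_pos (fun k _ => mul_pos (hw k) (Real.exp_pos _)) Finset.univ_nonempty
  have hk : ∀ k, |y k| ≤ ‖y‖ := fun k => norm_le_pi_norm y k
  have hup : ∑ k, w k * Real.exp (y k - δ k / 2) ≤ W * Real.exp ‖y‖ := by
    rw [hW, Finset.sum_mul]
    refine Finset.sum_le_sum fun k _ => ?_
    rw [mul_assoc, ← Real.exp_add]
    have := (le_abs_self _).trans (hk k)
    have := (hw k).le
    gcongr
    linarith
  have hlo : W * Real.exp (-‖y‖) ≤ ∑ k, w k * Real.exp (y k - δ k / 2) := by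
    rw [hW, Finset.sum_mul]
    refine Finset.sum_le_sum fun k _ => ?_
    rw [mul_assoc, ← Real.exp_add]
    have := (neg_abs_le (y k))
    have := hk k
    have := (hw k).le
    gcongr
    linarith
  have h1 := Real.log_le_log hS hup
  have h2 := Real.log_le_log (by positivity) hlo
  rw [Real.log_mul hWpos.ne' (Real.exp_pos _).ne', Real.log_exp] at h1 h2
  rw [abs_le]
  constructor
  · linarith [neg_abs_le (Real.log W)]
  · linarith [le_abs_self (Real.log W)]

lemma integrable_logSumExp [Nonempty K] {μ : Measure (K → ℝ)} {A : K → K → ℝ}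
    (hμ : IsGaussNoise μ A) {w : K → ℝ} (hw : ∀ k, 0 < w k) (δ : K → ℝ) :
    Integrable (fun y => Real.log (∑ k, w k * Real.exp (y k - δ k / 2))) μ := by
  obtain ⟨C, hC⟩ := logSumExp_bound hw δ
  have := hμ.isProbabilityMeasure
  have hm : Measurable (fun y : K → ℝ => Real.log (∑ k, w k * Real.exp (y k - δ k / 2))) := by
    fun_prop
  refine ((integrable_const C).add (hμ.integrable_exp 1)).mono' hm.aestronglyMeasurable
    (Eventually.of_forall fun y => (hC y).trans ?_)
  have := Real.add_one_le_exp (1 * ‖y‖)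
  simp only [Pi.add_apply]
  linarith

lemma expHom_sumExp (w δ : K → ℝ) (hw : ∀ k, 0 < w k) :
    ExpHom (fun y => ENNReal.ofReal (∑ k, w k * Real.exp (y k - δ k / 2))) 1 := by
  intro y c
  simp only
  rw [← ENNReal.ofReal_mul (Finset.sum_nonneg fun k _ => (mul_pos (hw k) (Real.exp_pos _)).le),
    Finset.sum_mul]
  congr 1
  refine Finset.sum_congr rfl fun k _ => ?_
  rw [mul_assoc, ← Real.exp_add, Pi.add_apply]
  congr 2; ring

/-- The Guerra bound for a finite Gaussian vector. -/
theorem guerra_finite [Nonempty K] [DecidableEq K] {w : K → ℝ} (hw : ∀ k, 0 < w k)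
    {μ : Measure (K → ℝ)} {A : K → K → ℝ} (hμ : IsGaussNoise μ A) (c : ℝ)
    (hA : ∀ k l, 0 ≤ A k l - c) (L : List (InnerLevel K)) (hL : ∀ ℓ ∈ L, ℓ.Valid)
    (hcum : InnerCum (fun k l => A k l - c) L) :
    ENNReal.ofReal (Real.exp (expProd L * (constSum L + ∫ y, Real.log (∑ k, w k * Real.exp
        (y k - cumDiff (fun k l => A k l - c) (L.map InnerLevel.toLevel) k k / 2)) ∂μ))) ≤
      recE (fun y => ENNReal.ofReal (∑ k, w k * Real.exp (y k)))
        (L.map fun ℓ => (ℓ.r, ℓ.ν)) 0 := by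
  set δ : K → ℝ := fun k => cumDiff (fun k l => A k l - c) (L.map InnerLevel.toLevel) k k with hδ
  set gA : (K → ℝ) → ℝ≥0∞ := fun y => ENNReal.ofReal (∑ k, w k * Real.exp (y k - δ k / 2)) with hgA
  set gB : (K → ℝ) → ℝ≥0∞ := fun y => ENNReal.ofReal (∑ k, w k * Real.exp (y k)) with hgB
  set n := expProd L with hn
  have hnpos : 0 < n := expProd_pos hL
  have hPμ := hμ.isProbabilityMeasure
  have hgAm : Measurable gA := by fun_prop
  have hgBm : Measurable gB := by fun_prop
  have hgAh : ExpHom gA 1 := expHom_sumExp w δ hw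
  have hgBh : ExpHom gB 1 := by
    have := expHom_sumExp w (fun _ => 0) hw
    simpa using this
  have hLB : ∀ ℓ ∈ L.map (fun ℓ : InnerLevel K => (ℓ.r, ℓ.ν)), 0 < ℓ.1 ∧ SFinite ℓ.2 := by
    intro ℓ' h
    obtain ⟨ℓ'', h', rfl⟩ := List.mem_map.1 h
    have := (hL _ h').hν.isProbabilityMeasure
    exact ⟨(hL _ h').r_pos, inferInstance⟩
  -- positivity and finiteness of the right-hand side
  obtain ⟨R, hRpos, hR⟩ : ∃ R : ℝ, 0 < R ∧
      recE gB (L.map fun ℓ => (ℓ.r, ℓ.ν)) 0 = ENNReal.ofReal R := by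
    obtain ⟨⟨C, hC⟩, -, h2⟩ := ofReal_interp_pi_div_two (tame_topFun (δ := fun _ => 0) hw)
      (L.map InnerLevel.toLevel) (by
        intro ℓ h
        obtain ⟨ℓ', h', rfl⟩ := List.mem_map.1 h
        exact (hL _ h').toLevel) 0
    refine ⟨interp (topFun w fun _ => 0) (L.map InnerLevel.toLevel) (0, 0), hC.pos _, ?_⟩
    rw [h2]
    simp [hgB, topFun, List.map_map, Function.comp_def, InnerLevel.toLevel]
  rw [hR, ENNReal.ofReal_le_ofReal_iff hRpos.le, ← Real.le_log_iff_exp_le hRpos]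
  set M := ∫ y, Real.log (∑ k, w k * Real.exp (y k - δ k / 2)) ∂μ with hM
  have hMi := integrable_logSumExp hμ hw δ
  -- The Gaussian vector enters with exponent r = ε/n, which makes the total degree ε. After taking
  -- logarithms and dividing by ε, the limit ε → 0 isolates the expectation of the logarithm.
  have key : ∀ ε, 0 < ε → ε ≤ n → constSum L + M ≤ 1 / n * Real.log R + ε * (|c| / 2) := by
    intro ε hε hεn
    set r := ε / n with hr
    have hr0 : 0 < r := div_pos hε hnpos
    have hr1 : r ≤ 1 := (div_le_one hnpos).2 hεn
    have hrn : r * n = ε := div_mul_cancel₀ _ hnpos.ne'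
    have hk : 0 ≤ |c| - c := by linarith [le_abs_self c]
    have hz := isGaussNoise_constNoise (K := K) (le_refl (0 : ℝ))
    -- The constant c may have either sign. Constant noises of nonnegative variances |c|-c in the
    -- first family and |c| in the second make the first two partial sums |c|-c and A-c. The
    -- exponent 1 of the added outermost level leaves the degree ε unchanged.
    set L' : List (Level K) := ⟨1, fun _ _ => |c| - c, fun _ _ => 0, constNoise K (|c| - c),
      constNoise K 0⟩ :: ⟨r, A, fun _ _ => |c|, μ, constNoise K |c|⟩ ::
      L.map InnerLevel.toLevel with hL'
    have hval : ∀ ℓ ∈ L', ℓ.Valid := by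
      intro ℓ h
      rcases List.mem_cons.1 h with rfl | h
      · exact ⟨one_pos, le_rfl, isGaussNoise_constNoise hk, hz⟩
      rcases List.mem_cons.1 h with rfl | h
      · exact ⟨hr0, hr1, hμ, isGaussNoise_constNoise (abs_nonneg c)⟩
      · obtain ⟨ℓ', h', rfl⟩ := List.mem_map.1 h
        exact (hL _ h').toLevel
    have eD : (fun k l => (0 : ℝ) + Level.diff (⟨1, fun _ _ => |c| - c, fun _ _ => 0,
        constNoise K (|c| - c), constNoise K 0⟩ : Level K) k l +
        Level.diff (⟨r, A, fun _ _ => |c|, μ, constNoise K |c|⟩ : Level K) k l) =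
        fun k l => A k l - c := by
      ext k l; simp only [Level.diff]; ring
    have hcum' : CumNonneg (fun _ _ => 0) L' := by
      refine ⟨fun k l => by simpa [Level.diff] using hk, fun k l => ?_, ?_⟩
      · have := congrFun (congrFun eD k) l
        rw [this]; exact hA k l
      · rw [eD]; exact hcum
    have hcd : ∀ k, cumDiff (fun _ _ => 0) L' k k = δ k := by
      intro k
      simp only [hL', cumDiff]
      rw [eD]
    have main := recE_le_recE hw L' hval hcum'
    simp_rw [hcd] at main
    have eA : L'.map (fun ℓ => (ℓ.r, ℓ.μ)) = (1, constNoise K (|c| - c)) :: (r, μ) ::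
        L.map (fun ℓ => (ℓ.r, constNoise K ℓ.a)) := by
      simp [hL', List.map_map, Function.comp_def, InnerLevel.toLevel]
    have eB : L'.map (fun ℓ => (ℓ.r, ℓ.ν)) = (1, constNoise K 0) :: (r, constNoise K |c|) ::
        L.map (fun ℓ => (ℓ.r, ℓ.ν)) := by
      simp [hL', List.map_map, Function.comp_def, InnerLevel.toLevel]
    rw [eA, eB] at main
    -- evaluate the right-hand side
    have hB1 := hgBh.recE (L.map fun ℓ => (ℓ.r, ℓ.ν)) fun ℓ h => (hLB ℓ h).1
    have hBm := measurable_recE hgBm (L.map fun ℓ => (ℓ.r, ℓ.ν)) fun ℓ h => (hLB ℓ h).2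
    have hnB : (List.map Prod.fst (List.map (fun ℓ : InnerLevel K => (ℓ.r, ℓ.ν)) L)).prod = n := by
      simp [hn, expProd, Function.comp_def]
    rw [hnB] at hB1
    -- The auxiliary noise sees a function of degree ε after the power, so it costs only ε²|c|/2,
    -- which disappears after division by ε.
    have rhs : recE gB ((1, constNoise K 0) :: (r, constNoise K |c|) ::
        L.map (fun ℓ => (ℓ.r, ℓ.ν))) 0 = ENNReal.ofReal (R ^ r * Real.exp (ε ^ 2 * |c| / 2)) := by
      have h2 : ∀ y, recE gB ((r, constNoise K |c|) :: L.map (fun ℓ => (ℓ.r, ℓ.ν))) y =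
          recE gB (L.map fun ℓ => (ℓ.r, ℓ.ν)) y ^ r *
            ENNReal.ofReal (Real.exp (ε ^ 2 * |c| / 2)) := by
        intro y
        simp only [recE]
        rw [lintegral_constNoise hB1 (abs_nonneg c) hr0.le hBm, hrn]
      have h3 : ExpHom (recE gB ((r, constNoise K |c|) :: L.map (fun ℓ => (ℓ.r, ℓ.ν)))) ε := by
        intro y t
        rw [h2, h2, hB1 y t, ENNReal.mul_rpow_of_nonneg _ _ hr0.le,
          ENNReal.ofReal_rpow_of_pos (Real.exp_pos _), ← Real.exp_mul, mul_right_comm]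
        rw [show n * t * r = ε * t by rw [← hrn]; ring]
      have h4 : Measurable (recE gB ((r, constNoise K |c|) :: L.map (fun ℓ => (ℓ.r, ℓ.ν)))) := by
        have : recE gB ((r, constNoise K |c|) :: L.map (fun ℓ => (ℓ.r, ℓ.ν))) = fun y =>
          recE gB (L.map fun ℓ => (ℓ.r, ℓ.ν)) y ^ r *
            ENNReal.ofReal (Real.exp (ε ^ 2 * |c| / 2)) := funext h2
        rw [this]
        exact (hBm.pow_const r).mul_const _
      rw [recE, lintegral_constNoise h3 le_rfl zero_le_one h4, h2, hR]
      rw [ENNReal.ofReal_rpow_of_pos hRpos, ENNReal.rpow_one, mul_zero, zero_div, Real.exp_zero,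
        ENNReal.ofReal_one, mul_one, ← ENNReal.ofReal_mul (Real.rpow_nonneg hRpos.le r)]
    -- bound the left-hand side from below
    have hS : ∀ y : K → ℝ, 0 < ∑ k, w k * Real.exp (y k - δ k / 2) := fun y =>
      Finset.sum_pos (fun k _ => mul_pos (hw k) (Real.exp_pos _)) Finset.univ_nonempty
    have h5 : ∀ y, recE gA ((r, μ) :: L.map (fun ℓ => (ℓ.r, constNoise K ℓ.a))) y =
        ∫⁻ a, ENNReal.ofReal (Real.exp (ε * constSum L + ε * Real.log
          (∑ k, w k * Real.exp ((y + a) k - δ k / 2)))) ∂μ := by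
      intro y
      simp only [recE]
      refine lintegral_congr fun a => ?_
      rw [recE_const hgAh hgAm L hL, ENNReal.mul_rpow_of_nonneg _ _ hr0.le, ← ENNReal.rpow_mul,
        ENNReal.ofReal_rpow_of_pos (Real.exp_pos _), ← Real.exp_mul, ← hn,
        show n * r = ε by rw [mul_comm]; exact hrn, hgA]
      simp only
      rw [ENNReal.ofReal_rpow_of_pos (hS _), ← ENNReal.ofReal_mul (Real.rpow_nonneg (hS _).le _),
        Real.rpow_def_of_pos (hS _), ← Real.exp_add]
      congr 2
      rw [mul_right_comm n, mul_comm n r, hrn]; ring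
    have h6 : ExpHom (recE gA ((r, μ) :: L.map (fun ℓ => (ℓ.r, constNoise K ℓ.a)))) ε := by
      have := hgAh.recE ((r, μ) :: L.map (fun ℓ => (ℓ.r, constNoise K ℓ.a))) (by
        intro ℓ h
        rcases List.mem_cons.1 h with rfl | h
        · exact hr0
        · obtain ⟨ℓ', h', rfl⟩ := List.mem_map.1 h
          exact (hL _ h').r_pos)
      have e : (List.map Prod.fst ((r, μ) :: L.map
          (fun ℓ : InnerLevel K => (ℓ.r, constNoise K ℓ.a)))).prod = ε := by
        simp only [List.map_cons, List.prod_cons, List.map_map, Function.comp_def]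
        exact hrn
      rwa [e] at this
    have h7 : Measurable (recE gA ((r, μ) :: L.map (fun ℓ => (ℓ.r, constNoise K ℓ.a)))) := by
      refine measurable_recE hgAm _ ?_
      intro ℓ h
      rcases List.mem_cons.1 h with rfl | h
      · infer_instance
      · obtain ⟨ℓ', h', rfl⟩ := List.mem_map.1 h
        have := isProbabilityMeasure_constNoise (K := K) ℓ'.a
        infer_instance
    have lhs : ENNReal.ofReal (Real.exp (ε * (constSum L + M))) ≤
        recE gA ((1, constNoise K (|c| - c)) :: (r, μ) ::
          L.map (fun ℓ => (ℓ.r, constNoise K ℓ.a))) 0 := by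
      rw [recE, lintegral_constNoise h6 hk zero_le_one h7, ENNReal.rpow_one, h5]
      simp only [zero_add]
      -- The auxiliary constant noise can only increase the left side, so its factor is dropped.
      have h8 : (1 : ℝ≥0∞) ≤ ENNReal.ofReal (Real.exp ((1 * ε) ^ 2 * (|c| - c) / 2)) := by
        rw [← ENNReal.ofReal_one]
        apply ENNReal.ofReal_le_ofReal
        apply Real.one_le_exp
        positivity
      have hi : Integrable (fun a : K → ℝ => ε * constSum L + ε * Real.log
          (∑ k, w k * Real.exp (a k - δ k / 2))) μ := (integrable_const _).add (hMi.const_mul ε)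
      have h9 := exp_integral_le hi
      have hM' : ∫ a, ε * Real.log (∑ k, w k * Real.exp (a k - δ k / 2)) ∂μ = ε * M :=
        integral_const_mul _ _
      rw [integral_add (integrable_const _) (hMi.const_mul ε), hM'] at h9
      simp only [integral_const, probReal_univ, one_smul] at h9
      rw [mul_add]
      calc _ ≤ _ := h9
        _ ≤ _ := le_mul_of_one_le_right' h8
    have fin := lhs.trans (main.trans_eq rhs)
    rw [ENNReal.ofReal_le_ofReal_iff (by positivity), Real.rpow_def_of_pos hRpos, ← Real.exp_add,
      Real.exp_le_exp] at fin
    have : constSum L + M ≤ (Real.log R * r + ε ^ 2 * |c| / 2) / ε := by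
      rw [le_div_iff₀ hε]; linarith
    refine this.trans_eq ?_
    rw [hr]; field_simp
  suffices h : constSum L + M ≤ 1 / n * Real.log R by
    rw [one_div_mul_eq_div, le_div_iff₀ hnpos] at h
    linarith
  refine le_of_forall_pos_le_add fun η hη => ?_
  set ε := min n (η / (|c| / 2 + 1)) with hε
  have hden : 0 < |c| / 2 + 1 := by positivity
  have hεpos : 0 < ε := lt_min hnpos (by positivity)
  refine (key ε hεpos (min_le_left _ _)).trans ?_
  have h1 : ε * (|c| / 2) ≤ η := by
    calc ε * (|c| / 2) ≤ (η / (|c| / 2 + 1)) * (|c| / 2 + 1) := by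
          gcongr
          · exact min_le_right _ _
          · linarith
      _ = η := div_mul_cancel₀ _ hden.ne'
  linarith

end

section

/-! ### General properties of the recursion -/

section recursion

variable {V W S : Type*} [AddCommMonoid V] [MeasurableSpace V] [MeasurableAdd₂ V]
  [AddCommMonoid W] [MeasurableSpace W] [MeasurableAdd₂ W] [MeasurableSpace S]

/-- This moves the recursion from vectors indexed by the sampled pairs to the coordinate space of
the configurations, which no longer depends on the sample. -/
lemma recE_map {g : W → ℝ≥0∞} (hg : Measurable g) (Λ : V →+ W) (hΛ : Measurable Λ)
    (L : List (ℝ × Measure V)) (hL : ∀ ℓ ∈ L, SFinite ℓ.2) (v : V) :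
    recE g (L.map fun ℓ => (ℓ.1, ℓ.2.map Λ)) (Λ v) = recE (fun v => g (Λ v)) L v := by
  induction L generalizing v with
  | nil => rfl
  | cons ℓ L ih =>
    have hL' : ∀ ℓ ∈ L, SFinite ℓ.2 := fun ℓ' h => hL ℓ' (List.mem_cons_of_mem _ h)
    have hm := measurable_recE hg (L.map fun ℓ => (ℓ.1, ℓ.2.map Λ)) (by
      intro ℓ' h
      obtain ⟨ℓ'', h', rfl⟩ := List.mem_map.1 h
      have := hL' _ h'
      exact inferInstanceAs (SFinite (ℓ''.2.map Λ)))
    simp only [List.map_cons, recE]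
    rw [lintegral_map (by fun_prop) hΛ]
    refine lintegral_congr fun a => ?_
    rw [← map_add, ih hL']

lemma lintegral_rpow_le_rpow_lintegral {π : Measure S} [IsProbabilityMeasure π] {f : S → ℝ≥0∞}
    (hf : Measurable f) {r : ℝ} (hr : 0 < r) (hr1 : r ≤ 1) :
    ∫⁻ s, f s ^ r ∂π ≤ (∫⁻ s, f s ∂π) ^ r := by
  have h := eLpNorm'_le_eLpNorm'_of_exponent_le hr hr1 π (f := f) hf.aestronglyMeasurable
  simp only [eLpNorm', enorm_eq_self, ENNReal.rpow_one, div_one] at h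
  calc ∫⁻ s, f s ^ r ∂π = ((∫⁻ s, f s ^ r ∂π) ^ (1 / r)) ^ r := by
        rw [← ENNReal.rpow_mul, one_div_mul_cancel hr.ne', ENNReal.rpow_one]
    _ ≤ _ := ENNReal.rpow_le_rpow h hr.le

lemma measurable_recE_param {G : S → V → ℝ≥0∞} (hG : Measurable (Function.uncurry G))
    (L : List (ℝ × Measure V)) (hL : ∀ ℓ ∈ L, SFinite ℓ.2) :
    Measurable (fun p : S × V => recE (G p.1) L p.2) := by
  induction L with
  | nil => exact hG
  | cons ℓ L ih =>
    have ih := ih fun ℓ' h => hL ℓ' (List.mem_cons_of_mem _ h)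
    have := hL ℓ List.mem_cons_self
    have h2 : Measurable (fun q : (S × V) × V => recE (G q.1.1) L (q.1.2 + q.2)) :=
      ih.comp (by fun_prop : Measurable fun q : (S × V) × V => (q.1.1, q.1.2 + q.2))
    exact Measurable.lintegral_prod_right' (f := fun q : (S × V) × V =>
      recE (G q.1.1) L (q.1.2 + q.2) ^ ℓ.1) (h2.pow_const _)

/-- Jensen's inequality for the recursion. -/
lemma lintegral_recE_le {π : Measure S} [IsProbabilityMeasure π] {G : S → V → ℝ≥0∞}
    (hG : Measurable (Function.uncurry G)) (L : List (ℝ × Measure V))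
    (hL : ∀ ℓ ∈ L, 0 < ℓ.1 ∧ ℓ.1 ≤ 1 ∧ SFinite ℓ.2) (v : V) :
    ∫⁻ s, recE (G s) L v ∂π ≤ recE (fun v => ∫⁻ s, G s v ∂π) L v := by
  induction L generalizing v with
  | nil => exact le_rfl
  | cons ℓ L ih =>
    have hL' : ∀ ℓ ∈ L, 0 < ℓ.1 ∧ ℓ.1 ≤ 1 ∧ SFinite ℓ.2 :=
      fun ℓ' h => hL ℓ' (List.mem_cons_of_mem _ h)
    obtain ⟨h0, h1, h2⟩ := hL ℓ List.mem_cons_self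
    have hm := measurable_recE_param hG L fun ℓ h => (hL' ℓ h).2.2
    simp only [recE]
    have hm2 : Measurable (fun p : S × V => recE (G p.1) L (v + p.2)) :=
      hm.comp (by fun_prop : Measurable fun p : S × V => (p.1, v + p.2))
    rw [lintegral_lintegral_swap (hm2.pow_const _).aemeasurable]
    refine lintegral_mono fun a => ?_
    have hm3 : Measurable (fun s => recE (G s) L (v + a)) :=
      hm2.comp (by fun_prop : Measurable fun s : S => (s, a))
    exact (lintegral_rpow_le_rpow_lintegral hm3 h0 h1).trans
      (ENNReal.rpow_le_rpow (ih hL' _) h0.le)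

end recursion

/-! ### Gaussian averages of exponentials of quadratic functions -/

/-- Completing the square gives the exact value √(β/c) exp(m v²/(2c)) with c = β - m a. The
determinant is bounded by √(1 + ma/c) ≤ exp(ma/(2c)), so the bound becomes a sum over levels that is
already of Riemann type. -/
lemma lintegral_exp_sq_gaussianReal_le {a β m : ℝ} (ha : 0 ≤ a) (hm : 0 < m)
    (hβ : m * a < β) (v : ℝ) :
    ∫⁻ z, ENNReal.ofReal (Real.exp (m * ((v + z) ^ 2 / (2 * β)))) ∂(gaussianReal 0 a.toNNReal) ≤
      ENNReal.ofReal (Real.exp (m * (a / (2 * (β - m * a)) + v ^ 2 / (2 * (β - m * a))))) := by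
  rcases ha.eq_or_lt with rfl | ha
  · simp
  set c := β - m * a with hc
  have hcpos : 0 < c := sub_pos.2 hβ
  have hβpos : 0 < β := lt_trans (by positivity) hβ
  have ha' : 0 < a * β / c := by positivity
  have hne : a.toNNReal ≠ 0 := by simpa using ha
  have hne' : (a * β / c).toNNReal ≠ 0 := by simpa using ha'
  have key : ∀ z, gaussianPDFReal 0 a.toNNReal z * Real.exp (m * ((v + z) ^ 2 / (2 * β))) =
      (√(β / c) * Real.exp (m * (v ^ 2 / (2 * c)))) *
        gaussianPDFReal (m * a * v / c) (a * β / c).toNNReal z := by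
    intro z
    simp only [gaussianPDFReal, Real.coe_toNNReal _ ha.le, Real.coe_toNNReal _ ha'.le]
    have e1 : (√(2 * Real.pi * a))⁻¹ = √(β / c) * (√(2 * Real.pi * (a * β / c)))⁻¹ := by
      rw [show 2 * Real.pi * (a * β / c) = (2 * Real.pi * a) * (β / c) by ring,
        Real.sqrt_mul (by positivity) (β / c)]
      have h1 : √(β / c) ≠ 0 := (Real.sqrt_pos.2 (by positivity)).ne'
      have h2 : √(2 * Real.pi * a) ≠ 0 := (Real.sqrt_pos.2 (by positivity)).ne'
      field_simp
    have e2 : -(z - 0) ^ 2 / (2 * a) + m * ((v + z) ^ 2 / (2 * β)) =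
        m * (v ^ 2 / (2 * c)) + -(z - m * a * v / c) ^ 2 / (2 * (a * β / c)) := by
      have hβ' : β = c + m * a := by rw [hc]; ring
      rw [hβ'] at hβpos ⊢
      field_simp
      ring
    rw [e1, mul_assoc, ← Real.exp_add, e2, Real.exp_add]
    ring
  rw [gaussianReal_of_var_ne_zero _ hne, lintegral_withDensity_eq_lintegral_mul _
    (measurable_gaussianPDF _ _) (by fun_prop)]
  have e3 : ∀ z, (gaussianPDF 0 a.toNNReal * fun z => ENNReal.ofReal
      (Real.exp (m * ((v + z) ^ 2 / (2 * β))))) z =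
      ENNReal.ofReal (√(β / c) * Real.exp (m * (v ^ 2 / (2 * c)))) *
        gaussianPDF (m * a * v / c) (a * β / c).toNNReal z := by
    intro z
    simp only [Pi.mul_apply, gaussianPDF]
    rw [← ENNReal.ofReal_mul (gaussianPDFReal_nonneg _ _ _), key,
      ENNReal.ofReal_mul (by positivity)]
  rw [lintegral_congr e3, lintegral_const_mul _ (measurable_gaussianPDF _ _),
    lintegral_gaussianPDF_eq_one _ hne', mul_one]
  apply ENNReal.ofReal_le_ofReal
  rw [mul_add, Real.exp_add]
  gcongr
  rw [Real.sqrt_le_left (Real.exp_pos _).le, ← Real.exp_nat_mul]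
  have := Real.add_one_le_exp (((2 : ℕ) : ℝ) * (m * (a / (2 * c))))
  refine le_trans (le_of_eq ?_) this
  rw [show β = c + m * a by rw [hc]; ring]
  push_cast
  field_simp
  ring

lemma lintegral_pi_prod {ι : Type*} [Fintype ι] {μ : ι → Measure ℝ}
    [∀ i, IsProbabilityMeasure (μ i)] {f : ι → ℝ → ℝ≥0∞} (hf : ∀ i, Measurable (f i)) :
    ∫⁻ z, ∏ i, f i (z i) ∂(Measure.pi μ) = ∏ i, ∫⁻ x, f i x ∂(μ i) := by
  have h := iIndepFun_pi (μ := μ) (X := f) fun i => (hf i).aemeasurable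
  rw [lintegral_prod_eq_prod_lintegral_of_indepFun _ _ h
    fun i => (hf i).comp (measurable_pi_apply i)]
  refine Finset.prod_congr rfl fun i _ => ?_
  exact (measurePreserving_eval μ i).lintegral_comp (hf i)

/-- The law of a vector of independent centred Gaussian variables of variances `a i`. -/
def diagNoise {ι : Type*} [Fintype ι] (a : ι → ℝ) : Measure (ι → ℝ) :=
  Measure.pi fun i => gaussianReal 0 (a i).toNNReal

instance {ι : Type*} [Fintype ι] (a : ι → ℝ) : IsProbabilityMeasure (diagNoise a) := by
  unfold diagNoise; infer_instance

lemma lintegral_exp_quadratic_diagNoise_le {ι : Type*} [Fintype ι] {a β : ι → ℝ} {m : ℝ}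
    (ha : ∀ i, 0 ≤ a i) (hm : 0 < m) (hβ : ∀ i, m * a i < β i) (C : ℝ) (v : ι → ℝ) :
    ∫⁻ z, ENNReal.ofReal (Real.exp (m * (C + ∑ i, (v i + z i) ^ 2 / (2 * β i)))) ∂(diagNoise a) ≤
      ENNReal.ofReal (Real.exp (m * (C + ∑ i, a i / (2 * (β i - m * a i)) +
        ∑ i, v i ^ 2 / (2 * (β i - m * a i))))) := by
  have e : ∀ z : ι → ℝ, ENNReal.ofReal (Real.exp (m * (C + ∑ i, (v i + z i) ^ 2 / (2 * β i)))) =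
      ENNReal.ofReal (Real.exp (m * C)) *
        ∏ i, ENNReal.ofReal (Real.exp (m * ((v i + z i) ^ 2 / (2 * β i)))) := by
    intro z
    rw [← ENNReal.ofReal_prod_of_nonneg fun i _ => (Real.exp_pos _).le, ← Real.exp_sum,
      ← ENNReal.ofReal_mul (Real.exp_pos _).le, ← Real.exp_add, mul_add, Finset.mul_sum]
  simp_rw [e]
  rw [lintegral_const_mul _ (by fun_prop), diagNoise,
    lintegral_pi_prod (f := fun i z => ENNReal.ofReal (Real.exp (m * ((v i + z) ^ 2 / (2 * β i)))))
      fun i => by fun_prop]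
  calc _ ≤ ENNReal.ofReal (Real.exp (m * C)) * ∏ i, ENNReal.ofReal (Real.exp
        (m * (a i / (2 * (β i - m * a i)) + v i ^ 2 / (2 * (β i - m * a i))))) := by
        gcongr with i
        exact lintegral_exp_sq_gaussianReal_le (ha i) hm (hβ i) (v i)
    _ = _ := by
        rw [← ENNReal.ofReal_prod_of_nonneg fun i _ => (Real.exp_pos _).le, ← Real.exp_sum,
          ← ENNReal.ofReal_mul (Real.exp_pos _).le, ← Real.exp_add, ← Finset.mul_sum,
          Finset.sum_add_distrib]
        congr 2; ring

/-- The quadratic recursion: the precisions satisfy `γ i = γ (i+1) - n i a i`. -/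
lemma recE_quadratic_le {ι : Type*} [Fintype ι] {T : ℕ} {n : ℕ → ℝ} {a γ : ℕ → ι → ℝ}
    (hn : ∀ i, 0 < n i) (ha : ∀ i j, 0 ≤ a i j) (hγ : ∀ i ≤ T, ∀ j, 0 < γ i j)
    (hγa : ∀ i < T, ∀ j, γ i j = γ (i + 1) j - n i * a i j) {g : (ι → ℝ) → ℝ≥0∞} {C : ℝ}
    {v₀ : ι → ℝ} (hg : ∀ v, g v ≤ ENNReal.ofReal
      (Real.exp (n T * (C + ∑ j, (v j + v₀ j) ^ 2 / (2 * γ T j))))) (k : ℕ) (i : ℕ)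
    (hik : i + k = T) (v : ι → ℝ) :
    recE g ((List.range' i k).map fun i => (n i / n (i + 1), diagNoise (a i))) v ≤
      ENNReal.ofReal (Real.exp (n i * (C + ∑ l ∈ Finset.Ico i T, ∑ j, a l j / (2 * γ l j) +
        ∑ j, (v j + v₀ j) ^ 2 / (2 * γ i j)))) := by
  induction k generalizing i v with
  | zero =>
    obtain rfl : i = T := by omega
    simpa [recE] using hg v
  | succ k ih =>
    have hi : i < T := by omega
    rw [List.range'_succ, List.map_cons, recE]
    simp only
    set S : ℝ := ∑ l ∈ Finset.Ico (i + 1) T, ∑ j, a l j / (2 * γ l j) with hS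
    -- The exponent n_i/n_{i+1} turns the prefactor n_{i+1} of the inductive bound into n_i.
    have h1 : ∀ z : ι → ℝ, recE g ((List.range' (i + 1) k).map fun i =>
        (n i / n (i + 1), diagNoise (a i))) (v + z) ^ (n i / n (i + 1)) ≤
        ENNReal.ofReal (Real.exp (n i * ((C + S) +
          ∑ j, ((v j + v₀ j) + z j) ^ 2 / (2 * γ (i + 1) j)))) := by
      intro z
      refine (ENNReal.rpow_le_rpow (ih (i + 1) (by omega) (v + z))
        (div_pos (hn i) (hn _)).le).trans_eq ?_
      rw [ENNReal.ofReal_rpow_of_pos (Real.exp_pos _), ← Real.exp_mul, mul_right_comm,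
        mul_div_cancel₀ _ (hn (i + 1)).ne']
      have e : ∀ j, (v + z) j + v₀ j = (v j + v₀ j) + z j := fun j => by
        rw [Pi.add_apply, add_right_comm]
      simp_rw [e, hS]
    refine (lintegral_mono h1).trans ((lintegral_exp_quadratic_diagNoise_le (ha i) (hn i)
      (fun j => by have := hγa i hi j; have := hγ i hi.le j; linarith) (C + S)
      (fun j => v j + v₀ j)).trans_eq ?_)
    rw [Finset.sum_eq_sum_Ico_succ_bot hi, ← hS]
    simp_rw [← hγa i hi]
    congr 3
    ring

end

section

/-! ### Two Gaussian vectors -/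

section noises

variable {K ι : Type*} [Fintype K] [Fintype ι]

lemma hasGaussianLaw_of_process {Ω T : Type*} [MeasurableSpace Ω] {P : Measure Ω} {Y : T → Ω → ℝ}
    (hY : IsGaussianProcess Y P) (s : K → T) : HasGaussianLaw (fun ω k => Y (s k) ω) P := by
  have h := (hY.comp_right s).hasGaussianLaw Finset.univ
  have h2 := h.map_fun (ContinuousLinearMap.pi fun k : K =>
    ContinuousLinearMap.proj (R := ℝ) (φ := fun _ : (Finset.univ : Finset K) => ℝ)
      ⟨k, Finset.mem_univ k⟩)
  exact h2

/-- The linear map with coefficients `c`. -/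
def coefMap (c : K → ι → ℝ) : (ι → ℝ) →+ (K → ℝ) where
  toFun v k := ∑ j, v j * c k j
  map_zero' := by ext; simp
  map_add' v v' := by ext; simp [add_mul, Finset.sum_add_distrib]

lemma coefMap_apply (c : K → ι → ℝ) (v : ι → ℝ) (k : K) : coefMap c v k = ∑ j, v j * c k j := rfl

lemma continuous_coefMap (c : K → ι → ℝ) : Continuous (coefMap c) :=
  continuous_pi fun k => by simp only [coefMap_apply]; fun_prop

lemma isGaussNoise_diagNoise [DecidableEq ι] {a : ι → ℝ} (ha : ∀ i, 0 ≤ a i) :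
    IsGaussNoise (diagNoise a) (fun i j => if i = j then a i else 0) := by
  have hind : iIndepFun (fun (i : ι) (z : ι → ℝ) => z i) (diagNoise a) :=
    iIndepFun_pi (X := fun _ x => x) fun i => aemeasurable_id
  have hlaw : ∀ i, (diagNoise a).map (fun z => z i) = gaussianReal 0 (a i).toNNReal := fun i =>
    (measurePreserving_eval (fun i => gaussianReal 0 (a i).toNNReal) i).map_eq
  have hg : ∀ i, HasGaussianLaw (fun z : ι → ℝ => z i) (diagNoise a) := fun i =>
    ⟨by rw [hlaw]; infer_instance⟩
  have hgl := iIndepFun.hasGaussianLaw hg hind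
  have hme : ∀ i, AEMeasurable (fun z : ι → ℝ => z i) (diagNoise a) := fun i =>
    (measurable_pi_apply i).aemeasurable
  have hmean : ∀ i, ∫ z, z i ∂(diagNoise a) = 0 := by
    intro i
    have : ∫ x, id x ∂((diagNoise a).map fun z => z i) = 0 := by
      rw [hlaw]; exact integral_id_gaussianReal
    rwa [integral_map (hme i) aestronglyMeasurable_id] at this
  refine ⟨?_, hmean, fun i j => ?_⟩
  · have := hgl.isGaussian_map
    rwa [show (fun (z : ι → ℝ) (i : ι) => z i) = id from rfl, Measure.map_id] at this
  · split_ifs with h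
    · subst h
      have hm : AEStronglyMeasurable (fun x : ℝ => x * x) ((diagNoise a).map fun z => z i) := by
        fun_prop
      have h1 : ∫ x, x * x ∂((diagNoise a).map fun z => z i) = a i := by
        rw [hlaw]
        have h := variance_id_gaussianReal (μ := 0) (v := (a i).toNNReal)
        rw [variance_eq_sub IsGaussian.memLp_two_id] at h
        have h2 : ∫ x, id x ∂(gaussianReal 0 (a i).toNNReal) = 0 := integral_id_gaussianReal
        rw [h2, Real.coe_toNNReal _ (ha i)] at h
        simpa [sq] using h
      rwa [integral_map (hme i) hm] at h1
    · have := (hind.indepFun h).integral_fun_mul_eq_mul_integral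
        (measurable_pi_apply i).aestronglyMeasurable (measurable_pi_apply j).aestronglyMeasurable
      rw [this, hmean, zero_mul]

lemma isGaussNoise_coefMap {a : ι → ℝ} (ha : ∀ i, 0 ≤ a i) (c : K → ι → ℝ) :
    IsGaussNoise ((diagNoise a).map (coefMap c)) (fun k l => ∑ j, a j * (c k j * c l j)) := by
  classical
  have hd := isGaussNoise_diagNoise ha
  have hm := (continuous_coefMap c).measurable
  have h2 : ∀ i j, Integrable (fun z : ι → ℝ => z i * z j) (diagNoise a) := fun i j =>
    (hd.memLp_eval i).integrable_mul (hd.memLp_eval j)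
  have h1 : ∀ i, Integrable (fun z : ι → ℝ => z i) (diagNoise a) := fun i =>
    (hd.memLp_eval i).integrable (by norm_num)
  refine ⟨?_, fun k => ?_, fun k l => ?_⟩
  · have := hd.gaussian
    have e : ⇑(coefMap c) = ⇑(ContinuousLinearMap.pi fun k : K => ∑ j, c k j •
        ContinuousLinearMap.proj (R := ℝ) (φ := fun _ : ι => ℝ) j) := by
      ext v k
      simp [coefMap_apply, mul_comm]
    rw [e]
    exact isGaussian_map _
  · rw [integral_map hm.aemeasurable (measurable_pi_apply k).aestronglyMeasurable]
    simp only [coefMap_apply]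
    rw [integral_finsetSum _ fun j _ => (h1 j).mul_const _]
    simp [integral_mul_const, hd.mean]
  · have hms : AEStronglyMeasurable (fun y : K → ℝ => y k * y l)
      ((diagNoise a).map (coefMap c)) := by fun_prop
    rw [integral_map hm.aemeasurable hms]
    simp only [coefMap_apply, Finset.sum_mul_sum]
    have e : ∀ (z : ι → ℝ) i j, z i * c k i * (z j * c l j) = z i * z j * (c k i * c l j) :=
      fun z i j => by ring
    simp_rw [e]
    rw [integral_finsetSum _ fun i _ => integrable_finsetSum _ fun j _ => (h2 i j).mul_const _]
    refine Finset.sum_congr rfl fun i _ => ?_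
    rw [integral_finsetSum _ fun j _ => (h2 i j).mul_const _]
    simp_rw [integral_mul_const, hd.cov]
    simp

end noises

/-! ### Covariance of a coupled pair and its diagonalizing coordinates -/

section pairs

variable {K : Type*} [Fintype K] {N : ℕ}

/-- The covariance of `X^1(σ^1) + X^2(σ^2)`. -/
def pairCov (ξ : ℝ → ℝ) (t : ℝ) (N : ℕ) (p q : Config N × Config N) : ℝ :=
  N * (ξ (overlap p.1 q.1) + ξ (overlap p.2 q.2) +
    t * (ξ (overlap p.1 q.2) + ξ (overlap p.2 q.1)))

variable {Ω : Type*} [MeasurableSpace Ω] {P : Measure Ω} {ξ : ℝ → ℝ} {t : ℝ}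
  {X : Fin 2 → Config N → Ω → ℝ}

lemma IsCoupledPair.memLp (hX : IsCoupledPair P ξ t N X) (j : Fin 2) (σ : Config N) :
    MemLp (X j σ) 2 P := (hX.gaussian.hasGaussianLaw_eval (j, σ)).memLp_two

lemma IsCoupledPair.isGaussianProcess_add (hX : IsCoupledPair P ξ t N X) :
    IsGaussianProcess (fun (p : Config N × Config N) ω => X 0 p.1 ω + X 1 p.2 ω) P := by
  classical
  refine hX.gaussian.of_isGaussianProcess fun p => ⟨{(0, p.1), (1, p.2)},
    ContinuousLinearMap.proj (R := ℝ) (φ := fun _ => ℝ) ⟨(0, p.1), by simp⟩ +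
    ContinuousLinearMap.proj (R := ℝ) (φ := fun _ => ℝ) ⟨(1, p.2), by simp⟩, fun ω => rfl⟩

lemma IsCoupledPair.measurable_add (hX : IsCoupledPair P ξ t N X) (p : Config N × Config N) :
    Measurable (fun ω => X 0 p.1 ω + X 1 p.2 ω) :=
  ((hX.measurable 0).comp (measurable_const.prodMk measurable_id)).add
    ((hX.measurable 1).comp (measurable_const.prodMk measurable_id))

lemma IsCoupledPair.cov_add (hX : IsCoupledPair P ξ t N X) (p q : Config N × Config N) :
    ∫ ω, (X 0 p.1 ω + X 1 p.2 ω) * (X 0 q.1 ω + X 1 q.2 ω) ∂P = pairCov ξ t N p q := by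
  have hi : ∀ i j σ τ, Integrable (fun ω => X i σ ω * X j τ ω) P := fun i j σ τ =>
    (hX.memLp i σ).integrable_mul (hX.memLp j τ)
  have e : ∀ ω, (X 0 p.1 ω + X 1 p.2 ω) * (X 0 q.1 ω + X 1 q.2 ω) =
      ∑ i : Fin 2, ∑ j : Fin 2, X i (if i = 0 then p.1 else p.2) ω *
        X j (if j = 0 then q.1 else q.2) ω := by
    intro ω
    simp [Fin.sum_univ_two]; ring
  simp_rw [e]
  rw [integral_finsetSum _ fun i _ => integrable_finsetSum _ fun j _ => hi _ _ _ _]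
  simp_rw [integral_finsetSum _ fun j _ => hi _ j _ _, hX.covariance]
  simp [Fin.sum_univ_two, pairCov]; ring

lemma IsCoupledPair.isGaussNoise (hX : IsCoupledPair P ξ t N X) (s : K → Config N × Config N) :
    IsGaussNoise (P.map fun ω k => X 0 (s k).1 ω + X 1 (s k).2 ω)
      (fun k l => pairCov ξ t N (s k) (s l)) := by
  have hm : Measurable (fun ω k => X 0 (s k).1 ω + X 1 (s k).2 ω) :=
    measurable_pi_lambda _ fun k => hX.measurable_add (s k)
  refine ⟨(hasGaussianLaw_of_process hX.isGaussianProcess_add s).isGaussian_map,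
    fun k => ?_, fun k l => ?_⟩
  · rw [integral_map hm.aemeasurable (measurable_pi_apply k).aestronglyMeasurable]
    have hi : ∀ j σ, Integrable (fun ω => X j σ ω) P := fun j σ =>
      have := hX.gaussian.isProbabilityMeasure
      (hX.memLp j σ).integrable (by norm_num)
    rw [integral_add (hi _ _) (hi _ _), hX.centered, hX.centered, add_zero]
  · have hms : AEStronglyMeasurable (fun y : K → ℝ => y k * y l)
      (P.map fun ω k => X 0 (s k).1 ω + X 1 (s k).2 ω) := by fun_prop
    rw [integral_map hm.aemeasurable hms]
    exact hX.cov_add (s k) (s l)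

/-- The coefficients of a pair in the orthonormal coordinates `(1,η)/√2`, `(1,-η)/√2`. -/
def pairCoef (η : ℝ) (p : Config N × Config N) (j : Bool × Fin N) : ℝ :=
  ((p.1 : EuclideanSpace ℝ (Fin N)) j.2 +
    (if j.1 then η else -η) * (p.2 : EuclideanSpace ℝ (Fin N)) j.2) / √2

lemma sum_mul_eq_overlap (hN : N ≠ 0) (σ τ : Config N) :
    ∑ i, (σ : EuclideanSpace ℝ (Fin N)) i * (τ : EuclideanSpace ℝ (Fin N)) i =
      N * overlap σ τ := by
  have : (N : ℝ) ≠ 0 := by exact_mod_cast hN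
  rw [overlap, mul_inv_cancel_left₀ this, PiLp.inner_apply]
  simp [mul_comm]

lemma overlap_comm (σ τ : Config N) : overlap σ τ = overlap τ σ := by
  rw [overlap, overlap, real_inner_comm]

lemma abs_overlap_le (σ τ : Config N) : |overlap σ τ| ≤ 1 := by
  rcases N.eq_zero_or_pos with rfl | hN
  · simp [overlap]
  have hN : (0 : ℝ) < N := by exact_mod_cast hN
  rw [overlap, abs_mul, abs_inv, abs_of_pos hN, inv_mul_le_iff₀ hN, mul_one]
  refine (abs_real_inner_le_norm _ _).trans_eq ?_
  rw [norm_eq_of_mem_sphere, norm_eq_of_mem_sphere, Real.mul_self_sqrt hN.le]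

lemma overlap_mem (σ τ : Config N) : overlap σ τ ∈ Icc (-1 : ℝ) 1 :=
  abs_le.1 (abs_overlap_le σ τ)

/-- The matrix [[x, ηy],[ηy, x]] has eigenvectors (1,η) and (1,-η) with eigenvalues x+y and x-y.
Independent noises with these variances therefore weight overlaps within a replica by x and cross
overlaps by ηy. -/
lemma sum_pairCoef (hN : N ≠ 0) {η : ℝ} (hη : η * η = 1) (x y : ℝ) (p q : Config N × Config N) :
    ∑ j, (if j.1 then x + y else x - y) * (pairCoef η p j * pairCoef η q j) =
      N * (x * (overlap p.1 q.1 + overlap p.2 q.2) +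
        η * y * (overlap p.1 q.2 + overlap p.2 q.1)) := by
  have h2 : √(2 : ℝ) * √2 = 2 := Real.mul_self_sqrt (by norm_num)
  rw [Fintype.sum_prod_type]
  simp only [Fintype.sum_bool, pairCoef, if_true, Bool.false_eq_true, if_false]
  rw [← Finset.sum_add_distrib]
  have e : ∀ i : Fin N, (x + y) * ((((p.1 : EuclideanSpace ℝ (Fin N)) i +
      η * (p.2 : EuclideanSpace ℝ (Fin N)) i) / √2) * (((q.1 : EuclideanSpace ℝ (Fin N)) i +
      η * (q.2 : EuclideanSpace ℝ (Fin N)) i) / √2)) +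
      (x - y) * ((((p.1 : EuclideanSpace ℝ (Fin N)) i +
      -η * (p.2 : EuclideanSpace ℝ (Fin N)) i) / √2) * (((q.1 : EuclideanSpace ℝ (Fin N)) i +
      -η * (q.2 : EuclideanSpace ℝ (Fin N)) i) / √2)) =
      x * ((p.1 : EuclideanSpace ℝ (Fin N)) i * (q.1 : EuclideanSpace ℝ (Fin N)) i) +
      x * ((p.2 : EuclideanSpace ℝ (Fin N)) i * (q.2 : EuclideanSpace ℝ (Fin N)) i) +
      (η * y * ((p.1 : EuclideanSpace ℝ (Fin N)) i * (q.2 : EuclideanSpace ℝ (Fin N)) i) +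
      η * y * ((p.2 : EuclideanSpace ℝ (Fin N)) i * (q.1 : EuclideanSpace ℝ (Fin N)) i)) := by
    intro i
    rw [div_mul_div_comm, div_mul_div_comm, h2]
    linear_combination (x * ((p.2 : EuclideanSpace ℝ (Fin N)) i *
      (q.2 : EuclideanSpace ℝ (Fin N)) i)) * hη
  rw [Finset.sum_congr rfl fun i _ => e i]
  simp only [Finset.sum_add_distrib, ← Finset.mul_sum, sum_mul_eq_overlap hN]
  ring

end pairs

end

section

/-! ### The hierarchical comparison for finitely many pairs of configurations -/

/-- `ψ` plays the role of `ξ'` on `[0,1]`, for an even convex function `ξ` on `[-1,1]`. -/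
structure IsProfile (ξ ψ : ℝ → ℝ) : Prop where
  even : ∀ s ∈ Icc (-1 : ℝ) 1, ξ (-s) = ξ s
  psi_zero : ψ 0 = 0
  psi_mono : MonotoneOn ψ (Icc 0 1)
  tangent : ∀ q ∈ Icc (0 : ℝ) 1, ∀ r ∈ Icc (-1 : ℝ) 1, ξ q + ψ q * (r - q) ≤ ξ r

/-- The function `θ(q) = q ξ'(q) - ξ(q)`. -/
def theta (ξ ψ : ℝ → ℝ) (q : ℝ) : ℝ := q * ψ q - ξ q

/-- The distance of `ξ` from its tangent at `q`. -/
def slack (ξ ψ : ℝ → ℝ) (r q : ℝ) : ℝ := ξ r + theta ξ ψ q - r * ψ q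

/-- The increment of `f` over the cell `[q_i,q_{i+1}]`. -/
def inc (f : ℝ → ℝ) (q : ℕ → ℝ) (i : ℕ) : ℝ := f (q (i + 1)) - f (q i)

/-- The increment of `f(· ∧ v)` over the cell `[q_i,q_{i+1}]`. -/
def incMin (f : ℝ → ℝ) (v : ℝ) (q : ℕ → ℝ) (i : ℕ) : ℝ := f (min (q (i + 1)) v) - f (min (q i) v)

/-- The variances of the two kinds of noise at level `i`. -/
def levelVar {N : ℕ} (ψ : ℝ → ℝ) (t v : ℝ) (q : ℕ → ℝ) (i : ℕ) (j : Bool × Fin N) : ℝ :=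
  if j.1 then inc ψ q i + t * incMin ψ v q i else inc ψ q i - t * incMin ψ v q i

section

variable {ξ ψ : ℝ → ℝ}

lemma IsProfile.slack_nonneg (hp : IsProfile ξ ψ) {r q : ℝ} (hr : r ∈ Icc (-1 : ℝ) 1) (hq : q ∈ Icc (0 : ℝ) 1) :
    0 ≤ slack ξ ψ r q := by
  have := hp.tangent q hq r hr
  rw [slack, theta]
  linarith

/-- The tangent at q' evaluated at q gives θ(q') ≥ qψ(q') - ξ(q), and ψ is nondecreasing. -/
lemma IsProfile.theta_mono (hp : IsProfile ξ ψ) : MonotoneOn (theta ξ ψ) (Icc 0 1) := by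
  intro q hq q' hq' h
  have h1 := hp.tangent q' hq' q ⟨by linarith [hq.1], hq.2⟩
  have h2 := hp.psi_mono hq hq' h
  simp only [theta]
  nlinarith [hq.1]

end

lemma min_mem_Icc {a v : ℝ} (ha : a ∈ Icc (0 : ℝ) 1) (hv : v ∈ Icc (0 : ℝ) 1) :
    min a v ∈ Icc (0 : ℝ) 1 := ⟨le_min ha.1 hv.1, (min_le_left _ _).trans ha.2⟩

lemma inc_nonneg {f : ℝ → ℝ} (hf : MonotoneOn f (Icc 0 1)) {q : ℕ → ℝ} (hq : Monotone q)
    (hq01 : ∀ i, q i ∈ Icc (0 : ℝ) 1) (i : ℕ) : 0 ≤ inc f q i :=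
  sub_nonneg.2 (hf (hq01 _) (hq01 _) (hq i.le_succ))

lemma incMin_nonneg {f : ℝ → ℝ} (hf : MonotoneOn f (Icc 0 1)) {q : ℕ → ℝ} (hq : Monotone q)
    (hq01 : ∀ i, q i ∈ Icc (0 : ℝ) 1) {v : ℝ} (hv : v ∈ Icc (0 : ℝ) 1) (i : ℕ) :
    0 ≤ incMin f v q i :=
  sub_nonneg.2 (hf (min_mem_Icc (hq01 _) hv) (min_mem_Icc (hq01 _) hv)
    (min_le_min_right _ (hq i.le_succ)))

lemma incMin_le_inc {f : ℝ → ℝ} (hf : MonotoneOn f (Icc 0 1)) {q : ℕ → ℝ} (hq : Monotone q)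
    (hq01 : ∀ i, q i ∈ Icc (0 : ℝ) 1) {v : ℝ} (hv : v ∈ Icc (0 : ℝ) 1) (i : ℕ) :
    incMin f v q i ≤ inc f q i := by
  have h := hq i.le_succ
  simp only [incMin, inc]
  rcases le_total (q (i + 1)) v with h1 | h1
  · rw [min_eq_left h1, min_eq_left (h.trans h1)]
  · rw [min_eq_right h1]
    rcases le_total (q i) v with h2 | h2
    · rw [min_eq_left h2]
      linarith [hf hv (hq01 (i + 1)) h1]
    · rw [min_eq_right h2]
      linarith [hf (hq01 i) (hq01 (i + 1)) h]

lemma levelVar_nonneg {N : ℕ} {f : ℝ → ℝ} (hf : MonotoneOn f (Icc 0 1)) {q : ℕ → ℝ}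
    (hq : Monotone q) (hq01 : ∀ i, q i ∈ Icc (0 : ℝ) 1) {v : ℝ} (hv : v ∈ Icc (0 : ℝ) 1) {t : ℝ}
    (ht : t ∈ Icc (0 : ℝ) 1) (i : ℕ) (j : Bool × Fin N) : 0 ≤ levelVar f t v q i j := by
  have h1 := incMin_nonneg hf hq hq01 hv i
  have h2 := incMin_le_inc hf hq hq01 hv i
  have h3 : t * incMin f v q i ≤ incMin f v q i := mul_le_of_le_one_left h1 ht.2
  have h4 : 0 ≤ t * incMin f v q i := mul_nonneg ht.1 h1
  rw [levelVar]
  split_ifs <;> linarith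

lemma neg_mem_Icc_one {r : ℝ} (hr : r ∈ Icc (-1 : ℝ) 1) : -r ∈ Icc (-1 : ℝ) 1 :=
  ⟨by linarith [hr.2], by linarith [hr.1]⟩

lemma sign_mul_mem {η : ℝ} (hη : η = 1 ∨ η = -1) {r : ℝ} (hr : r ∈ Icc (-1 : ℝ) 1) :
    η * r ∈ Icc (-1 : ℝ) 1 := by
  rcases hη with rfl | rfl
  · simpa using hr
  · simpa using neg_mem_Icc_one hr

lemma IsProfile.sign_mul {ξ ψ : ℝ → ℝ} (hp : IsProfile ξ ψ) {η : ℝ} (hη : η = 1 ∨ η = -1) {r : ℝ}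
    (hr : r ∈ Icc (-1 : ℝ) 1) : ξ (η * r) = ξ r := by
  rcases hη with rfl | rfl
  · simp
  · simpa using hp.even r hr

section scheme

variable {K : Type*} [Fintype K] {N : ℕ}

/-- The levels of the interpolation for the pairs of configurations `s k`. -/
def pairLevel (ξ ψ : ℝ → ℝ) (t v η : ℝ) (q n : ℕ → ℝ) (s : K → Config N × Config N) (i : ℕ) :
    InnerLevel K where
  r := n i / n (i + 1)
  -- The 2 counts the two overlaps within the replicas, and with weight t the two cross overlaps. It
  -- cancels the 1/2 in `constSum`.
  a := 2 * N * (inc (theta ξ ψ) q i + t * incMin (theta ξ ψ) v q i)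
  B k l := ∑ j, levelVar ψ t v q i j * (pairCoef η (s k) j * pairCoef η (s l) j)
  ν := (diagNoise (levelVar ψ t v q i)).map (coefMap fun k => pairCoef η (s k))

/-- The accumulated covariance differences. -/
def pairSlack (ξ ψ : ℝ → ℝ) (t v η : ℝ) (q : ℕ → ℝ) (s : K → Config N × Config N) (i : ℕ)
    (k l : K) : ℝ :=
  N * (slack ξ ψ (overlap (s k).1 (s l).1) (q i) + slack ξ ψ (overlap (s k).2 (s l).2) (q i) +
    t * (slack ξ ψ (η * overlap (s k).1 (s l).2) (min (q i) v) +
      slack ξ ψ (η * overlap (s k).2 (s l).1) (min (q i) v)))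

variable {ξ ψ : ℝ → ℝ} {t v η : ℝ} {q n : ℕ → ℝ} (s : K → Config N × Config N)

/-- The constant noise adds the increment of θ and the linear noise removes R times the increment of
ψ: together they move the point of tangency from q_i to q_{i+1}. -/
lemma pairSlack_succ (hN : N ≠ 0) (hη : η * η = 1) (i : ℕ) (k l : K) :
    pairSlack ξ ψ t v η q s i k l + (pairLevel ξ ψ t v η q n s i).toLevel.diff k l =
      pairSlack ξ ψ t v η q s (i + 1) k l := by
  simp only [Level.diff, InnerLevel.toLevel, pairLevel, levelVar]
  rw [sum_pairCoef hN hη]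
  simp only [pairSlack, slack, inc, incMin]
  ring

lemma pairSlack_nonneg (hp : IsProfile ξ ψ) (hq01 : ∀ i, q i ∈ Icc (0 : ℝ) 1)
    (hv : v ∈ Icc (0 : ℝ) 1) (ht : 0 ≤ t) (hη : η = 1 ∨ η = -1) (i : ℕ) (k l : K) :
    0 ≤ pairSlack ξ ψ t v η q s i k l := by
  have h1 := hp.slack_nonneg (overlap_mem (s k).1 (s l).1) (hq01 i)
  have h2 := hp.slack_nonneg (overlap_mem (s k).2 (s l).2) (hq01 i)
  have h3 := hp.slack_nonneg (sign_mul_mem hη (overlap_mem (s k).1 (s l).2))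
    (min_mem_Icc (hq01 i) hv)
  have h4 := hp.slack_nonneg (sign_mul_mem hη (overlap_mem (s k).2 (s l).1))
    (min_mem_Icc (hq01 i) hv)
  rw [pairSlack]
  positivity

/-- The tangent at 0 is horizontal because ψ(0) = 0, so the initial gap differs from the covariance
only by a constant. Evenness removes the sign η from the cross overlaps. -/
lemma pairSlack_zero (hp : IsProfile ξ ψ) (hv : v ∈ Icc (0 : ℝ) 1) (hη : η = 1 ∨ η = -1)
    (hq0 : q 0 = 0) (k l : K) :
    pairSlack ξ ψ t v η q s 0 k l = pairCov ξ t N (s k) (s l) - 2 * N * (1 + t) * ξ 0 := by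
  rw [pairSlack, pairCov, hq0, min_eq_left hv.1]
  simp only [slack, theta, hp.psi_zero, hp.sign_mul hη (overlap_mem _ _)]
  ring

lemma cumNonneg_pairLevel (hN : N ≠ 0) (hp : IsProfile ξ ψ) (hq01 : ∀ i, q i ∈ Icc (0 : ℝ) 1)
    (hv : v ∈ Icc (0 : ℝ) 1) (ht : 0 ≤ t) (hη : η = 1 ∨ η = -1) (k i : ℕ) :
    InnerCum (pairSlack ξ ψ t v η q s i) ((List.range' i k).map (pairLevel ξ ψ t v η q n s)) ∧
    cumDiff (pairSlack ξ ψ t v η q s i)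
      (((List.range' i k).map (pairLevel ξ ψ t v η q n s)).map InnerLevel.toLevel) =
      pairSlack ξ ψ t v η q s (i + k) := by
  have hη2 : η * η = 1 := by rcases hη with rfl | rfl <;> norm_num
  induction k generalizing i with
  | zero => exact ⟨trivial, rfl⟩
  | succ k ih =>
    have e : (fun a b => pairSlack ξ ψ t v η q s i a b +
        (pairLevel ξ ψ t v η q n s i).toLevel.diff a b) = pairSlack ξ ψ t v η q s (i + 1) := by
      ext a b; exact pairSlack_succ s hN hη2 i a b
    rw [List.range'_succ, List.map_cons]
    simp only [InnerCum, List.map_cons, CumNonneg, cumDiff]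
    rw [e]
    refine ⟨⟨fun a b => ?_, (ih (i + 1)).1⟩, ?_⟩
    · rw [pairSlack_succ s hN hη2]
      exact pairSlack_nonneg s hp hq01 hv ht hη _ _ _
    · rw [(ih (i + 1)).2]
      congr 1; ring

lemma expProd_pairLevel (hn : ∀ i, 0 < n i) (k i : ℕ) :
    expProd ((List.range' i k).map (pairLevel ξ ψ t v η q n s)) = n i / n (i + k) := by
  induction k generalizing i with
  | zero => simp [expProd, (hn i).ne']
  | succ k ih =>
    have ih := ih (i + 1)
    rw [List.range'_succ, List.map_cons]
    simp only [expProd, List.map_cons, List.prod_cons] at ih ⊢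
    rw [ih, pairLevel, show i + 1 + k = i + (k + 1) by ring]
    exact div_mul_div_cancel₀ (hn _).ne'

/-- The quotients n_i/n_{i+1} telescope, so the product of exponents from level l inward is n_l/n_T
= n_l. -/
lemma constSum_pairLevel (hn : ∀ i, 0 < n i) {T : ℕ} (hnT : n T = 1) (k i : ℕ) (hik : i + k = T) :
    constSum ((List.range' i k).map (pairLevel ξ ψ t v η q n s)) =
      ∑ l ∈ Finset.Ico i T, n l * (N * (inc (theta ξ ψ) q l + t * incMin (theta ξ ψ) v q l)) := by
  induction k generalizing i with
  | zero =>
    obtain rfl : i = T := by omega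
    simp [constSum]
  | succ k ih =>
    have h := expProd_pairLevel (ξ := ξ) (ψ := ψ) (t := t) (v := v) (η := η) (q := q) s hn (k + 1) i
    rw [List.range'_succ, List.map_cons] at h ⊢
    rw [constSum, ih (i + 1) (by omega), h, hik, hnT, Finset.sum_eq_sum_Ico_succ_bot (show i < T by omega),
      pairLevel]
    ring

lemma overlap_self (hN : N ≠ 0) (σ : Config N) : overlap σ σ = 1 := by
  have hN' : (N : ℝ) ≠ 0 := by exact_mod_cast hN
  rw [overlap, real_inner_self_eq_norm_sq, norm_eq_of_mem_sphere, Real.sq_sqrt N.cast_nonneg,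
    inv_mul_cancel₀ hN']

variable {Ω : Type*} [MeasurableSpace Ω] {P : Measure Ω} {X : Fin 2 → Config N → Ω → ℝ}

/-- The hierarchical bound for finitely many pairs of configurations. -/
theorem guerra_pairs [Nonempty K] (hX : IsCoupledPair P ξ t N X) (hN : N ≠ 0)
    (hp : IsProfile ξ ψ) (hq : Monotone q) (hq01 : ∀ i, q i ∈ Icc (0 : ℝ) 1) (hq0 : q 0 = 0)
    (hv : v ∈ Icc (0 : ℝ) 1) (ht : t ∈ Icc (0 : ℝ) 1) (hη : η = 1 ∨ η = -1) {T : ℕ} (hqT : q T = 1)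
    (hn : ∀ i, 0 < n i) (hnm : Monotone n) (hnT : n T = 1) {w : K → ℝ} (hw : ∀ k, 0 < w k) {κ : ℝ}
    (hκ : ∀ k, slack ξ ψ (η * overlap (s k).1 (s k).2) v ≤ κ) :
    ENNReal.ofReal (Real.exp (n 0 * (∑ i ∈ Finset.range T,
        n i * (N * (inc (theta ξ ψ) q i + t * incMin (theta ξ ψ) v q i)) +
        (∫ ω, Real.log (∑ k, w k * Real.exp (X 0 (s k).1 ω + X 1 (s k).2 ω)) ∂P - N * κ)))) ≤
      recE (fun z => ENNReal.ofReal (∑ k, w k * Real.exp (∑ j, z j * pairCoef η (s k) j)))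
        ((List.range' 0 T).map fun i => (n i / n (i + 1), diagNoise (levelVar ψ t v q i))) 0 := by
  classical
  have hNpos : (0 : ℝ) < N := by exact_mod_cast Nat.pos_of_ne_zero hN
  have hPP := hX.gaussian.isProbabilityMeasure
  set L := (List.range' 0 T).map (pairLevel ξ ψ t v η q n s) with hL
  have hval : ∀ ℓ ∈ L, ℓ.Valid := by
    intro ℓ h
    obtain ⟨i, -, rfl⟩ := List.mem_map.1 h
    refine ⟨div_pos (hn _) (hn _), (div_le_one (hn _)).2 (hnm i.le_succ), ?_,
      isGaussNoise_coefMap (levelVar_nonneg hp.psi_mono hq hq01 hv ht i) _⟩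
    have h1 := inc_nonneg hp.theta_mono hq hq01 i
    have h2 := incMin_nonneg hp.theta_mono hq hq01 hv i
    have := ht.1
    simp only [pairLevel]
    positivity
  have hμ := hX.isGaussNoise s
  have e0 : (fun k l => pairCov ξ t N (s k) (s l) - 2 * N * (1 + t) * ξ 0) =
      pairSlack ξ ψ t v η q s 0 := by
    ext k l; exact (pairSlack_zero s hp hv hη hq0 k l).symm
  obtain ⟨hc1, hc2⟩ := cumNonneg_pairLevel (n := n) s hN hp hq01 hv ht.1 hη T 0
  have main := guerra_finite hw hμ (2 * N * (1 + t) * ξ 0) (fun k l => by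
    have := congrFun (congrFun e0 k) l
    rw [this]; exact pairSlack_nonneg s hp hq01 hv ht.1 hη 0 k l) L hval (by rw [e0]; exact hc1)
  rw [e0, hc2, zero_add] at main
  -- On the diagonal the overlaps within a replica are 1 = q_T, where the gap is zero. The two cross
  -- terms coincide, and each is small because the overlap is nearly u.
  have hδ : ∀ k, pairSlack ξ ψ t v η q s T k k / 2 ≤ N * κ := by
    intro k
    have h1 := hp.slack_nonneg (sign_mul_mem hη (overlap_mem (s k).1 (s k).2)) hv
    have h2 : t * slack ξ ψ (η * overlap (s k).1 (s k).2) v ≤ κ :=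
      (mul_le_of_le_one_left h1 ht.2).trans (hκ k)
    have h3 : slack ξ ψ 1 1 = 0 := by simp [slack, theta]
    rw [pairSlack, hqT, min_eq_right hv.2, overlap_self hN, overlap_self hN, h3,
      overlap_comm (s k).2 (s k).1]
    nlinarith
  have hint : ∀ δ : K → ℝ, Integrable (fun y : K → ℝ => Real.log (∑ k, w k * Real.exp
      (y k - δ k / 2))) (P.map fun ω k => X 0 (s k).1 ω + X 1 (s k).2 ω) := fun δ =>
    integrable_logSumExp hμ hw δ
  have hm : Measurable (fun ω k => X 0 (s k).1 ω + X 1 (s k).2 ω) :=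
    measurable_pi_lambda _ fun k => hX.measurable_add (s k)
  have hlow : ∫ ω, Real.log (∑ k, w k * Real.exp (X 0 (s k).1 ω + X 1 (s k).2 ω)) ∂P - N * κ ≤
      ∫ y, Real.log (∑ k, w k * Real.exp (y k - pairSlack ξ ψ t v η q s T k k / 2))
        ∂(P.map fun ω k => X 0 (s k).1 ω + X 1 (s k).2 ω) := by
    rw [integral_map hm.aemeasurable (hint _).1]
    have hi1 := (integrable_map_measure (hint fun k => pairSlack ξ ψ t v η q s T k k).1
      hm.aemeasurable).1 (hint _)
    have hi0 : Integrable (fun ω => Real.log (∑ k, w k *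
        Real.exp (X 0 (s k).1 ω + X 1 (s k).2 ω))) P := by
      have := (integrable_map_measure (hint fun _ => 0).1 hm.aemeasurable).1 (hint _)
      simpa [Function.comp_def] using this
    have e : ∫ ω, Real.log (∑ k, w k * Real.exp (X 0 (s k).1 ω + X 1 (s k).2 ω)) ∂P - N * κ =
        ∫ ω, (Real.log (∑ k, w k * Real.exp (X 0 (s k).1 ω + X 1 (s k).2 ω)) - N * κ) ∂P := by
      rw [integral_sub hi0 (integrable_const _)]; simp
    rw [e]
    refine integral_mono (hi0.sub (integrable_const _)) hi1 fun ω => ?_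
    have hpos : 0 < ∑ k, w k * Real.exp (X 0 (s k).1 ω + X 1 (s k).2 ω) :=
      Finset.sum_pos (fun k _ => mul_pos (hw k) (Real.exp_pos _)) Finset.univ_nonempty
    rw [← Real.log_exp (N * κ), ← Real.log_div hpos.ne' (Real.exp_pos _).ne']
    apply Real.log_le_log (by positivity)
    rw [div_eq_mul_inv, ← Real.exp_neg, Finset.sum_mul]
    refine Finset.sum_le_sum fun k _ => ?_
    rw [mul_assoc, ← Real.exp_add]
    have := hδ k
    have := (hw k).le
    gcongr
    linarith
  have hexp : expProd L = n 0 := by rw [hL, expProd_pairLevel s hn, zero_add, hnT, div_one]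
  have hsum := constSum_pairLevel (ξ := ξ) (ψ := ψ) (t := t) (v := v) (η := η) (q := q) s hn hnT T 0
    (zero_add T)
  rw [hexp, hsum, ← Finset.range_eq_Ico] at main
  refine le_trans ?_ (main.trans_eq ?_)
  · have := (hn 0).le
    gcongr
  · have hm := recE_map (g := fun y : K → ℝ => ENNReal.ofReal (∑ k, w k * Real.exp (y k)))
      (by fun_prop) (coefMap fun k => pairCoef η (s k)) (continuous_coefMap _).measurable
      ((List.range' 0 T).map fun i => (n i / n (i + 1), diagNoise (levelVar ψ t v q i))) (by
        intro ℓ h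
        obtain ⟨i, -, rfl⟩ := List.mem_map.1 h
        infer_instance) 0
    rw [map_zero, List.map_map] at hm
    rw [hL, List.map_map]
    exact hm

end scheme

end

section

/-! ### Replacing an average by an empirical average -/

lemma abs_log_le_add_inv {z : ℝ} (hz : 0 < z) : |Real.log z| ≤ z + z⁻¹ := by
  have h1 := Real.log_le_sub_one_of_pos hz
  have h2 := Real.log_le_sub_one_of_pos (inv_pos.2 hz)
  rw [Real.log_inv] at h2
  have := inv_pos.2 hz
  rw [abs_le]
  constructor <;> linarith

/-- Tangent line of the convex function 1/z at c. With c the mean of z it integrates to 1/c, which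
gives Jensen's inequality; the next lemma does the same for 1/z². -/
lemma inv_tangent {z c : ℝ} (hz : 0 < z) (hc : 0 < c) : 2 * c⁻¹ - c⁻¹ ^ 2 * z ≤ z⁻¹ := by
  have : z⁻¹ - (2 * c⁻¹ - c⁻¹ ^ 2 * z) = (z - c) ^ 2 / (z * c ^ 2) := by field_simp; ring
  have h2 : 0 ≤ (z - c) ^ 2 / (z * c ^ 2) := by positivity
  linarith

lemma inv_sq_tangent {z c : ℝ} (hz : 0 < z) (hc : 0 < c) :
    3 * c⁻¹ ^ 2 - 2 * c⁻¹ ^ 3 * z ≤ z⁻¹ ^ 2 := by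
  have : z⁻¹ ^ 2 - (3 * c⁻¹ ^ 2 - 2 * c⁻¹ ^ 3 * z) =
      (z - c) ^ 2 * (2 * z + c) / (z ^ 2 * c ^ 3) := by field_simp; ring
  have h2 : 0 ≤ (z - c) ^ 2 * (2 * z + c) / (z ^ 2 * c ^ 3) := by positivity
  linarith

/-- From log(a/b) ≤ (a-b)/b and Young's inequality. The error separates into an inverse second
moment, made small by κ, and a variance, made small by the sample size. -/
lemma log_le_log_add_young {a b κ : ℝ} (ha : 0 < a) (hb : 0 < b) (hκ : 0 < κ) :
    Real.log a ≤ Real.log b + (κ / 2 * b⁻¹ ^ 2 + (a - b) ^ 2 / (2 * κ)) := by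
  have h1 := Real.log_le_sub_one_of_pos (div_pos ha hb)
  rw [Real.log_div ha.ne' hb.ne'] at h1
  have h2 : a / b - 1 = (a - b) * b⁻¹ := by field_simp
  have h3 : κ / 2 * b⁻¹ ^ 2 + (a - b) ^ 2 / (2 * κ) - (a - b) * b⁻¹ =
      (κ * b⁻¹ - (a - b)) ^ 2 / (2 * κ) := by field_simp; ring
  have h4 : 0 ≤ (κ * b⁻¹ - (a - b)) ^ 2 / (2 * κ) := by positivity
  linarith

section sampling

variable {S Ω K : Type*} [MeasurableSpace S] [MeasurableSpace Ω] [Fintype K] {ρ : Measure S}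
  [IsProbabilityMeasure ρ] {P : Measure Ω} [IsProbabilityMeasure P] {f : S × Ω → ℝ}

/-- Positivity and second moments. -/
structure IsWeight (ρ : Measure S) (P : Measure Ω) (f : S × Ω → ℝ) : Prop where
  measurable : Measurable f
  pos : ∀ p, 0 < f p
  sq : Integrable (fun p => f p ^ 2) (ρ.prod P)
  inv_sq : Integrable (fun p => (f p)⁻¹ ^ 2) (ρ.prod P)

/-- The average over `S`. -/
def avgOver (ρ : Measure S) (f : S × Ω → ℝ) (ω : Ω) : ℝ := ∫ s, f (s, ω) ∂ρ

/-- The empirical average. -/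
def empAvg (f : S × Ω → ℝ) (p : (K → S) × Ω) : ℝ := (Fintype.card K : ℝ)⁻¹ * ∑ k, f (p.1 k, p.2)

namespace IsWeight

variable (hf : IsWeight ρ P f)

include hf

lemma integrable : Integrable f (ρ.prod P) := by
  refine ((integrable_const (1 : ℝ)).add hf.sq).mono' hf.measurable.aestronglyMeasurable
    (Eventually.of_forall fun p => ?_)
  have := hf.pos p
  rw [Real.norm_eq_abs, abs_of_pos this, Pi.add_apply]
  nlinarith [sq_nonneg (f p - 1)]

lemma integrable_inv : Integrable (fun p => (f p)⁻¹) (ρ.prod P) := by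
  refine ((integrable_const (1 : ℝ)).add hf.inv_sq).mono' hf.measurable.inv.aestronglyMeasurable
    (Eventually.of_forall fun p => ?_)
  have := inv_pos.2 (hf.pos p)
  rw [Real.norm_eq_abs, abs_of_pos this, Pi.add_apply]
  nlinarith [sq_nonneg ((f p)⁻¹ - 1)]

lemma measurable_avgOver : Measurable (avgOver ρ f) :=
  (StronglyMeasurable.integral_prod_left' (f := f) hf.measurable.stronglyMeasurable).measurable

lemma avgOver_pos : ∀ᵐ ω ∂P, 0 < avgOver ρ f ω := by
  filter_upwards [hf.integrable.prod_left_ae] with ω hω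
  rw [avgOver, integral_pos_iff_support_of_nonneg (fun s => (hf.pos _).le) hω]
  have : Function.support (fun s => f (s, ω)) = univ := by
    ext s; simp [(hf.pos (s, ω)).ne']
  rw [this, measure_univ]
  exact one_pos

lemma inv_avgOver_le : ∀ᵐ ω ∂P, (avgOver ρ f ω)⁻¹ ≤ avgOver ρ (fun p => (f p)⁻¹) ω := by
  filter_upwards [hf.integrable.prod_left_ae, hf.integrable_inv.prod_left_ae, hf.avgOver_pos]
    with ω h1 h2 h3
  set c := avgOver ρ f ω with hc
  have hi : Integrable (fun s => 2 * c⁻¹ - c⁻¹ ^ 2 * f (s, ω)) ρ :=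
    (integrable_const _).sub (h1.const_mul _)
  have h4 : ∫ s, (2 * c⁻¹ - c⁻¹ ^ 2 * f (s, ω)) ∂ρ ≤ ∫ s, (f (s, ω))⁻¹ ∂ρ :=
    integral_mono hi h2 fun s => inv_tangent (hf.pos _) h3
  rw [integral_sub (integrable_const _) (h1.const_mul _), integral_const_mul (c⁻¹ ^ 2)] at h4
  have h5 : ∫ s, f (s, ω) ∂ρ = c := rfl
  rw [h5] at h4
  simp only [integral_const, probReal_univ, one_smul] at h4
  refine le_trans (le_of_eq ?_) h4
  field_simp; ring

lemma integrable_avgOver : Integrable (avgOver ρ f) P := hf.integrable.integral_prod_right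

lemma integrable_log_avgOver : Integrable (fun ω => Real.log (avgOver ρ f ω)) P := by
  have h2 : Integrable (avgOver ρ fun p => (f p)⁻¹) P := hf.integrable_inv.integral_prod_right
  refine (hf.integrable_avgOver.add h2).mono' hf.measurable_avgOver.log.aestronglyMeasurable ?_
  filter_upwards [hf.avgOver_pos, hf.inv_avgOver_le] with ω h3 h4
  rw [Real.norm_eq_abs, Pi.add_apply]
  exact (abs_log_le_add_inv h3).trans (by linarith)

variable [Nonempty K]

lemma measurable_empAvg : Measurable (empAvg f : (K → S) × Ω → ℝ) := by
  have := hf.measurable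
  unfold empAvg
  fun_prop

lemma empAvg_pos (p : (K → S) × Ω) : 0 < empAvg f p :=
  mul_pos (inv_pos.2 (by exact_mod_cast Fintype.card_pos))
    (Finset.sum_pos (fun k _ => hf.pos _) Finset.univ_nonempty)

lemma measurePreserving_eval_prod (k : K) :
    MeasurePreserving (fun p : (K → S) × Ω => (p.1 k, p.2))
      ((Measure.pi fun _ : K => ρ).prod P) (ρ.prod P) :=
  (measurePreserving_eval (fun _ : K => ρ) k).prod (MeasurePreserving.id P)

lemma integrable_empAvg_of {g : S × Ω → ℝ} (hg : Integrable g (ρ.prod P)) :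
    Integrable (empAvg g : (K → S) × Ω → ℝ) ((Measure.pi fun _ : K => ρ).prod P) ∧
    ∫ p, empAvg g p ∂((Measure.pi fun _ : K => ρ).prod P) = ∫ p, g p ∂(ρ.prod P) := by
  have hi : ∀ k : K, Integrable (fun p : (K → S) × Ω => g (p.1 k, p.2))
      ((Measure.pi fun _ : K => ρ).prod P) := fun k =>
    (hf.measurePreserving_eval_prod k).integrable_comp_of_integrable hg
  have he : ∀ k : K, ∫ p : (K → S) × Ω, g (p.1 k, p.2) ∂((Measure.pi fun _ : K => ρ).prod P) =
      ∫ p, g p ∂(ρ.prod P) := by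
    intro k
    have h := (hf.measurePreserving_eval_prod (K := K) k)
    rw [← h.map_eq, integral_map h.measurable.aemeasurable (by rw [h.map_eq]; exact hg.1)]
  refine ⟨(integrable_finsetSum _ fun k _ => hi k).const_mul _, ?_⟩
  simp only [empAvg]
  rw [integral_const_mul, integral_finsetSum _ fun k _ => hi k, Finset.sum_congr rfl fun k _ => he k]
  simp

lemma inv_sq_empAvg_le (p : (K → S) × Ω) :
    (empAvg f p)⁻¹ ^ 2 ≤ empAvg (fun p => (f p)⁻¹ ^ 2) p := by
  set c := empAvg f p with hc
  have hcpos : 0 < c := hf.empAvg_pos p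
  have hM : (0 : ℝ) < Fintype.card K := by exact_mod_cast Fintype.card_pos
  have h : ∑ k, (3 * c⁻¹ ^ 2 - 2 * c⁻¹ ^ 3 * f (p.1 k, p.2)) ≤ ∑ k, (f (p.1 k, p.2))⁻¹ ^ 2 :=
    Finset.sum_le_sum fun k _ => inv_sq_tangent (hf.pos _) hcpos
  have h2 : ∑ k, f (p.1 k, p.2) = Fintype.card K * c := by
    rw [hc, empAvg, mul_inv_cancel_left₀ hM.ne']
  rw [Finset.sum_sub_distrib, ← Finset.mul_sum _ _ (2 * c⁻¹ ^ 3), h2] at h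
  simp only [Finset.sum_const, Finset.card_univ, nsmul_eq_mul] at h
  rw [empAvg, inv_mul_eq_div, le_div_iff₀ hM]
  refine le_trans (le_of_eq ?_) h
  field_simp; ring

lemma inv_empAvg_le (p : (K → S) × Ω) :
    (empAvg f p)⁻¹ ≤ 1 + empAvg (fun p => (f p)⁻¹ ^ 2) p := by
  have := hf.inv_sq_empAvg_le p
  nlinarith [sq_nonneg ((empAvg f p)⁻¹ - 1)]

lemma integrable_log_empAvg :
    Integrable (fun p => Real.log (empAvg f p)) ((Measure.pi fun _ : K => ρ).prod P) := by
  have h1 := (hf.integrable_empAvg_of (K := K) hf.integrable).1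
  have h2 := (hf.integrable_empAvg_of (K := K) hf.inv_sq).1
  refine (h1.add ((integrable_const (1 : ℝ)).add h2)).mono'
    hf.measurable_empAvg.log.aestronglyMeasurable (Eventually.of_forall fun p => ?_)
  rw [Real.norm_eq_abs]
  simp only [Pi.add_apply]
  exact (abs_log_le_add_inv (hf.empAvg_pos p)).trans (by linarith [hf.inv_empAvg_le p])

/-- For fixed disorder the samples are independent and identically distributed, so the variance of
the empirical mean is 1/|K| times that of one sample, which is at most its second moment. -/
lemma integral_sub_sq_le : ∀ᵐ ω ∂P,
    Integrable (fun s : K → S => (avgOver ρ f ω - empAvg f (s, ω)) ^ 2) (Measure.pi fun _ => ρ) ∧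
    ∫ s : K → S, (avgOver ρ f ω - empAvg f (s, ω)) ^ 2 ∂(Measure.pi fun _ => ρ) ≤
      (Fintype.card K : ℝ)⁻¹ * avgOver ρ (fun p => f p ^ 2) ω := by
  filter_upwards [hf.integrable.prod_left_ae, hf.sq.prod_left_ae] with ω h1 h2
  have hM : (0 : ℝ) < Fintype.card K := by exact_mod_cast Fintype.card_pos
  have hmf : Measurable fun s => f (s, ω) := hf.measurable.comp (by fun_prop)
  have hL : MemLp (fun s => f (s, ω)) 2 ρ :=
    (memLp_two_iff_integrable_sq hmf.aestronglyMeasurable).2 h2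
  have hLk : ∀ k : K, MemLp (fun s : K → S => f (s k, ω)) 2 (Measure.pi fun _ => ρ) := fun k =>
    hL.comp_measurePreserving (measurePreserving_eval (fun _ : K => ρ) k)
  have hmean : ∀ k : K, ∫ s : K → S, f (s k, ω) ∂(Measure.pi fun _ => ρ) = avgOver ρ f ω := by
    intro k
    have h := measurePreserving_eval (fun _ : K => ρ) k
    have := integral_map (μ := Measure.pi fun _ : K => ρ) (φ := Function.eval k)
      (f := fun s => f (s, ω)) h.measurable.aemeasurable hmf.aestronglyMeasurable
    rw [h.map_eq] at this
    exact this.symm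
  have hE : MemLp (fun s : K → S => empAvg f (s, ω)) 2 (Measure.pi fun _ => ρ) :=
    (memLp_finsetSum _ fun k _ => hLk k).const_mul _
  have hEm : ∫ s : K → S, empAvg f (s, ω) ∂(Measure.pi fun _ => ρ) = avgOver ρ f ω := by
    simp only [empAvg]
    rw [integral_const_mul, integral_finsetSum _ fun k _ => (hLk k).integrable (by norm_num),
      Finset.sum_congr rfl fun k _ => hmean k]
    simp
  have hi : Integrable (fun s : K → S => (avgOver ρ f ω - empAvg f (s, ω)) ^ 2)
      (Measure.pi fun _ => ρ) :=
    ((memLp_const (avgOver ρ f ω)).sub hE).integrable_sq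
  refine ⟨hi, ?_⟩
  have hv : ∫ s : K → S, (avgOver ρ f ω - empAvg f (s, ω)) ^ 2 ∂(Measure.pi fun _ => ρ) =
      variance (fun s : K → S => empAvg f (s, ω)) (Measure.pi fun _ => ρ) := by
    rw [variance_eq_integral hE.1.aemeasurable, hEm]
    refine integral_congr_ae (Eventually.of_forall fun s => ?_)
    simp only; ring
  have hs : variance (∑ k : K, fun s : K → S => f (s k, ω)) (Measure.pi fun _ => ρ) =
      ∑ _k : K, variance (fun s => f (s, ω)) ρ :=
    variance_sum_pi (X := fun (_ : K) s => f (s, ω)) fun _ => hL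
  have e : (fun s : K → S => empAvg f (s, ω)) =
      fun s => (Fintype.card K : ℝ)⁻¹ * (∑ k : K, fun s : K → S => f (s k, ω)) s := by
    ext s; simp [empAvg]
  rw [hv, e, variance_const_mul, hs]
  have hb : variance (fun s => f (s, ω)) ρ ≤ avgOver ρ (fun p => f p ^ 2) ω :=
    variance_le_expectation_sq hmf.aestronglyMeasurable
  simp only [Finset.sum_const, Finset.card_univ, nsmul_eq_mul]
  calc (Fintype.card K : ℝ)⁻¹ ^ 2 * (Fintype.card K * variance (fun s => f (s, ω)) ρ)
      = (Fintype.card K : ℝ)⁻¹ * variance (fun s => f (s, ω)) ρ := by field_simp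
    _ ≤ _ := by gcongr

/-- The free energy is bounded by the one of the empirical averages, up to a small error. -/
lemma integral_log_avgOver_le {κ : ℝ} (hκ : 0 < κ) :
    ∫ ω, Real.log (avgOver ρ f ω) ∂P ≤
      ∫ s : K → S, ∫ ω, Real.log (empAvg f (s, ω)) ∂P ∂(Measure.pi fun _ => ρ) +
      (κ / 2 * ∫ p, (f p)⁻¹ ^ 2 ∂(ρ.prod P) +
        (Fintype.card K : ℝ)⁻¹ * (∫ p, f p ^ 2 ∂(ρ.prod P)) / (2 * κ)) := by
  set π := Measure.pi fun _ : K => ρ with hπ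
  have hlog := hf.integrable_log_empAvg (K := K)
  have hinv := hf.integrable_empAvg_of (K := K) hf.inv_sq
  have hinv2 : Integrable (fun p : (K → S) × Ω => (empAvg f p)⁻¹ ^ 2) (π.prod P) :=
    hinv.1.mono' (hf.measurable_empAvg.inv.pow_const 2).aestronglyMeasurable
      (Eventually.of_forall fun p => by
        rw [Real.norm_eq_abs, abs_of_nonneg (by positivity)]; exact hf.inv_sq_empAvg_le p)
  have hmd : Measurable (fun p : (K → S) × Ω => (avgOver ρ f p.2 - empAvg f p) ^ 2) :=
    ((hf.measurable_avgOver.comp measurable_snd).sub hf.measurable_empAvg).pow_const 2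
  have hsqi : Integrable (avgOver ρ fun p => f p ^ 2) P := hf.sq.integral_prod_right
  have hd : Integrable (fun p : (K → S) × Ω => (avgOver ρ f p.2 - empAvg f p) ^ 2) (π.prod P) := by
    refine (integrable_prod_iff' hmd.aestronglyMeasurable).2 ⟨?_, ?_⟩
    · filter_upwards [hf.integral_sub_sq_le (K := K)] with ω h using h.1
    · refine (hsqi.const_mul (Fintype.card K : ℝ)⁻¹).mono'
        (hmd.norm.stronglyMeasurable.integral_prod_left').aestronglyMeasurable ?_
      filter_upwards [hf.integral_sub_sq_le (K := K)] with ω h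
      simp only [Real.norm_eq_abs, abs_pow, sq_abs]
      rw [abs_of_nonneg (integral_nonneg fun s => sq_nonneg _)]
      exact h.2
  have hdle : ∫ p, (avgOver ρ f p.2 - empAvg f p) ^ 2 ∂(π.prod P) ≤
      (Fintype.card K : ℝ)⁻¹ * ∫ p, f p ^ 2 ∂(ρ.prod P) := by
    rw [integral_prod_symm _ hd, integral_prod_symm _ hf.sq, ← integral_const_mul]
    refine integral_mono_ae hd.integral_prod_right (hsqi.const_mul _) ?_
    filter_upwards [hf.integral_sub_sq_le (K := K)] with ω h using h.2
  have hlog0 : Integrable (fun p : (K → S) × Ω => Real.log (avgOver ρ f p.2)) (π.prod P) :=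
    hf.integrable_log_avgOver.comp_snd π
  have e0 : ∫ ω, Real.log (avgOver ρ f ω) ∂P =
      ∫ p : (K → S) × Ω, Real.log (avgOver ρ f p.2) ∂(π.prod P) := by
    rw [integral_prod _ hlog0]; simp
  have hE : Integrable (fun p : (K → S) × Ω => κ / 2 * (empAvg f p)⁻¹ ^ 2 +
      (avgOver ρ f p.2 - empAvg f p) ^ 2 / (2 * κ)) (π.prod P) :=
    (hinv2.const_mul _).add (hd.div_const _)
  rw [e0, ← integral_prod _ hlog]
  calc ∫ p : (K → S) × Ω, Real.log (avgOver ρ f p.2) ∂(π.prod P)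
      ≤ ∫ p : (K → S) × Ω, (Real.log (empAvg f p) + (κ / 2 * (empAvg f p)⁻¹ ^ 2 +
          (avgOver ρ f p.2 - empAvg f p) ^ 2 / (2 * κ))) ∂(π.prod P) := by
        refine integral_mono_ae hlog0 (hlog.add hE) ?_
        filter_upwards [Measure.quasiMeasurePreserving_snd.ae hf.avgOver_pos] with p h
        exact log_le_log_add_young h (hf.empAvg_pos p) hκ
    _ = ∫ p : (K → S) × Ω, Real.log (empAvg f p) ∂(π.prod P) +
          (κ / 2 * ∫ p : (K → S) × Ω, (empAvg f p)⁻¹ ^ 2 ∂(π.prod P) +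
          (∫ p : (K → S) × Ω, (avgOver ρ f p.2 - empAvg f p) ^ 2 ∂(π.prod P)) / (2 * κ)) := by
        rw [integral_add hlog hE, integral_add (hinv2.const_mul _) (hd.div_const _),
          integral_const_mul, integral_div]
    _ ≤ _ := by
        rw [← hinv.2]
        have : ∫ p : (K → S) × Ω, (empAvg f p)⁻¹ ^ 2 ∂(π.prod P) ≤
            ∫ p, empAvg (fun p => (f p)⁻¹ ^ 2) p ∂(π.prod P) :=
          integral_mono hinv2 hinv.1 hf.inv_sq_empAvg_le
        gcongr

end IsWeight

end sampling

end

section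

/-! ### Exponential integrals over the sphere and Gaussian integrals -/

section polar

variable {E : Type*} [NormedAddCommGroup E] [NormedSpace ℝ E] [MeasurableSpace E] [BorelSpace E]
  [FiniteDimensional ℝ E] (μ : Measure E) [μ.IsAddHaarMeasure]

lemma lintegral_polar [Nontrivial E] {F : E → ℝ≥0∞} (hF : Measurable F) :
    ∫⁻ x, F x ∂μ = ∫⁻ r in Ioi (0 : ℝ), ENNReal.ofReal (r ^ (Module.finrank ℝ E - 1)) *
      ∫⁻ ω : Metric.sphere (0 : E) 1, F (r • (ω : E)) ∂μ.toSphere := by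
  have hms : MeasurableSet ({0}ᶜ : Set E) := (measurableSet_singleton _).compl
  set G : Metric.sphere (0 : E) 1 × Ioi (0 : ℝ) → ℝ≥0∞ := fun p => F (p.2.1 • (p.1 : E)) with hG
  have hGm : Measurable G := hF.comp (by fun_prop)
  have h1 : ∫⁻ x, F x ∂μ = ∫⁻ x : ({0}ᶜ : Set E), F x ∂(μ.comap (↑)) := by
    rw [lintegral_subtype_comap hms, restrict_compl_singleton]
  have h2 : ∀ x : ({0}ᶜ : Set E), F x = G (homeomorphUnitSphereProd E x) := by
    intro x
    have : (x : E) = (homeomorphUnitSphereProd E x).2.1 • ((homeomorphUnitSphereProd E x).1 : E) := by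
      rw [← homeomorphUnitSphereProd_symm_apply_coe, Homeomorph.symm_apply_apply]
    simp only [hG]
    rw [← this]
  simp_rw [h1, h2]
  rw [μ.measurePreserving_homeomorphUnitSphereProd.lintegral_comp hGm,
    lintegral_prod_symm _ hGm.aemeasurable, Measure.volumeIoiPow,
    lintegral_withDensity_eq_lintegral_mul _ (by fun_prop) (hGm.lintegral_prod_left'),
    ← lintegral_subtype_comap measurableSet_Ioi]
  rfl

lemma map_neg_toSphere [Nontrivial E] : μ.toSphere.map (fun ω => -ω) = μ.toSphere := by
  ext s hs
  have hm : Measurable (fun ω : Metric.sphere (0 : E) 1 => -ω) := continuous_neg.measurable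
  rw [Measure.map_apply hm hs, μ.toSphere_apply' hs, μ.toSphere_apply' (hm hs)]
  congr 1
  have : Ioo (0 : ℝ) 1 • ((↑) '' ((fun ω : Metric.sphere (0 : E) 1 => -ω) ⁻¹' s) : Set E) =
      -(Ioo (0 : ℝ) 1 • ((↑) '' s : Set E)) := by
    ext x
    simp only [Set.mem_smul, Set.mem_neg, Set.mem_image, Set.mem_preimage]
    constructor
    · rintro ⟨r, hr, _, ⟨ω, hω, rfl⟩, rfl⟩
      exact ⟨r, hr, _, ⟨-ω, hω, rfl⟩, by simp⟩
    · rintro ⟨r, hr, _, ⟨ω, hω, rfl⟩, h⟩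
      refine ⟨r, hr, _, ⟨-ω, by simpa using hω, rfl⟩, ?_⟩
      rw [← neg_neg x, ← h]; simp
  rw [this, Measure.measure_neg]

end polar

section sphere

variable {E : Type*} [NormedAddCommGroup E] [InnerProductSpace ℝ E] [MeasurableSpace E]
  [BorelSpace E] [FiniteDimensional ℝ E] (μ : Measure E) [μ.IsAddHaarMeasure]

/-- By antipodal symmetry exp may be replaced by cosh, which is even and nondecreasing in the
absolute value of its argument. -/
lemma lintegral_exp_inner_mono [Nontrivial E] (v : E) {r r' : ℝ} (hr : 0 ≤ r) (h : r ≤ r') :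
    ∫⁻ ω : Metric.sphere (0 : E) 1, ENNReal.ofReal (Real.exp (inner ℝ v (r • (ω : E)))) ∂μ.toSphere
    ≤ ∫⁻ ω : Metric.sphere (0 : E) 1, ENNReal.ofReal (Real.exp (inner ℝ v (r' • (ω : E))))
      ∂μ.toSphere := by
  have hmeas : ∀ r : ℝ, Measurable fun ω : Metric.sphere (0 : E) 1 =>
      ENNReal.ofReal (Real.exp (inner ℝ v (r • (ω : E)))) := fun r => by fun_prop
  have key : ∀ r : ℝ, ∫⁻ ω : Metric.sphere (0 : E) 1,
      ENNReal.ofReal (Real.exp (inner ℝ v (r • (ω : E)))) ∂μ.toSphere =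
      2⁻¹ * ∫⁻ ω : Metric.sphere (0 : E) 1,
      ENNReal.ofReal (2 * Real.cosh (r * inner ℝ v (ω : E))) ∂μ.toSphere := by
    intro r
    have h1 : ∫⁻ ω : Metric.sphere (0 : E) 1,
        ENNReal.ofReal (Real.exp (inner ℝ v (r • (ω : E)))) ∂μ.toSphere =
        ∫⁻ ω : Metric.sphere (0 : E) 1,
        ENNReal.ofReal (Real.exp (inner ℝ v (r • ((-ω : Metric.sphere (0 : E) 1) : E))))
          ∂μ.toSphere := by
      conv_lhs => rw [← map_neg_toSphere μ]
      exact lintegral_map (hmeas r) continuous_neg.measurable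
    have h2 : ∫⁻ ω : Metric.sphere (0 : E) 1,
        ENNReal.ofReal (2 * Real.cosh (r * inner ℝ v (ω : E))) ∂μ.toSphere =
        2 * ∫⁻ ω : Metric.sphere (0 : E) 1,
        ENNReal.ofReal (Real.exp (inner ℝ v (r • (ω : E)))) ∂μ.toSphere := by
      rw [two_mul]
      conv_rhs => rw [h1]
      conv_rhs => enter [1]; rw [← h1]
      rw [← lintegral_add_left (hmeas r)]
      refine lintegral_congr fun ω => ?_
      rw [← ENNReal.ofReal_add (Real.exp_pos _).le (Real.exp_pos _).le, Real.cosh_eq]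
      congr 1
      have e : ((-ω : Metric.sphere (0 : E) 1) : E) = -(ω : E) := rfl
      rw [e, smul_neg, inner_neg_right, inner_smul_right]
      ring
    rw [h2, ← mul_assoc, ENNReal.inv_mul_cancel (by norm_num) (by norm_num), one_mul]
  rw [key r, key r']
  gcongr with ω
  rw [Real.cosh_le_cosh, abs_mul, abs_mul, abs_of_nonneg hr, abs_of_nonneg (hr.trans h)]
  gcongr

end sphere

/-! ### One-dimensional radial integrals -/

lemma lintegral_exp_neg_sq {c : ℝ} (hc : 0 < c) :
    ∫⁻ r : ℝ, ENNReal.ofReal (Real.exp (-c * r ^ 2)) = ENNReal.ofReal √(Real.pi / c) := by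
  rw [← integral_gaussian, ofReal_integral_eq_lintegral_ofReal (integrable_exp_neg_mul_sq hc)
    (Eventually.of_forall fun _ => (Real.exp_pos _).le)]

/-- The logarithm of the cost of passing from the sphere to the Gaussian measure. -/
def sphereCost (b : ℝ) (N : ℕ) : ℝ :=
  N * ((b - 1 - Real.log b) / 2) + ((1 + Real.log b) / 2 + Real.log √(Real.pi / (b / (2 * N))) +
    b * √(N : ℝ) + b / 2)

/-- Both sides are compared with the radial density near its maximum. Above, log z ≤ z-1 with z =
br²/N bounds r^{N-1}; as the power is N-1 and not N, a factor exp(-br²/(2N)) is left over and makes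
the integral finite. Below, only a unit interval beyond √N is kept. -/
lemma radial_le {b : ℝ} (hb : 0 < b) {N : ℕ} (hN : 1 ≤ N) :
    ∫⁻ r in Ioi (0 : ℝ), ENNReal.ofReal (r ^ (N - 1)) *
      ENNReal.ofReal (Real.exp (-(b / 2) * r ^ 2)) ≤ ENNReal.ofReal (Real.exp (sphereCost b N)) *
    ∫⁻ r in Ioi (√(N : ℝ)), ENNReal.ofReal (r ^ (N - 1)) *
      ENNReal.ofReal (Real.exp (-(b / 2) * r ^ 2)) := by
  have hNpos : (0 : ℝ) < N := by exact_mod_cast hN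
  have hs : 0 < √(N : ℝ) := Real.sqrt_pos.2 hNpos
  have hsq : √(N : ℝ) ^ 2 = N := Real.sq_sqrt hNpos.le
  set m : ℝ := ((N - 1 : ℕ) : ℝ) with hm
  have hmN : m = N - 1 := by rw [hm, Nat.cast_sub hN, Nat.cast_one]
  have hm0 : 0 ≤ m := Nat.cast_nonneg _
  have hpow : ∀ r : ℝ, 0 < r → r ^ (N - 1) = Real.exp (m * Real.log r) := fun r hr => by
    rw [mul_comm, Real.exp_mul, Real.exp_log hr, hm, Real.rpow_natCast]
  set A := m / 2 * (Real.log N - 1 - Real.log b) with hA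
  have hc : 0 < b / (2 * N) := by positivity
  have hroot : 0 < √(Real.pi / (b / (2 * N))) := Real.sqrt_pos.2 (by positivity)
  have up : ∫⁻ r in Ioi (0 : ℝ), ENNReal.ofReal (r ^ (N - 1)) *
      ENNReal.ofReal (Real.exp (-(b / 2) * r ^ 2)) ≤
      ENNReal.ofReal (Real.exp A * √(Real.pi / (b / (2 * N)))) := by
    calc _ ≤ ∫⁻ r in Ioi (0 : ℝ), ENNReal.ofReal (Real.exp A) *
          ENNReal.ofReal (Real.exp (-(b / (2 * N)) * r ^ 2)) := by
          refine setLIntegral_mono (by fun_prop) fun r hr => ?_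
          have hr : 0 < r := hr
          rw [← ENNReal.ofReal_mul (by positivity), ← ENNReal.ofReal_mul (by positivity),
            hpow r hr, ← Real.exp_add, ← Real.exp_add]
          apply ENNReal.ofReal_le_ofReal
          rw [Real.exp_le_exp]
          have h1 := Real.log_le_sub_one_of_pos (show 0 < b * r ^ 2 / N by positivity)
          rw [Real.log_div (by positivity) hNpos.ne', Real.log_mul hb.ne' (by positivity),
            Real.log_pow] at h1
          push_cast at h1
          have h2 := mul_le_mul_of_nonneg_left h1 (by positivity : 0 ≤ m / 2)
          have h3 : -(b / (2 * N)) * r ^ 2 = -(b / 2) * r ^ 2 + m / 2 * (b * r ^ 2 / N) := by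
            rw [hmN]; field_simp; ring
          rw [h3, hA]
          linarith
      _ ≤ ∫⁻ r : ℝ, ENNReal.ofReal (Real.exp A) *
          ENNReal.ofReal (Real.exp (-(b / (2 * N)) * r ^ 2)) := setLIntegral_le_lintegral _ _
      _ = _ := by
          rw [lintegral_const_mul _ (by fun_prop), lintegral_exp_neg_sq hc,
            ← ENNReal.ofReal_mul (Real.exp_pos _).le]
  have lo : ENNReal.ofReal (Real.exp (m / 2 * Real.log N - b / 2 * (√(N : ℝ) + 1) ^ 2)) ≤
      ∫⁻ r in Ioi (√(N : ℝ)), ENNReal.ofReal (r ^ (N - 1)) *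
      ENNReal.ofReal (Real.exp (-(b / 2) * r ^ 2)) := by
    calc _ = ∫⁻ _r in Ioc (√(N : ℝ)) (√(N : ℝ) + 1), ENNReal.ofReal
          (Real.exp (m / 2 * Real.log N - b / 2 * (√(N : ℝ) + 1) ^ 2)) := by
          rw [setLIntegral_const, Real.volume_Ioc]; simp
      _ ≤ ∫⁻ r in Ioc (√(N : ℝ)) (√(N : ℝ) + 1), ENNReal.ofReal (r ^ (N - 1)) *
          ENNReal.ofReal (Real.exp (-(b / 2) * r ^ 2)) := by
          refine setLIntegral_mono (by fun_prop) fun r hr => ?_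
          have hr0 : 0 < r := hs.trans hr.1
          rw [← ENNReal.ofReal_mul (by positivity), hpow r hr0, ← Real.exp_add]
          apply ENNReal.ofReal_le_ofReal
          rw [Real.exp_le_exp]
          have h1 : Real.log N / 2 ≤ Real.log r := by
            rw [← Real.log_sqrt hNpos.le]
            exact Real.log_le_log hs hr.1.le
          have h2 : r ^ 2 ≤ (√(N : ℝ) + 1) ^ 2 := by
            have := hr.2; gcongr
          have h3 := mul_le_mul_of_nonneg_left h1 hm0
          have h4 := mul_le_mul_of_nonneg_left h2 (by positivity : 0 ≤ b / 2)
          linarith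
      _ ≤ _ := lintegral_mono_set Ioc_subset_Ioi_self
  refine up.trans ?_
  refine le_trans ?_ (mul_le_mul_right lo _)
  rw [← ENNReal.ofReal_mul (Real.exp_pos _).le, ← Real.exp_add]
  apply ENNReal.ofReal_le_ofReal
  nth_rewrite 1 [← Real.exp_log hroot]
  rw [← Real.exp_add, Real.exp_le_exp, sphereCost, hA]
  have : (√(N : ℝ) + 1) ^ 2 = N + 2 * √(N : ℝ) + 1 := by rw [add_sq, hsq]; ring
  rw [this, hmN]
  apply le_of_eq
  ring

lemma tendsto_sphereCost {b : ℝ} (hb : 0 < b) :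
    Tendsto (fun N : ℕ => (N : ℝ)⁻¹ * sphereCost b N) atTop (𝓝 ((b - 1 - Real.log b) / 2)) := by
  have h0 : Tendsto (fun N : ℕ => (N : ℝ)⁻¹) atTop (𝓝 0) := tendsto_inv_atTop_nhds_zero_nat
  have hlog : Tendsto (fun N : ℕ => (N : ℝ)⁻¹ * Real.log N) atTop (𝓝 0) := by
    have := (Real.isLittleO_log_id_atTop.tendsto_div_nhds_zero).comp tendsto_natCast_atTop_atTop
    refine this.congr fun N => ?_
    simp [div_eq_inv_mul]
  have hsqrt : Tendsto (fun N : ℕ => (N : ℝ)⁻¹ * √(N : ℝ)) atTop (𝓝 0) := by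
    have := (Real.tendsto_sqrt_atTop.comp (tendsto_natCast_atTop_atTop (R := ℝ))).inv_tendsto_atTop
    refine this.congr fun N => ?_
    simp only [Pi.inv_apply, Function.comp_apply]
    rcases N.eq_zero_or_pos with rfl | hN
    · simp
    have hNpos : (0 : ℝ) < N := by exact_mod_cast hN
    have hs : 0 < √(N : ℝ) := Real.sqrt_pos.2 hNpos
    have hsq : √(N : ℝ) * √(N : ℝ) = N := Real.mul_self_sqrt hNpos.le
    field_simp
    nlinarith
  have h : Tendsto (fun N : ℕ => (b - 1 - Real.log b) / 2 + ((N : ℝ)⁻¹ *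
      ((1 + Real.log b) / 2 + Real.log (2 * Real.pi / b) / 2 + b / 2) +
      (N : ℝ)⁻¹ * Real.log N / 2 + b * ((N : ℝ)⁻¹ * √(N : ℝ)))) atTop
      (𝓝 ((b - 1 - Real.log b) / 2 + (0 * ((1 + Real.log b) / 2 +
        Real.log (2 * Real.pi / b) / 2 + b / 2) + 0 / 2 + b * 0))) :=
    tendsto_const_nhds.add (((h0.mul_const _).add (hlog.div_const 2)).add (hsqrt.const_mul b))
  simp only [zero_mul, zero_div, mul_zero, add_zero] at h
  refine h.congr' ?_
  filter_upwards [eventually_ge_atTop 1] with N hN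
  have hNpos : (0 : ℝ) < N := by exact_mod_cast hN
  have hpi := Real.pi_pos
  have e : Real.log √(Real.pi / (b / (2 * N))) =
      Real.log (2 * Real.pi / b) / 2 + Real.log N / 2 := by
    rw [Real.log_sqrt (by positivity), show Real.pi / (b / (2 * N)) = (2 * Real.pi / b) * N by
      field_simp, Real.log_mul (by positivity) hNpos.ne']
    ring
  rw [sphereCost, e]
  field_simp
  ring

/-! ### Gaussian integrals in Euclidean space -/

section gauss

variable {N : ℕ}

local notation "E" => EuclideanSpace ℝ (Fin N)

lemma lintegral_exp_neg_norm_sq {b : ℝ} (hb : 0 < b) :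
    ∫⁻ x : E, ENNReal.ofReal (Real.exp (-(b / 2) * ‖x‖ ^ 2)) =
      ENNReal.ofReal ((2 * Real.pi / b) ^ ((N : ℝ) / 2)) := by
  have hpi := Real.pi_pos
  have h := GaussianFourier.integral_rexp_neg_mul_sq_norm (V := E) (half_pos hb)
  rw [finrank_euclideanSpace_fin, show Real.pi / (b / 2) = 2 * Real.pi / b by field_simp] at h
  have hi : Integrable (fun x : E => Real.exp (-(b / 2) * ‖x‖ ^ 2)) := by
    by_contra hne
    rw [integral_undef hne] at h
    have : 0 < (2 * Real.pi / b) ^ ((N : ℝ) / 2) := by positivity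
    linarith
  rw [← h, ofReal_integral_eq_lintegral_ofReal hi
    (Eventually.of_forall fun _ => (Real.exp_pos _).le)]

lemma lintegral_exp_inner_sub_norm_sq {b : ℝ} (hb : 0 < b) (v : E) :
    ∫⁻ x : E, ENNReal.ofReal (Real.exp (inner ℝ v x - b / 2 * ‖x‖ ^ 2)) =
      ENNReal.ofReal ((2 * Real.pi / b) ^ ((N : ℝ) / 2)) *
        ENNReal.ofReal (Real.exp (‖v‖ ^ 2 / (2 * b))) := by
  have e : ∀ x : E, ENNReal.ofReal (Real.exp (inner ℝ v x - b / 2 * ‖x‖ ^ 2)) =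
      ENNReal.ofReal (Real.exp (-(b / 2) * ‖x - b⁻¹ • v‖ ^ 2)) *
        ENNReal.ofReal (Real.exp (‖v‖ ^ 2 / (2 * b))) := by
    intro x
    rw [← ENNReal.ofReal_mul (Real.exp_pos _).le, ← Real.exp_add, norm_sub_sq_real,
      inner_smul_right, norm_smul, Real.norm_eq_abs, mul_pow, sq_abs, real_inner_comm]
    congr 2
    field_simp
    ring
  simp_rw [e]
  rw [lintegral_mul_const _ (by fun_prop),
    lintegral_sub_right_eq_self (fun x : E => ENNReal.ofReal (Real.exp (-(b / 2) * ‖x‖ ^ 2))),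
    lintegral_exp_neg_norm_sq hb]

lemma lintegral_uniformMeasure {F : Config N → ℝ≥0∞} (hF : Measurable F) :
    ∫⁻ σ, F σ ∂(uniformMeasure N) = ((volume : Measure E).toSphere univ)⁻¹ *
      ∫⁻ ω, F (dilate N ω) ∂(volume : Measure E).toSphere := by
  have hd : Measurable (dilate N) := by
    unfold dilate
    exact Measurable.subtype_mk (by fun_prop)
  rw [uniformMeasure, lintegral_map hF hd, lintegral_smul_measure, smul_eq_mul]

/-- Exponential integrals over the sphere are bounded by Gaussian ones. -/
lemma lintegral_exp_sphere_le {b : ℝ} (hb : 0 < b) (hN : 1 ≤ N) (v : E) :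
    ENNReal.ofReal ((2 * Real.pi / b) ^ ((N : ℝ) / 2)) *
      ∫⁻ σ : Config N, ENNReal.ofReal (Real.exp (inner ℝ v (σ : E))) ∂(uniformMeasure N) ≤
    ENNReal.ofReal (Real.exp (sphereCost b N)) *
      ∫⁻ x : E, ENNReal.ofReal (Real.exp (inner ℝ v x - b / 2 * ‖x‖ ^ 2)) := by
  have : Nonempty (Fin N) := ⟨⟨0, hN⟩⟩
  set μ : Measure E := volume
  have hsph0 : μ.toSphere univ ≠ 0 := by
    rw [Ne, Measure.measure_univ_eq_zero]; exact μ.toSphere_ne_zero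
  have hspht : μ.toSphere univ ≠ ⊤ := measure_ne_top _ _
  set A : ℝ → ℝ≥0∞ := fun r => ∫⁻ ω : Metric.sphere (0 : E) 1,
    ENNReal.ofReal (Real.exp (inner ℝ v (r • (ω : E)))) ∂μ.toSphere with hA
  have hnorm : ∀ (r : ℝ), 0 < r → ∀ ω : Metric.sphere (0 : E) 1, ‖r • (ω : E)‖ = r := by
    intro r hr ω
    rw [norm_smul, norm_eq_of_mem_sphere, mul_one, Real.norm_eq_abs, abs_of_pos hr]
  -- total mass
  have h1 : ENNReal.ofReal ((2 * Real.pi / b) ^ ((N : ℝ) / 2)) =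
      (∫⁻ r in Ioi (0 : ℝ), ENNReal.ofReal (r ^ (N - 1)) *
      ENNReal.ofReal (Real.exp (-(b / 2) * r ^ 2))) * μ.toSphere univ := by
    rw [← lintegral_exp_neg_norm_sq hb, lintegral_polar volume (by fun_prop),
      finrank_euclideanSpace_fin, ← lintegral_mul_const _ (by fun_prop)]
    refine setLIntegral_congr_fun measurableSet_Ioi fun r hr => ?_
    rw [mul_assoc]
    congr 1
    simp_rw [hnorm r hr]
    rw [lintegral_const]
  have h2 : ∫⁻ σ : Config N, ENNReal.ofReal (Real.exp (inner ℝ v (σ : E))) ∂(uniformMeasure N) =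
      (μ.toSphere univ)⁻¹ * A √(N : ℝ) := by
    rw [lintegral_uniformMeasure (by fun_prop)]
    rfl
  -- Only the radii beyond √N are kept. There the spherical integral is at least its value at √N, by
  -- monotonicity in the radius.
  have h3 : (∫⁻ r in Ioi (√(N : ℝ)), ENNReal.ofReal (r ^ (N - 1)) *
      ENNReal.ofReal (Real.exp (-(b / 2) * r ^ 2))) * A √(N : ℝ) ≤
      ∫⁻ x : E, ENNReal.ofReal (Real.exp (inner ℝ v x - b / 2 * ‖x‖ ^ 2)) := by
    rw [lintegral_polar volume (by fun_prop), finrank_euclideanSpace_fin,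
      ← lintegral_mul_const _ (by fun_prop)]
    have hs := Real.sqrt_nonneg (N : ℝ)
    refine le_trans ?_ (lintegral_mono_set (Ioi_subset_Ioi hs))
    refine setLIntegral_mono' measurableSet_Ioi fun r hr => ?_
    have hr0 : 0 < r := hs.trans_lt hr
    have e : ∀ ω : Metric.sphere (0 : E) 1, ENNReal.ofReal (Real.exp
        (inner ℝ v (r • (ω : E)) - b / 2 * ‖r • (ω : E)‖ ^ 2)) =
        ENNReal.ofReal (Real.exp (-(b / 2) * r ^ 2)) *
          ENNReal.ofReal (Real.exp (inner ℝ v (r • (ω : E)))) := by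
      intro ω
      rw [hnorm r hr0, ← ENNReal.ofReal_mul (Real.exp_pos _).le, ← Real.exp_add]
      congr 2; ring
    simp_rw [e]
    rw [lintegral_const_mul _ (by fun_prop), mul_assoc]
    gcongr
    exact lintegral_exp_inner_mono μ v hs (le_of_lt hr)
  rw [h1, h2]
  calc _ = (∫⁻ r in Ioi (0 : ℝ), ENNReal.ofReal (r ^ (N - 1)) *
      ENNReal.ofReal (Real.exp (-(b / 2) * r ^ 2))) * A √(N : ℝ) := by
        rw [mul_assoc, ← mul_assoc (μ.toSphere univ), ENNReal.mul_inv_cancel hsph0 hspht, one_mul]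
    _ ≤ _ := by
        refine (mul_le_mul_left (radial_le hb hN) _).trans ?_
        rw [mul_assoc]
        gcongr

end gauss

end

section

/-! ### Exponential integrals over pairs of configurations -/

section pairbound

variable {N : ℕ}

local notation "E" => EuclideanSpace ℝ (Fin N)

lemma measurable_dilate : Measurable (dilate N) := by
  unfold dilate
  exact Measurable.subtype_mk (by fun_prop)

lemma isProbabilityMeasure_uniformMeasure (hN : 1 ≤ N) :
    IsProbabilityMeasure (uniformMeasure N) := by
  have : Nonempty (Fin N) := ⟨⟨0, hN⟩⟩
  have h0 : (volume : Measure E).toSphere univ ≠ 0 := by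
    rw [Ne, Measure.measure_univ_eq_zero]; exact (volume : Measure E).toSphere_ne_zero
  constructor
  rw [uniformMeasure, Measure.map_apply measurable_dilate .univ, preimage_univ,
    Measure.smul_apply, smul_eq_mul, ENNReal.inv_mul_cancel h0 (measure_ne_top _ _)]

lemma lintegral_exp_inner_uniformMeasure_le {b : ℝ} (hb : 0 < b) (hN : 1 ≤ N) (v : E) :
    ∫⁻ σ : Config N, ENNReal.ofReal (Real.exp (inner ℝ v (σ : E))) ∂(uniformMeasure N) ≤
      ENNReal.ofReal (Real.exp (sphereCost b N + ‖v‖ ^ 2 / (2 * b))) := by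
  have hpi := Real.pi_pos
  have h := lintegral_exp_sphere_le hb hN v
  rw [lintegral_exp_inner_sub_norm_sq hb, mul_left_comm,
    ← ENNReal.ofReal_mul (Real.exp_pos _).le, ← Real.exp_add] at h
  exact (ENNReal.mul_le_mul_iff_right (by simp; positivity) ENNReal.ofReal_ne_top).1 h

/-- The logarithm of the cost of passing from pairs of configurations to Gaussian vectors. -/
def pairCost (b l : ℝ) (N : ℕ) : ℝ :=
  sphereCost b N + sphereCost (b - l ^ 2 / b) N + N * (l ^ 2 / (2 * b))

lemma sub_sq_div_pos {b l : ℝ} (h : |l| < b) : 0 < b - l ^ 2 / b := by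
  have hb : 0 < b := (abs_nonneg l).trans_lt h
  rw [sub_pos, div_lt_iff₀ hb]
  have := sq_lt_sq' (by linarith [abs_nonneg l]) h
  rw [sq_abs] at this
  linarith

lemma sq_sub_sq_pos' {b l : ℝ} (h : |l| < b) : 0 < b ^ 2 - l ^ 2 := by
  have := sq_lt_sq' (by linarith [abs_nonneg l]) h
  rw [sq_abs] at this
  linarith

lemma tendsto_pairCost {b l : ℝ} (h : |l| < b) :
    Tendsto (fun N : ℕ => (N : ℝ)⁻¹ * pairCost b l N) atTop
      (𝓝 (Real.log √(b ^ 2 / (b ^ 2 - l ^ 2)) + (b - 1 - Real.log b))) := by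
  have hb : 0 < b := (abs_nonneg l).trans_lt h
  have hb' := sub_sq_div_pos h
  have hd := sq_sub_sq_pos' h
  have h1 := ((tendsto_sphereCost hb).add (tendsto_sphereCost hb')).add_const (l ^ 2 / (2 * b))
  have e : (b - 1 - Real.log b) / 2 + ((b - l ^ 2 / b) - 1 - Real.log (b - l ^ 2 / b)) / 2 +
      l ^ 2 / (2 * b) = Real.log √(b ^ 2 / (b ^ 2 - l ^ 2)) + (b - 1 - Real.log b) := by
    rw [Real.log_sqrt (by positivity), show b - l ^ 2 / b = (b ^ 2 - l ^ 2) / b by field_simp,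
      Real.log_div hd.ne' hb.ne', Real.log_div (by positivity) hd.ne', Real.log_pow]
    push_cast
    field_simp
    ring
  rw [e] at h1
  refine h1.congr' ?_
  filter_upwards [eventually_ge_atTop 1] with N hN
  have hNpos : (0 : ℝ) < N := by exact_mod_cast hN
  rw [pairCost]
  field_simp

/-- The second configuration is integrated first, in the field v₂ + lσ and with precision b. Since
‖σ‖² = N is fixed, its quadratic term in σ is a constant, and σ remains in the linear field v₁ +
(l/b)v₂. The second integration uses the Schur complement b - l²/b, which reproduces the inverse of
[[b,-l],[-l,b]]. -/
lemma lintegral_exp_pair_le {b l : ℝ} (h : |l| < b) (hN : 1 ≤ N) (v₁ v₂ : E) :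
    ∫⁻ p : Config N × Config N, ENNReal.ofReal (Real.exp (inner ℝ v₁ (p.1 : E) +
        inner ℝ v₂ (p.2 : E) + l * inner ℝ (p.1 : E) (p.2 : E)))
      ∂((uniformMeasure N).prod (uniformMeasure N)) ≤
    ENNReal.ofReal (Real.exp (pairCost b l N +
      (b * ‖v₁‖ ^ 2 + 2 * l * inner ℝ v₁ v₂ + b * ‖v₂‖ ^ 2) / (2 * (b ^ 2 - l ^ 2)))) := by
  have hb : 0 < b := (abs_nonneg l).trans_lt h
  have hb' := sub_sq_div_pos h
  have hd := sq_sub_sq_pos' h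
  have := isProbabilityMeasure_uniformMeasure hN
  have hNN : (0 : ℝ) ≤ N := N.cast_nonneg
  rw [lintegral_prod _ (by fun_prop)]
  simp only
  set C := sphereCost b N + ‖v₂‖ ^ 2 / (2 * b) + N * (l ^ 2 / (2 * b)) with hC
  calc _ ≤ ∫⁻ σ : Config N, ENNReal.ofReal (Real.exp C) *
        ENNReal.ofReal (Real.exp (inner ℝ (v₁ + (l / b) • v₂) (σ : E))) ∂(uniformMeasure N) := by
        refine lintegral_mono fun σ => ?_
        have e : ∀ τ : Config N, ENNReal.ofReal (Real.exp (inner ℝ v₁ (σ : E) +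
            inner ℝ v₂ (τ : E) + l * inner ℝ (σ : E) (τ : E))) =
            ENNReal.ofReal (Real.exp (inner ℝ v₁ (σ : E))) *
              ENNReal.ofReal (Real.exp (inner ℝ (v₂ + l • (σ : E)) (τ : E))) := by
          intro τ
          rw [← ENNReal.ofReal_mul (Real.exp_pos _).le, ← Real.exp_add, inner_add_left,
            real_inner_smul_left, add_assoc]
        simp_rw [e]
        rw [lintegral_const_mul _ (by fun_prop)]
        refine (mul_le_mul_right (lintegral_exp_inner_uniformMeasure_le hb hN _) _).trans_eq ?_
        rw [← ENNReal.ofReal_mul (Real.exp_pos _).le, ← Real.exp_add,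
          ← ENNReal.ofReal_mul (Real.exp_pos _).le, ← Real.exp_add]
        congr 2
        have hσ : ‖(σ : E)‖ ^ 2 = N := by rw [norm_eq_of_mem_sphere, Real.sq_sqrt hNN]
        rw [norm_add_sq_real, norm_smul, mul_pow, hσ, Real.norm_eq_abs, sq_abs, inner_smul_right,
          inner_add_left, real_inner_smul_left, hC]
        field_simp
        ring
    _ ≤ ENNReal.ofReal (Real.exp C) * ENNReal.ofReal (Real.exp (sphereCost (b - l ^ 2 / b) N +
          ‖v₁ + (l / b) • v₂‖ ^ 2 / (2 * (b - l ^ 2 / b)))) := by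
        rw [lintegral_const_mul _ (by fun_prop)]
        gcongr
        exact lintegral_exp_inner_uniformMeasure_le hb' hN _
    _ = _ := by
        rw [← ENNReal.ofReal_mul (Real.exp_pos _).le, ← Real.exp_add]
        congr 2
        rw [norm_add_sq_real, norm_smul, mul_pow, Real.norm_eq_abs, sq_abs, inner_smul_right, hC,
          pairCost, show b - l ^ 2 / b = (b ^ 2 - l ^ 2) / b by field_simp]
        field_simp
        ring

/-- The precisions of the two kinds of coordinates. -/
def pairPrec (b l η : ℝ) (j : Bool × Fin N) : ℝ := if j.1 then b - η * l else b + η * l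

lemma measurable_overlap : Measurable fun p : Config N × Config N => overlap p.1 p.2 := by
  unfold overlap; fun_prop

lemma measurable_pairCoef (η : ℝ) (j : Bool × Fin N) :
    Measurable fun p : Config N × Config N => pairCoef η p j := by
  unfold pairCoef
  have : ∀ i, Measurable fun σ : Config N => (σ : E) i := fun i => by fun_prop
  fun_prop

/-- The set of pairs of configurations with overlap close to `u`. -/
def overlapSet (N : ℕ) (u α : ℝ) : Set (Config N × Config N) := {s | |overlap s.1 s.2 - u| < α}

lemma measurableSet_overlapSet (u α : ℝ) : MeasurableSet (overlapSet N u α) :=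
  measurableSet_lt ((measurable_overlap.sub_const u).abs) measurable_const

/-- On the constrained set, inserting exp(lN(R-u)) costs at most exp(N|l|α), after which the
constraint is dropped. In the coordinates (1,±η)/√2 the precision matrix [[b,-l],[-l,b]] is diagonal
with eigenvalues b∓ηl. -/
lemma lintegral_exp_pairCoef_le {b l : ℝ} (h : |l| < b) (hN : 1 ≤ N) {η : ℝ} (hη : η = 1 ∨ η = -1)
    (u α : ℝ) (z : Bool × Fin N → ℝ) :
    ∫⁻ p in overlapSet N u α, ENNReal.ofReal (Real.exp (∑ j, z j * pairCoef η p j))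
      ∂((uniformMeasure N).prod (uniformMeasure N)) ≤
    ENNReal.ofReal (Real.exp (pairCost b l N + N * (|l| * α - l * u) +
      ∑ j, z j ^ 2 / (2 * pairPrec b l η j))) := by
  have hb : 0 < b := (abs_nonneg l).trans_lt h
  have hd := sq_sub_sq_pos' h
  have hNpos : (0 : ℝ) < N := by exact_mod_cast hN
  have hη2 : η * η = 1 := by rcases hη with rfl | rfl <;> norm_num
  have h2 : √(2 : ℝ) * √2 = 2 := Real.mul_self_sqrt (by norm_num)
  have hs2 : √(2 : ℝ) ≠ 0 := by positivity
  set v₁ : E := WithLp.toLp 2 fun i => (z (true, i) + z (false, i)) / √2 with hv₁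
  set v₂ : E := WithLp.toLp 2 fun i => η * (z (true, i) - z (false, i)) / √2 with hv₂
  have e1 : ∀ p : Config N × Config N, ∑ j, z j * pairCoef η p j =
      inner ℝ v₁ (p.1 : E) + inner ℝ v₂ (p.2 : E) := by
    intro p
    rw [PiLp.inner_apply, PiLp.inner_apply, Fintype.sum_prod_type]
    simp only [Fintype.sum_bool, ← Finset.sum_add_distrib]
    refine Finset.sum_congr rfl fun i _ => ?_
    simp [hv₁, hv₂, pairCoef]
    field_simp
    ring
  have hp1 : b - η * l ≠ 0 := by
    have := abs_lt.1 h
    rcases hη with rfl | rfl <;> linarith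
  have hp2 : b + η * l ≠ 0 := by
    have := abs_lt.1 h
    rcases hη with rfl | rfl <;> linarith
  have e2 : (b * ‖v₁‖ ^ 2 + 2 * l * inner ℝ v₁ v₂ + b * ‖v₂‖ ^ 2) / (2 * (b ^ 2 - l ^ 2)) =
      ∑ j, z j ^ 2 / (2 * pairPrec b l η j) := by
    rw [EuclideanSpace.real_norm_sq_eq, EuclideanSpace.real_norm_sq_eq, PiLp.inner_apply,
      Fintype.sum_prod_type]
    simp only [Fintype.sum_bool, ← Finset.sum_add_distrib, Finset.mul_sum, Finset.sum_div]
    refine Finset.sum_congr rfl fun i _ => ?_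
    have hd' : b ^ 2 - l ^ 2 = (b - η * l) * (b + η * l) := by linear_combination (l ^ 2) * hη2
    have hs : √(2 : ℝ) ^ 2 = 2 := Real.sq_sqrt (by norm_num)
    rw [hd']
    simp only [hv₁, hv₂, pairPrec, if_true, Bool.false_eq_true, if_false, div_pow, hs, mul_pow,
      RCLike.inner_apply, conj_trivial]
    rw [div_mul_div_comm, h2, show η ^ 2 = 1 by rw [sq]; exact hη2,
      div_add_div _ _ (mul_ne_zero two_ne_zero hp1) (mul_ne_zero two_ne_zero hp2),
      div_eq_div_iff (mul_ne_zero two_ne_zero (mul_ne_zero hp1 hp2))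
        (mul_ne_zero (mul_ne_zero two_ne_zero hp1) (mul_ne_zero two_ne_zero hp2))]
    ring
  calc _ ≤ ∫⁻ p in overlapSet N u α, ENNReal.ofReal (Real.exp (N * (|l| * α - l * u))) *
        ENNReal.ofReal (Real.exp (inner ℝ v₁ (p.1 : E) +
        inner ℝ v₂ (p.2 : E) + l * inner ℝ (p.1 : E) (p.2 : E)))
        ∂((uniformMeasure N).prod (uniformMeasure N)) := by
        refine setLIntegral_mono (by fun_prop) fun p hp => ?_
        rw [e1, ← ENNReal.ofReal_mul (Real.exp_pos _).le, ← Real.exp_add]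
        apply ENNReal.ofReal_le_ofReal
        rw [Real.exp_le_exp]
        have h3 : inner ℝ (p.1 : E) (p.2 : E) = N * overlap p.1 p.2 := by
          rw [overlap, mul_inv_cancel_left₀ hNpos.ne']
        rw [h3]
        have h4 : -(|l| * α) ≤ l * (overlap p.1 p.2 - u) := by
          have h5 : |l * (overlap p.1 p.2 - u)| ≤ |l| * α := by
            rw [abs_mul]
            have : |overlap p.1 p.2 - u| < α := hp
            gcongr
          linarith [neg_abs_le (l * (overlap p.1 p.2 - u))]
        nlinarith
    _ ≤ ∫⁻ p, ENNReal.ofReal (Real.exp (N * (|l| * α - l * u))) *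
        ENNReal.ofReal (Real.exp (inner ℝ v₁ (p.1 : E) +
        inner ℝ v₂ (p.2 : E) + l * inner ℝ (p.1 : E) (p.2 : E)))
        ∂((uniformMeasure N).prod (uniformMeasure N)) := setLIntegral_le_lintegral _ _
    _ ≤ _ := by
        rw [lintegral_const_mul _ (by fun_prop)]
        refine (mul_le_mul_right (lintegral_exp_pair_le h hN v₁ v₂) _).trans_eq ?_
        rw [← ENNReal.ofReal_mul (Real.exp_pos _).le, ← Real.exp_add, e2]
        congr 2; ring

end pairbound

end

section

/-! ### The coupled partition function as an average -/

section weights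

variable {N : ℕ}

local notation "E" => EuclideanSpace ℝ (Fin N)

lemma isOpenPosMeasure_uniformMeasure (hN : 1 ≤ N) : (uniformMeasure N).IsOpenPosMeasure := by
  have : Nonempty (Fin N) := ⟨⟨0, hN⟩⟩
  have hs : 0 < √(N : ℝ) := Real.sqrt_pos.2 (by exact_mod_cast hN)
  have h1 := Measure.isOpenPosMeasure_smul (volume : Measure E).toSphere
    (ENNReal.inv_ne_zero.2 (measure_ne_top (volume : Measure E).toSphere univ))
  have hc : Continuous (dilate N) := by
    unfold dilate
    exact Continuous.subtype_mk (by fun_prop) _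
  refine hc.isOpenPosMeasure_map fun σ => ?_
  refine ⟨⟨(√(N : ℝ))⁻¹ • (σ : E), ?_⟩, ?_⟩
  · rw [mem_sphere_zero_iff_norm, norm_smul, norm_eq_of_mem_sphere, Real.norm_eq_abs,
      abs_of_pos (inv_pos.2 hs), inv_mul_cancel₀ hs.ne']
  · apply Subtype.ext
    simp only [dilate]
    rw [smul_smul, mul_inv_cancel₀ hs.ne', one_smul]

/-- Rotation in a plane, hence the restriction to dimension at least 2: for N = 1 only the overlaps
±1 occur. -/
lemma exists_overlap_eq (hN : 2 ≤ N) {u : ℝ} (hu : u ∈ Icc (-1 : ℝ) 1) :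
    ∃ p : Config N × Config N, overlap p.1 p.2 = u := by
  have hNpos : (0 : ℝ) < N := by exact_mod_cast (by omega : 0 < N)
  have hs : 0 < √(N : ℝ) := Real.sqrt_pos.2 hNpos
  have hsq : √(N : ℝ) * √(N : ℝ) = N := Real.mul_self_sqrt hNpos.le
  set e₀ : E := EuclideanSpace.single ⟨0, by omega⟩ 1 with he₀
  set e₁ : E := EuclideanSpace.single ⟨1, by omega⟩ 1 with he₁
  have h00 : ‖e₀‖ = 1 := by simp [he₀]
  have h11 : ‖e₁‖ = 1 := by simp [he₁]
  have h01 : inner ℝ e₀ e₁ = (0 : ℝ) := by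
    simp [he₀, he₁, EuclideanSpace.inner_single_left]
  have hu2 : 0 ≤ 1 - u ^ 2 := by nlinarith [hu.1, hu.2]
  have hw : ‖u • e₀ + √(1 - u ^ 2) • e₁‖ = 1 := by
    rw [← sq_eq_sq₀ (norm_nonneg _) zero_le_one, norm_add_sq_real, norm_smul, norm_smul, h00, h11,
      real_inner_smul_left, real_inner_smul_right, h01, mul_one, mul_one, Real.norm_eq_abs, sq_abs,
      Real.norm_eq_abs, sq_abs, Real.sq_sqrt hu2]
    ring
  refine ⟨(⟨√(N : ℝ) • e₀, ?_⟩, ⟨√(N : ℝ) • (u • e₀ + √(1 - u ^ 2) • e₁), ?_⟩), ?_⟩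
  · rw [mem_sphere_zero_iff_norm, norm_smul, h00, mul_one, Real.norm_eq_abs, abs_of_pos hs]
  · rw [mem_sphere_zero_iff_norm, norm_smul, hw, mul_one, Real.norm_eq_abs, abs_of_pos hs]
  · rw [overlap]
    simp only
    rw [real_inner_smul_left, real_inner_smul_right, inner_add_right, real_inner_smul_right,
      real_inner_smul_right, h01, real_inner_self_eq_norm_sq, h00, ← mul_assoc (√(N : ℝ)), hsq]
    field_simp
    ring

lemma overlapSet_pos (hN : 2 ≤ N) {u α : ℝ} (hu : u ∈ Icc (-1 : ℝ) 1) (hα : 0 < α) :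
    0 < ((uniformMeasure N).prod (uniformMeasure N)) (overlapSet N u α) := by
  have := isOpenPosMeasure_uniformMeasure (N := N) (by omega)
  have := isProbabilityMeasure_uniformMeasure (N := N) (by omega)
  have ho : IsOpen (overlapSet N u α) := by
    have : Continuous fun p : Config N × Config N => overlap p.1 p.2 := by
      unfold overlap; fun_prop
    exact isOpen_lt (this.sub continuous_const).abs continuous_const
  obtain ⟨p, hp⟩ := exists_overlap_eq hN hu
  exact ho.measure_pos _ ⟨p, by simpa [overlapSet, hp] using hα⟩

/-- The normalized restriction of the uniform measure to the pairs with overlap close to `u`. -/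
def pairMeasure (N : ℕ) (u α : ℝ) : Measure (Config N × Config N) :=
  ProbabilityTheory.cond ((uniformMeasure N).prod (uniformMeasure N)) (overlapSet N u α)

/-- The mass of the set of pairs with overlap close to `u`. -/
def pairMass (N : ℕ) (u α : ℝ) : ℝ :=
  ((uniformMeasure N).prod (uniformMeasure N)).real (overlapSet N u α)

variable {u α : ℝ}

lemma pairMass_pos (hN : 2 ≤ N) (hu : u ∈ Icc (-1 : ℝ) 1) (hα : 0 < α) : 0 < pairMass N u α := by
  have := isProbabilityMeasure_uniformMeasure (N := N) (by omega)
  exact ENNReal.toReal_pos (overlapSet_pos hN hu hα).ne' (measure_ne_top _ _)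

lemma isProbabilityMeasure_pairMeasure (hN : 2 ≤ N) (hu : u ∈ Icc (-1 : ℝ) 1) (hα : 0 < α) :
    IsProbabilityMeasure (pairMeasure N u α) := by
  have := isProbabilityMeasure_uniformMeasure (N := N) (by omega)
  exact ProbabilityTheory.cond_isProbabilityMeasure (overlapSet_pos hN hu hα).ne'

lemma ae_mem_overlapSet : ∀ᵐ p ∂(pairMeasure N u α), |overlap p.1 p.2 - u| < α := by
  rw [pairMeasure, ProbabilityTheory.cond]
  exact Measure.ae_smul_measure (ae_restrict_mem (measurableSet_overlapSet u α)) _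

variable {Ω : Type*} [MeasurableSpace Ω] {P : Measure Ω} {ξ : ℝ → ℝ} {t h : ℝ}
  {X : Fin 2 → Config N → Ω → ℝ}

/-- The contribution of the external field. -/
def fieldTerm (h : ℝ) (p : Config N × Config N) : ℝ :=
  h * ∑ i, (p.1 : E) i + h * ∑ i, (p.2 : E) i

/-- The integrand of the partition function, multiplied by the mass of the domain. -/
def pairWeight (h : ℝ) (X : Fin 2 → Config N → Ω → ℝ) (u α : ℝ)
    (p : (Config N × Config N) × Ω) : ℝ :=
  pairMass N u α * (Real.exp (fieldTerm h p.1) * Real.exp (X 0 p.1.1 p.2 + X 1 p.1.2 p.2))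

lemma abs_fieldTerm_le (h : ℝ) (p : Config N × Config N) :
    |fieldTerm h p| ≤ 2 * (|h| * (N * √(N : ℝ))) := by
  have key : ∀ σ : Config N, |h * ∑ i, (σ : E) i| ≤ |h| * (N * √(N : ℝ)) := by
    intro σ
    rw [abs_mul]
    gcongr
    calc |∑ i, (σ : E) i| ≤ ∑ i, |(σ : E) i| := Finset.abs_sum_le_sum_abs _ _
      _ ≤ ∑ _i : Fin N, √(N : ℝ) := by
          refine Finset.sum_le_sum fun i _ => ?_
          have := PiLp.norm_apply_le (σ : E) i
          rwa [norm_eq_of_mem_sphere] at this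
      _ = _ := by simp
  rw [fieldTerm, two_mul]
  exact (abs_add_le _ _).trans (add_le_add (key _) (key _))

lemma measurable_fieldTerm (h : ℝ) : Measurable (fieldTerm h : Config N × Config N → ℝ) := by
  unfold fieldTerm
  have : ∀ i, Measurable fun σ : Config N => (σ : E) i := fun i => by fun_prop
  fun_prop

lemma IsCoupledPair.measurable_pair (hX : IsCoupledPair P ξ t N X) :
    Measurable fun p : (Config N × Config N) × Ω => X 0 p.1.1 p.2 + X 1 p.1.2 p.2 :=
  ((hX.measurable 0).comp (by fun_prop : Measurable fun p : (Config N × Config N) × Ω =>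
    (p.1.1, p.2))).add ((hX.measurable 1).comp (by fun_prop : Measurable
    fun p : (Config N × Config N) × Ω => (p.1.2, p.2)))

lemma IsCoupledPair.lintegral_exp_le (hX : IsCoupledPair P ξ t N X) (hN : N ≠ 0) (c : ℝ)
    (p : Config N × Config N) :
    ∫⁻ ω, ENNReal.ofReal (Real.exp (c * (X 0 p.1 ω + X 1 p.2 ω))) ∂P ≤
      ENNReal.ofReal (Real.exp (c ^ 2 * (4 * N * ξ 1) / 2)) := by
  have hg := hX.isGaussNoise (fun _ : Unit => p)
  have hm : Measurable (fun ω (_ : Unit) => X 0 p.1 ω + X 1 p.2 ω) :=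
    measurable_pi_lambda _ fun k => hX.measurable_add p
  have h1 : ∫⁻ ω, ENNReal.ofReal (Real.exp (c * (X 0 p.1 ω + X 1 p.2 ω))) ∂P =
      ∫⁻ x, ENNReal.ofReal (Real.exp (c * x))
        ∂((P.map fun ω (_ : Unit) => X 0 p.1 ω + X 1 p.2 ω).map fun a => a ()) := by
    rw [lintegral_map (by fun_prop) (by fun_prop), lintegral_map (by fun_prop) hm]
  rw [h1, hg.map_eval (), lintegral_exp_gaussianReal (hg.diag_nonneg ())]
  have hv : pairCov ξ t N p p ≤ 4 * N * ξ 1 := by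
    rw [← hX.cov_add p p]
    have hsq : ∀ j σ, Integrable (fun ω => X j σ ω * X j σ ω) P := fun j σ =>
      (hX.memLp j σ).integrable_mul (hX.memLp j σ)
    have hvar : ∀ j σ, ∫ ω, X j σ ω * X j σ ω ∂P = N * ξ 1 := by
      intro j σ
      rw [hX.covariance, overlap_self hN]; simp
    have hi : Integrable (fun ω => 2 * (X 0 p.1 ω * X 0 p.1 ω) + 2 * (X 1 p.2 ω * X 1 p.2 ω)) P :=
      ((hsq _ _).const_mul 2).add ((hsq _ _).const_mul 2)
    calc ∫ ω, (X 0 p.1 ω + X 1 p.2 ω) * (X 0 p.1 ω + X 1 p.2 ω) ∂P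
        ≤ ∫ ω, (2 * (X 0 p.1 ω * X 0 p.1 ω) + 2 * (X 1 p.2 ω * X 1 p.2 ω)) ∂P := by
          refine integral_mono_of_nonneg (Eventually.of_forall fun ω => mul_self_nonneg _) hi
            (Eventually.of_forall fun ω => ?_)
          simp only
          nlinarith [sq_nonneg (X 0 p.1 ω - X 1 p.2 ω)]
      _ = _ := by
          rw [integral_add ((hsq _ _).const_mul 2) ((hsq _ _).const_mul 2), integral_const_mul,
            integral_const_mul, hvar, hvar]
          ring
  apply ENNReal.ofReal_le_ofReal
  rw [Real.exp_le_exp]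
  gcongr

/-- The field is bounded on the sphere, and the Gaussian exponential moments, of order 2 and of
order -2, are bounded uniformly over the configurations since the variances are. -/
lemma isWeight_pairWeight (hX : IsCoupledPair P ξ t N X) (hN : 2 ≤ N)
    (hu : u ∈ Icc (-1 : ℝ) 1) (hα : 0 < α) :
    IsWeight (pairMeasure N u α) P (pairWeight h X u α) := by
  have := isProbabilityMeasure_pairMeasure hN hu hα
  have := hX.gaussian.isProbabilityMeasure
  have hm := pairMass_pos hN hu hα
  have hmf := measurable_fieldTerm (N := N) h
  have hmX := hX.measurable_pair
  set B := 2 * (|h| * (N * √(N : ℝ))) with hB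
  have key : ∀ (a c : ℝ), 0 ≤ a → Integrable (fun p : (Config N × Config N) × Ω =>
      a * (Real.exp (c * fieldTerm h p.1) * Real.exp (c * (X 0 p.1.1 p.2 + X 1 p.1.2 p.2))))
      ((pairMeasure N u α).prod P) := by
    intro a c ha
    have hm2 : Measurable (fun p : (Config N × Config N) × Ω =>
      a * (Real.exp (c * fieldTerm h p.1) * Real.exp (c * (X 0 p.1.1 p.2 + X 1 p.1.2 p.2)))) := by
      fun_prop
    refine ⟨hm2.aestronglyMeasurable, ?_⟩
    rw [hasFiniteIntegral_iff_ofReal (Eventually.of_forall fun p => by positivity)]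
    rw [lintegral_prod _ hm2.ennreal_ofReal.aemeasurable]
    calc _ ≤ ∫⁻ _p : Config N × Config N, ENNReal.ofReal (a * Real.exp (|c| * B)) *
          ENNReal.ofReal (Real.exp (c ^ 2 * (4 * N * ξ 1) / 2)) ∂(pairMeasure N u α) := by
          refine lintegral_mono fun p => ?_
          have hb : a * Real.exp (c * fieldTerm h p) ≤ a * Real.exp (|c| * B) := by
            have hcf : c * fieldTerm h p ≤ |c| * B :=
              calc c * fieldTerm h p ≤ |c * fieldTerm h p| := le_abs_self _
                _ ≤ |c| * B := by rw [abs_mul]; gcongr; exact abs_fieldTerm_le h p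
            exact mul_le_mul_of_nonneg_left (Real.exp_le_exp.2 hcf) ha
          calc _ ≤ ∫⁻ ω, ENNReal.ofReal (a * Real.exp (|c| * B)) *
                ENNReal.ofReal (Real.exp (c * (X 0 p.1 ω + X 1 p.2 ω))) ∂P := by
                refine lintegral_mono fun ω => ?_
                rw [← ENNReal.ofReal_mul (by positivity)]
                apply ENNReal.ofReal_le_ofReal
                simp only
                rw [← mul_assoc]
                gcongr
            _ ≤ _ := by
                have := hX.measurable_add p
                rw [lintegral_const_mul _ (by fun_prop)]
                gcongr
                exact hX.lintegral_exp_le (by omega) c p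
      _ < ⊤ := by
          rw [lintegral_const, measure_univ, mul_one]
          exact ENNReal.mul_lt_top ENNReal.ofReal_lt_top ENNReal.ofReal_lt_top
  refine ⟨?_, fun p => ?_, ?_, ?_⟩
  · unfold pairWeight; fun_prop
  · rw [pairWeight]; positivity
  · refine (key (pairMass N u α ^ 2) 2 (by positivity)).congr (Eventually.of_forall fun p => ?_)
    simp only [pairWeight]
    rw [mul_pow, mul_pow, ← Real.exp_nat_mul, ← Real.exp_nat_mul]
    norm_num
  · refine (key ((pairMass N u α)⁻¹ ^ 2) (-2) (by positivity)).congr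
      (Eventually.of_forall fun p => ?_)
    simp only [pairWeight]
    rw [mul_inv, mul_inv, ← Real.exp_neg, ← Real.exp_neg, mul_pow, mul_pow, ← Real.exp_nat_mul,
      ← Real.exp_nat_mul]
    push_cast
    congr 3 <;> ring

/-- The mass included in `pairWeight` undoes the normalization of `pairMeasure`. Sampling requires a
probability measure, whereas the partition function is an unnormalized integral. -/
lemma coupledPartition_eq (hN : 2 ≤ N) (hu : u ∈ Icc (-1 : ℝ) 1) (hα : 0 < α) (ω : Ω) :
    coupledPartition h X u α ω = avgOver (pairMeasure N u α) (pairWeight h X u α) ω := by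
  have hm := pairMass_pos hN hu hα
  rw [avgOver, pairMeasure, ProbabilityTheory.cond, integral_smul_measure]
  simp only [pairWeight]
  rw [integral_const_mul, ENNReal.toReal_inv]
  change _ = (pairMass N u α)⁻¹ • _
  rw [smul_eq_mul, inv_mul_cancel_left₀ hm.ne']
  refine integral_congr_ae (Eventually.of_forall fun p => ?_)
  simp only [negHamiltonian, fieldTerm]
  rw [← Real.exp_add]
  congr 1; ring

end weights

end

section

/-! ### The bound for a fixed system size and a fixed partition -/

/-- The variances of the two kinds of coordinates on a cell. -/
def cellVar (ψ : ℝ → ℝ) (t v : ℝ) (q : ℕ → ℝ) (i : ℕ) (c : Bool) : ℝ :=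
  if c then inc ψ q i + t * incMin ψ v q i else inc ψ q i - t * incMin ψ v q i

/-- The external field in the two kinds of coordinates. -/
def fieldCoef (h η : ℝ) (c : Bool) : ℝ := h * (1 + if c then η else -η) / √2

section

variable {N : ℕ} {u α h : ℝ}

local notation "E" => EuclideanSpace ℝ (Fin N)

lemma fieldTerm_eq {η : ℝ} (hη : η * η = 1) (p : Config N × Config N) :
    fieldTerm h p = ∑ j : Bool × Fin N, fieldCoef h η j.1 * pairCoef η p j := by
  have h2 : √(2 : ℝ) * √2 = 2 := Real.mul_self_sqrt (by norm_num)
  rw [Fintype.sum_prod_type]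
  simp only [Fintype.sum_bool, fieldCoef, pairCoef, fieldTerm, Finset.mul_sum, if_true,
    Bool.false_eq_true, if_false, ← Finset.sum_add_distrib]
  refine Finset.sum_congr rfl fun i _ => ?_
  rw [div_mul_div_comm, div_mul_div_comm, h2]
  linear_combination (-h * (p.2 : E) i) * hη

lemma lintegral_pairMeasure_le {b l : ℝ} (hlb : |l| < b) (hN : 2 ≤ N) {η : ℝ}
    (hη : η = 1 ∨ η = -1) (hu : u ∈ Icc (-1 : ℝ) 1) (hα : 0 < α) (z : Bool × Fin N → ℝ) :
    ∫⁻ p, ENNReal.ofReal (pairMass N u α * Real.exp (fieldTerm h p) *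
        Real.exp (∑ j, z j * pairCoef η p j)) ∂(pairMeasure N u α) ≤
    ENNReal.ofReal (Real.exp (pairCost b l N + N * (|l| * α - l * u) +
      ∑ j, (z j + fieldCoef h η j.1) ^ 2 / (2 * pairPrec b l η j))) := by
  have := isProbabilityMeasure_uniformMeasure (N := N) (by omega)
  have hη2 : η * η = 1 := by rcases hη with rfl | rfl <;> norm_num
  have hm := pairMass_pos hN hu hα
  have hA0 := (overlapSet_pos hN hu hα).ne'
  have hmA : ENNReal.ofReal (pairMass N u α) =
      ((uniformMeasure N).prod (uniformMeasure N)) (overlapSet N u α) :=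
    ENNReal.ofReal_toReal (measure_ne_top _ _)
  have e : ∀ p : Config N × Config N, ENNReal.ofReal (pairMass N u α * Real.exp (fieldTerm h p) *
      Real.exp (∑ j, z j * pairCoef η p j)) =
      ((uniformMeasure N).prod (uniformMeasure N)) (overlapSet N u α) *
      ENNReal.ofReal (Real.exp (∑ j, (z j + fieldCoef h η j.1) * pairCoef η p j)) := by
    intro p
    rw [← hmA, ← ENNReal.ofReal_mul hm.le, mul_assoc, ← Real.exp_add, fieldTerm_eq hη2,
      ← Finset.sum_add_distrib]
    congr 3
    refine Finset.sum_congr rfl fun j _ => ?_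
    ring
  have hmeas : Measurable fun p : Config N × Config N =>
      ENNReal.ofReal (Real.exp (∑ j, (z j + fieldCoef h η j.1) * pairCoef η p j)) :=
    (Finset.measurable_sum _ fun j _ =>
      (measurable_pairCoef η j).const_mul _).exp.ennreal_ofReal
  simp_rw [e]
  rw [lintegral_const_mul _ hmeas, pairMeasure, ProbabilityTheory.cond, lintegral_smul_measure,
    smul_eq_mul, ← mul_assoc, ENNReal.mul_inv_cancel hA0 (measure_ne_top _ _), one_mul]
  exact lintegral_exp_pairCoef_le hlb (by omega) hη u α _

variable {Ω : Type*} [MeasurableSpace Ω] {P : Measure Ω} {ξ ψ : ℝ → ℝ} {t v η b l κ : ℝ}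
  {X : Fin 2 → Config N → Ω → ℝ} {q n : ℕ → ℝ} {T : ℕ} {γ : ℕ → Bool → ℝ}

/-- The upper bound for the free energy of an empirical average. -/
def levelBound (ξ ψ : ℝ → ℝ) (t v h η : ℝ) (q n : ℕ → ℝ) (T : ℕ) (γ : ℕ → Bool → ℝ) : ℝ :=
  ∑ i ∈ Finset.range T, ∑ c, cellVar ψ t v q i c / (2 * γ i c) +
    ∑ c, fieldCoef h η c ^ 2 / (2 * γ 0 c) -
    ∑ i ∈ Finset.range T, n i * (inc (theta ξ ψ) q i + t * incMin (theta ξ ψ) v q i)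

lemma sum_bool_prod (F : Bool → ℝ) : ∑ j : Bool × Fin N, F j.1 = N * ∑ c, F c := by
  rw [Fintype.sum_prod_type, Finset.mul_sum]
  simp

/-- `guerra_pairs` holds for almost every sample. Averaging over samples uses Jensen's inequality
twice: for exp on the left, and on the right to bring the average inside the concave powers of the
recursion. The averaged innermost function is a linear exponential integral over one pair, bounded
by a Gaussian quadratic, and `recE_quadratic_le` evaluates the levels. The common factor n_0 then
cancels. -/
theorem empirical_le {K : Type*} [Fintype K] [Nonempty K] (hX : IsCoupledPair P ξ t N X)
    (hN : 2 ≤ N) (hp : IsProfile ξ ψ) (hq : Monotone q) (hq01 : ∀ i, q i ∈ Icc (0 : ℝ) 1)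
    (hq0 : q 0 = 0) (hv : v ∈ Icc (0 : ℝ) 1) (ht : t ∈ Icc (0 : ℝ) 1) (hη : η = 1 ∨ η = -1)
    (hqT : q T = 1) (hn : ∀ i, 0 < n i) (hnm : Monotone n) (hnT : n T = 1)
    (hu : u ∈ Icc (-1 : ℝ) 1) (hα : 0 < α) (hlb : |l| < b)
    (hκ : ∀ r ∈ Icc (-1 : ℝ) 1, |r - u| < α → slack ξ ψ (η * r) v ≤ κ)
    (hγ : ∀ i ≤ T, ∀ c, 0 < γ i c)
    (hγa : ∀ i < T, ∀ c, γ i c = γ (i + 1) c - n i * cellVar ψ t v q i c)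
    (hγT : ∀ c, γ T c = if c then b - η * l else b + η * l) :
    ∫ s : K → Config N × Config N, ∫ ω, Real.log (empAvg (pairWeight h X u α) (s, ω)) ∂P
      ∂(Measure.pi fun _ => pairMeasure N u α) ≤
    pairCost b l N + N * ((|l| * α - l * u) + levelBound ξ ψ t v h η q n T γ + κ) := by
  have hN0 : N ≠ 0 := by omega
  have hPP := hX.gaussian.isProbabilityMeasure
  have hρ := isProbabilityMeasure_pairMeasure hN hu hα
  have hm := pairMass_pos hN hu hα
  have hW := isWeight_pairWeight (h := h) hX hN hu hα
  set ρ := pairMeasure N u α with hρdef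
  set π := Measure.pi fun _ : K => ρ with hπ
  have hM : (0 : ℝ) < Fintype.card K := by exact_mod_cast Fintype.card_pos
  set w : (K → Config N × Config N) → K → ℝ := fun s k =>
    (Fintype.card K : ℝ)⁻¹ * (pairMass N u α * Real.exp (fieldTerm h (s k))) with hw
  have hwpos : ∀ s k, 0 < w s k := fun s k => by simp only [hw]; positivity
  set g : (K → Config N × Config N) → ℝ := fun s =>
    ∫ ω, Real.log (empAvg (pairWeight h X u α) (s, ω)) ∂P with hg
  have hgi : Integrable g π := (hW.integrable_log_empAvg (K := K)).integral_prod_left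
  set A := ∑ i ∈ Finset.range T,
    n i * (N * (inc (theta ξ ψ) q i + t * incMin (theta ξ ψ) v q i)) with hA
  set L := (List.range' 0 T).map fun i =>
    (n i / n (i + 1), diagNoise (levelVar (N := N) ψ t v q i)) with hL
  set G : (K → Config N × Config N) → (Bool × Fin N → ℝ) → ℝ≥0∞ := fun s z =>
    ENNReal.ofReal (∑ k, w s k * Real.exp (∑ j, z j * pairCoef η (s k) j)) with hG
  have hwm : ∀ k, Measurable fun s => w s k := fun k =>
    (((measurable_fieldTerm h).comp (measurable_pi_apply k)).exp.const_mul _).const_mul _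
  have hGm : Measurable (Function.uncurry G) := by
    refine Measurable.ennreal_ofReal (Finset.measurable_sum _ fun k _ => ?_)
    refine ((hwm k).comp measurable_fst).mul (Measurable.exp (Finset.measurable_sum _ fun j _ => ?_))
    have h1 : Measurable fun x : (K → Config N × Config N) × (Bool × Fin N → ℝ) =>
        pairCoef η (x.1 k) j :=
      (measurable_pairCoef η j).comp ((measurable_pi_apply k).comp measurable_fst)
    exact ((measurable_pi_apply j).comp measurable_snd).mul h1
  have hLv : ∀ ℓ ∈ L, 0 < ℓ.1 ∧ ℓ.1 ≤ 1 ∧ SFinite ℓ.2 := by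
    intro ℓ hℓ
    obtain ⟨i, -, rfl⟩ := List.mem_map.1 hℓ
    exact ⟨div_pos (hn _) (hn _), (div_le_one (hn _)).2 (hnm i.le_succ), inferInstance⟩
  have hae : ∀ᵐ s ∂π, ∀ k, |overlap (s k).1 (s k).2 - u| < α := by
    rw [ae_all_iff]
    intro k
    exact (measurePreserving_eval (fun _ : K => ρ) k).quasiMeasurePreserving.ae
      (p := fun p => |overlap p.1 p.2 - u| < α) ae_mem_overlapSet
  have h1 : ∀ᵐ s ∂π, ENNReal.ofReal (Real.exp (n 0 * (A + (g s - N * κ)))) ≤ recE (G s) L 0 := by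
    filter_upwards [hae] with s hs
    have := guerra_pairs s hX hN0 hp hq hq01 hq0 hv ht hη hqT hn hnm hnT (hwpos s)
      (fun k => hκ _ (overlap_mem _ _) (hs k))
    have e : ∀ ω, ∑ k, w s k * Real.exp (X 0 (s k).1 ω + X 1 (s k).2 ω) =
        empAvg (pairWeight h X u α) (s, ω) := by
      intro ω
      simp only [empAvg, hw, pairWeight, Finset.mul_sum]
      refine Finset.sum_congr rfl fun k _ => ?_
      ring
    simp_rw [e] at this
    exact this
  have hfi : Integrable (fun s => n 0 * (A + (g s - N * κ))) π :=
    ((integrable_const _).add (hgi.sub (integrable_const _))).const_mul _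
  have hint : ∫ s, n 0 * (A + (g s - N * κ)) ∂π = n 0 * (A + (∫ s, g s ∂π - N * κ)) := by
    have hgs : Integrable (fun s => g s - N * κ) π := hgi.sub (integrable_const _)
    rw [integral_const_mul, integral_add (integrable_const _) hgs,
      integral_sub hgi (integrable_const _)]
    simp
  have h2 : ENNReal.ofReal (Real.exp (n 0 * (A + (∫ s, g s ∂π - N * κ)))) ≤
      recE (fun z => ∫⁻ s, G s z ∂π) L 0 := by
    rw [← hint]
    exact (exp_integral_le hfi).trans ((lintegral_mono_ae h1).trans (lintegral_recE_le hGm L hLv 0))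
  have h3 : ∀ z, ∫⁻ s, G s z ∂π ≤ ENNReal.ofReal (Real.exp (n T * ((pairCost b l N +
      N * (|l| * α - l * u)) + ∑ j : Bool × Fin N,
        (z j + fieldCoef h η j.1) ^ 2 / (2 * γ T j.1)))) := by
    intro z
    set F : Config N × Config N → ℝ≥0∞ := fun p => ENNReal.ofReal (pairMass N u α *
      Real.exp (fieldTerm h p) * Real.exp (∑ j, z j * pairCoef η p j)) with hF
    have hFm : Measurable F := by
      refine Measurable.ennreal_ofReal ((((measurable_fieldTerm h).exp).const_mul _).mul
        (Measurable.exp (Finset.measurable_sum _ fun j _ => (measurable_pairCoef η j).const_mul _)))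
    have e1 : ∀ s, G s z = ∑ k, ENNReal.ofReal (Fintype.card K : ℝ)⁻¹ * F (s k) := by
      intro s
      simp only [hG, hF, hw]
      rw [ENNReal.ofReal_sum_of_nonneg fun k _ => by positivity]
      refine Finset.sum_congr rfl fun k _ => ?_
      rw [← ENNReal.ofReal_mul (by positivity)]
      congr 1; ring
    -- The empirical mean is unbiased, so the sample size disappears here.
    have e2 : ∫⁻ s, G s z ∂π = ∫⁻ p, F p ∂ρ := by
      simp_rw [e1]
      have hFk : ∀ k : K, Measurable fun s : K → Config N × Config N =>
          ENNReal.ofReal (Fintype.card K : ℝ)⁻¹ * F (s k) := fun k =>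
        (hFm.comp (measurable_pi_apply k)).const_mul _
      rw [lintegral_finsetSum _ fun k _ => hFk k]
      have : ∀ k : K, ∫⁻ s : K → Config N × Config N,
          ENNReal.ofReal (Fintype.card K : ℝ)⁻¹ * F (s k) ∂π =
          ENNReal.ofReal (Fintype.card K : ℝ)⁻¹ * ∫⁻ p, F p ∂ρ := by
        intro k
        have hk : Measurable fun s : K → Config N × Config N => F (s k) :=
          hFm.comp (measurable_pi_apply k)
        rw [lintegral_const_mul _ hk]
        congr 1
        exact (measurePreserving_eval (fun _ : K => ρ) k).lintegral_comp hFm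
      rw [Finset.sum_congr rfl fun k _ => this k, Finset.sum_const, Finset.card_univ,
        nsmul_eq_mul, ← mul_assoc, ENNReal.ofReal_inv_of_pos hM, ENNReal.ofReal_natCast,
        ENNReal.mul_inv_cancel (by simp) (ENNReal.natCast_ne_top _), one_mul]
    rw [e2]
    refine (lintegral_pairMeasure_le hlb hN hη hu hα z).trans_eq ?_
    rw [hnT, one_mul]
    congr 4
    ext j
    rw [hγT j.1, pairPrec]
  have h4 := recE_quadratic_le (T := T) (n := n) (a := fun i => levelVar (N := N) ψ t v q i)
    (γ := fun i (j : Bool × Fin N) => γ i j.1) hn (levelVar_nonneg hp.psi_mono hq hq01 hv ht)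
    (fun i hi j => hγ i hi j.1) (fun i hi j => hγa i hi j.1) h3 T 0 (zero_add T) 0
  have h5 := h2.trans h4
  rw [ENNReal.ofReal_le_ofReal_iff (Real.exp_pos _).le, Real.exp_le_exp,
    mul_le_mul_iff_right₀ (hn 0)] at h5
  have e3 : ∀ i, ∑ j : Bool × Fin N, levelVar ψ t v q i j / (2 * γ i j.1) =
      N * ∑ c, cellVar ψ t v q i c / (2 * γ i c) := fun i =>
    sum_bool_prod fun c => cellVar ψ t v q i c / (2 * γ i c)
  have e4 : ∑ j : Bool × Fin N, ((0 : Bool × Fin N → ℝ) j + fieldCoef h η j.1) ^ 2 /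
      (2 * γ 0 j.1) = (N : ℝ) * ∑ c, fieldCoef h η c ^ 2 / (2 * γ 0 c) := by
    rw [← sum_bool_prod fun c => fieldCoef h η c ^ 2 / (2 * γ 0 c)]
    simp
  have e5 : A = N * ∑ i ∈ Finset.range T,
      n i * (inc (theta ξ ψ) q i + t * incMin (theta ξ ψ) v q i) := by
    rw [hA, Finset.mul_sum]
    refine Finset.sum_congr rfl fun i _ => ?_
    ring
  rw [e4, Finset.sum_congr rfl fun i _ => e3 i, ← Finset.mul_sum, ← Finset.range_eq_Ico, e5] at h5
  rw [levelBound]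
  linarith

/-- The bound for the free energy of a system of fixed size. -/
theorem coupledFreeEnergy_le (hX : IsCoupledPair P ξ t N X)
    (hN : 2 ≤ N) (hp : IsProfile ξ ψ) (hq : Monotone q) (hq01 : ∀ i, q i ∈ Icc (0 : ℝ) 1)
    (hq0 : q 0 = 0) (hv : v ∈ Icc (0 : ℝ) 1) (ht : t ∈ Icc (0 : ℝ) 1) (hη : η = 1 ∨ η = -1)
    (hqT : q T = 1) (hn : ∀ i, 0 < n i) (hnm : Monotone n) (hnT : n T = 1)
    (hu : u ∈ Icc (-1 : ℝ) 1) (hα : 0 < α) (hlb : |l| < b)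
    (hκ : ∀ r ∈ Icc (-1 : ℝ) 1, |r - u| < α → slack ξ ψ (η * r) v ≤ κ)
    (hγ : ∀ i ≤ T, ∀ c, 0 < γ i c)
    (hγa : ∀ i < T, ∀ c, γ i c = γ (i + 1) c - n i * cellVar ψ t v q i c)
    (hγT : ∀ c, γ T c = if c then b - η * l else b + η * l) :
    coupledFreeEnergy P h X u α ≤
      (N : ℝ)⁻¹ * pairCost b l N + ((|l| * α - l * u) + levelBound ξ ψ t v h η q n T γ + κ) := by
  have hNpos : (0 : ℝ) < N := by exact_mod_cast (by omega : 0 < N)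
  have hPP := hX.gaussian.isProbabilityMeasure
  have hρ := isProbabilityMeasure_pairMeasure hN hu hα
  have hW := isWeight_pairWeight (h := h) hX hN hu hα
  set Q := pairCost b l N + N * ((|l| * α - l * u) + levelBound ξ ψ t v h η q n T γ + κ) with hQ
  set I₁ := ∫ p, (pairWeight h X u α p)⁻¹ ^ 2 ∂((pairMeasure N u α).prod P)
  set I₂ := ∫ p, pairWeight h X u α p ^ 2 ∂((pairMeasure N u α).prod P)
  set F := ∫ ω, Real.log (avgOver (pairMeasure N u α) (pairWeight h X u α) ω) ∂P with hF
  -- The moments I₁ and I₂ do not depend on the sample size M+1. Letting M → ∞ at fixed κ' removes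
  -- the variance term, and κ' → 0 then removes the other.
  have key : ∀ κ' > 0, ∀ M : ℕ, F ≤ Q + (κ' / 2 * I₁ + ((M : ℝ) + 1)⁻¹ * I₂ / (2 * κ')) := by
    intro κ' hκ' M
    have h1 := hW.integral_log_avgOver_le (K := Fin (M + 1)) hκ'
    have h2 := empirical_le (K := Fin (M + 1)) (h := h) hX hN hp hq hq01 hq0 hv ht hη hqT hn hnm hnT
      hu hα hlb hκ hγ hγa hγT
    rw [Fintype.card_fin] at h1
    push_cast at h1
    linarith
  have key2 : ∀ κ' > 0, F ≤ Q + κ' / 2 * I₁ := by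
    intro κ' hκ'
    have hl : Tendsto (fun M : ℕ => Q + (κ' / 2 * I₁ + ((M : ℝ) + 1)⁻¹ * I₂ / (2 * κ'))) atTop
        (𝓝 (Q + (κ' / 2 * I₁ + 0 * I₂ / (2 * κ')))) := by
      have h0 : Tendsto (fun M : ℕ => ((M : ℝ) + 1)⁻¹) atTop (𝓝 0) := by
        simpa using tendsto_one_div_add_atTop_nhds_zero_nat (𝕜 := ℝ)
      exact ((((h0.mul_const _).div_const _).const_add _).const_add _)
    have := ge_of_tendsto' hl (key κ' hκ')
    simpa using this
  have key3 : F ≤ Q := by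
    have hl : Tendsto (fun κ' : ℝ => Q + κ' / 2 * I₁) (𝓝[>] 0) (𝓝 (Q + 0 / 2 * I₁)) := by
      have : Continuous fun κ' : ℝ => Q + κ' / 2 * I₁ := by fun_prop
      exact (this.tendsto 0).mono_left nhdsWithin_le_nhds
    have := ge_of_tendsto hl (eventually_nhdsWithin_of_forall fun κ' hκ' => key2 κ' hκ')
    simpa using this
  have e : ∫ ω, Real.log (coupledPartition h X u α ω) ∂P = F := by
    rw [hF]
    exact integral_congr_ae (Eventually.of_forall fun ω => by
      simp only [coupledPartition_eq hN hu hα])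
  rw [coupledFreeEnergy, e]
  calc (N : ℝ)⁻¹ * F ≤ (N : ℝ)⁻¹ * Q := by gcongr
    _ = _ := by rw [hQ, mul_add, inv_mul_cancel_left₀ hNpos.ne']

end

end

section

/-! ### The derivatives of the mixture -/

/-- The first derivative `ξ'` of a function `ξ` on `[-1,1]`. -/
def xi1 (ξ : ℝ → ℝ) (s : ℝ) : ℝ := derivWithin ξ (Icc (-1) 1) s

lemma Icc_zero_one_subset : Icc (0 : ℝ) 1 ⊆ Icc (-1) 1 := Icc_subset_Icc_left (by norm_num)

section

variable {ξ : ℝ → ℝ}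

lemma IsMixture.hasDerivWithinAt (hξ : IsMixture ξ) {s : ℝ} (hs : s ∈ Icc (-1 : ℝ) 1) :
    HasDerivWithinAt ξ (xi1 ξ s) (Icc (-1) 1) s :=
  ((hξ.contDiffOn_two.differentiableOn (by norm_num)) s hs).hasDerivWithinAt

lemma IsMixture.hasDerivWithinAt_xi1 (hξ : IsMixture ξ) {s : ℝ} (hs : s ∈ Icc (-1 : ℝ) 1) :
    HasDerivWithinAt (xi1 ξ) (xi2 ξ s) (Icc (-1) 1) s := by
  have hU : UniqueDiffOn ℝ (Icc (-1 : ℝ) 1) := uniqueDiffOn_Icc (by norm_num)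
  have h1 : DifferentiableOn ℝ (iteratedDerivWithin 1 ξ (Icc (-1) 1)) (Icc (-1) 1) :=
    hξ.contDiffOn_two.differentiableOn_iteratedDerivWithin (by norm_num) hU
  have h2 : iteratedDerivWithin 1 ξ (Icc (-1) 1) = xi1 ξ := by
    ext s
    rw [iteratedDerivWithin_one, xi1]
  rw [h2] at h1
  have h3 := (h1 s hs).hasDerivWithinAt
  rwa [← h2, ← iteratedDerivWithin_succ, h2] at h3

lemma IsMixture.continuousOn_xi2 (hξ : IsMixture ξ) : ContinuousOn (xi2 ξ) (Icc 0 1) :=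
  hξ.differentiableOn_xi2.continuousOn.mono Icc_zero_one_subset

lemma IsMixture.continuousOn_xi1 (hξ : IsMixture ξ) : ContinuousOn (xi1 ξ) (Icc 0 1) :=
  fun _ hs => ((hξ.hasDerivWithinAt_xi1 (Icc_zero_one_subset hs)).continuousWithinAt).mono
    Icc_zero_one_subset

lemma IsMixture.continuousOn (hξ : IsMixture ξ) : ContinuousOn ξ (Icc 0 1) :=
  fun _ hs => ((hξ.hasDerivWithinAt (Icc_zero_one_subset hs)).continuousWithinAt).mono
    Icc_zero_one_subset

lemma IsMixture.xi2_nonneg (hξ : IsMixture ξ) {s : ℝ} (hs : s ∈ Icc (0 : ℝ) 1) : 0 ≤ xi2 ξ s := by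
  rcases hs.1.eq_or_lt with rfl | h
  · have h1 : Tendsto (xi2 ξ) (𝓝[Ioc 0 1] 0) (𝓝 (xi2 ξ 0)) :=
      (hξ.continuousOn_xi2 0 hs).mono Ioc_subset_Icc_self
    have : (𝓝[Ioc (0 : ℝ) 1] 0).NeBot := by
      rw [nhdsWithin_Ioc_eq_nhdsGT (by norm_num)]
      infer_instance
    refine ge_of_tendsto h1 ?_
    filter_upwards [self_mem_nhdsWithin] with r hr using (hξ.xi2_pos r hr).le
  · exact (hξ.xi2_pos s ⟨h, hs.2⟩).le

lemma intervalIntegrable_of_mem {f : ℝ → ℝ} (hf : IntervalIntegrable f volume 0 1) {a b : ℝ}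
    (ha : a ∈ Icc (0 : ℝ) 1) (hb : b ∈ Icc (0 : ℝ) 1) : IntervalIntegrable f volume a b :=
  hf.mono_set ((uIcc_subset_uIcc (by rwa [uIcc_of_le zero_le_one])
    (by rwa [uIcc_of_le zero_le_one])))

lemma intervalIntegrable_of_continuousOn {f : ℝ → ℝ} (hf : ContinuousOn f (Icc 0 1)) :
    IntervalIntegrable f volume 0 1 :=
  ContinuousOn.intervalIntegrable (by rwa [uIcc_of_le zero_le_one])

lemma IsMixture.integral_xi2 (hξ : IsMixture ξ) {a b : ℝ} (ha : a ∈ Icc (0 : ℝ) 1)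
    (hb : b ∈ Icc (0 : ℝ) 1) (hab : a ≤ b) : ∫ s in a..b, xi2 ξ s = xi1 ξ b - xi1 ξ a := by
  have hsub : Icc a b ⊆ Icc 0 1 := Icc_subset_Icc ha.1 hb.2
  refine intervalIntegral.integral_eq_sub_of_hasDerivAt_of_le hab (hξ.continuousOn_xi1.mono hsub)
    (fun s hs => ?_)
    (intervalIntegrable_of_mem (intervalIntegrable_of_continuousOn hξ.continuousOn_xi2) ha hb)
  have h0 := ha.1
  have h1 := hb.2
  exact (hξ.hasDerivWithinAt_xi1 (Icc_zero_one_subset (hsub (Ioo_subset_Icc_self hs)))).hasDerivAt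
    (Icc_mem_nhds (by linarith [hs.1]) (by linarith [hs.2]))

lemma IsMixture.integral_mul_xi2 (hξ : IsMixture ξ) {a b : ℝ} (ha : a ∈ Icc (0 : ℝ) 1)
    (hb : b ∈ Icc (0 : ℝ) 1) (hab : a ≤ b) :
    ∫ s in a..b, s * xi2 ξ s = theta ξ (xi1 ξ) b - theta ξ (xi1 ξ) a := by
  have hsub : Icc a b ⊆ Icc 0 1 := Icc_subset_Icc ha.1 hb.2
  refine intervalIntegral.integral_eq_sub_of_hasDerivAt_of_le hab
    (((continuousOn_id.mul hξ.continuousOn_xi1).sub hξ.continuousOn).mono hsub) (fun s hs => ?_)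
    (intervalIntegrable_of_mem (intervalIntegrable_of_continuousOn
      (continuousOn_id.mul hξ.continuousOn_xi2)) ha hb)
  have h0 := ha.1
  have h1 := hb.2
  have hm : Icc (-1 : ℝ) 1 ∈ 𝓝 s := Icc_mem_nhds (by linarith [hs.1]) (by linarith [hs.2])
  have hs' : s ∈ Icc (-1 : ℝ) 1 := Icc_zero_one_subset (hsub (Ioo_subset_Icc_self hs))
  have h2 := ((hasDerivAt_id s).mul ((hξ.hasDerivWithinAt_xi1 hs').hasDerivAt hm)).sub
    ((hξ.hasDerivWithinAt hs').hasDerivAt hm)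
  refine h2.congr_deriv ?_
  simp

/-- Convexity at the midpoint of r and -r, with evenness, makes 0 a minimum of ξ, so ξ'(0) = 0. The
tangent inequality is the slope comparison for convex functions on either side of q. -/
lemma IsMixture.isProfile (hξ : IsMixture ξ) : IsProfile ξ (xi1 ξ) where
  even := hξ.even
  psi_zero := by
    have h0 : HasDerivAt ξ (xi1 ξ 0) 0 := (hξ.hasDerivWithinAt (by norm_num)).hasDerivAt
      (Icc_mem_nhds (by norm_num) (by norm_num))
    have hmin : IsLocalMin ξ 0 := by
      filter_upwards [Icc_mem_nhds (show (-1 : ℝ) < 0 by norm_num) (show (0 : ℝ) < 1 by norm_num)]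
        with r hr
      have h1 := hξ.convexOn.2 hr (show -r ∈ Icc (-1 : ℝ) 1 from ⟨by linarith [hr.2],
        by linarith [hr.1]⟩) (show (0 : ℝ) ≤ 1 / 2 by norm_num) (show (0 : ℝ) ≤ 1 / 2 by norm_num)
        (by norm_num)
      rw [hξ.even r hr] at h1
      simp only [smul_eq_mul] at h1
      rw [show (1 : ℝ) / 2 * r + 1 / 2 * -r = 0 by ring] at h1
      linarith
    exact hmin.hasDerivAt_eq_zero h0
  psi_mono := fun a ha b hb hab => by
    have h1 := hξ.integral_xi2 ha hb hab
    have h2 : 0 ≤ ∫ s in a..b, xi2 ξ s := intervalIntegral.integral_nonneg hab fun s hs =>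
      hξ.xi2_nonneg ⟨ha.1.trans hs.1, hs.2.trans hb.2⟩
    linarith
  tangent := fun q hq r hr => by
    have hq' := Icc_zero_one_subset hq
    rcases lt_trichotomy q r with h | h | h
    · have h1 := hξ.convexOn.le_slope_of_hasDerivWithinAt hq' hr h (hξ.hasDerivWithinAt hq')
      rw [slope_def_field, le_div_iff₀ (by linarith)] at h1
      linarith
    · simp [h]
    · have h1 := hξ.convexOn.slope_le_of_hasDerivWithinAt hr hq' h (hξ.hasDerivWithinAt hq')
      rw [slope_def_field, div_le_iff₀ (by linarith)] at h1
      linarith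

lemma IsProfile.psi_nonneg {ψ : ℝ → ℝ} (hp : IsProfile ξ ψ) {q : ℝ} (hq : q ∈ Icc (0 : ℝ) 1) :
    0 ≤ ψ q := hp.psi_zero ▸ hp.psi_mono ⟨le_rfl, zero_le_one⟩ hq hq.1

/-- The tangent at r evaluated at v bounds the gap by (ψ(r)-ψ(v))(r-v). -/
lemma IsProfile.slack_le_of_nonneg {ψ : ℝ → ℝ} (hp : IsProfile ξ ψ) {r v : ℝ}
    (hr : r ∈ Icc (0 : ℝ) 1) (hv : v ∈ Icc (0 : ℝ) 1) : slack ξ ψ r v ≤ |r - v| * ψ 1 := by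
  have h1 := hp.tangent r hr v (Icc_zero_one_subset hv)
  have h2 : slack ξ ψ r v ≤ (ψ r - ψ v) * (r - v) := by
    rw [slack, theta]
    linarith
  have hm : ∀ q ∈ Icc (0 : ℝ) 1, ψ q ≤ ψ 1 := fun q hq => hp.psi_mono hq ⟨zero_le_one, le_rfl⟩ hq.2
  have h3 : |ψ r - ψ v| ≤ ψ 1 := abs_le.2
    ⟨by linarith [hm v hv, hp.psi_nonneg hr], by linarith [hm r hr, hp.psi_nonneg hv]⟩
  calc _ ≤ |(ψ r - ψ v) * (r - v)| := h2.trans (le_abs_self _)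
    _ = |r - v| * |ψ r - ψ v| := by rw [abs_mul, mul_comm]
    _ ≤ _ := by gcongr

/-- When r is negative, reflecting it to -r costs 2|r|ψ(v). In that case |r| ≤ α because v ≥ 0,
which explains the constant 3 = 1 + 2. -/
lemma IsProfile.slack_le {ψ : ℝ → ℝ} (hp : IsProfile ξ ψ) {r v α : ℝ}
    (hr : r ∈ Icc (-1 : ℝ) 1) (hv : v ∈ Icc (0 : ℝ) 1) (hα : |r - v| ≤ α) :
    slack ξ ψ r v ≤ 3 * α * ψ 1 := by
  have h1 : 0 ≤ ψ 1 := hp.psi_nonneg ⟨zero_le_one, le_rfl⟩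
  have h0 : 0 ≤ α := (abs_nonneg _).trans hα
  rcases le_total 0 r with h | h
  · have := hp.slack_le_of_nonneg ⟨h, hr.2⟩ hv
    nlinarith
  · have h2 := hp.slack_le_of_nonneg (r := -r) ⟨by linarith, by linarith [hr.1]⟩ hv
    have h3 : slack ξ ψ r v = slack ξ ψ (-r) v + 2 * (-r) * ψ v := by
      rw [slack, slack, hp.even r hr]
      ring
    have h4 : |-r - v| ≤ α := (abs_le.2 ⟨by linarith [(abs_le.1 hα).1, hv.1],
      by linarith [(abs_le.1 hα).1, hv.1]⟩)
    have h5 : -r ≤ α := by linarith [(abs_le.1 hα).1, hv.1]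
    have h6 : ψ v ≤ ψ 1 := hp.psi_mono hv ⟨zero_le_one, le_rfl⟩ hv.2
    have h7 : (-r) * ψ v ≤ α * ψ 1 := mul_le_mul h5 h6 (hp.psi_nonneg hv) h0
    nlinarith

end

lemma eta_eq (u : ℝ) : eta u = 1 ∨ eta u = -1 := by
  rw [eta]
  split_ifs <;> simp

lemma eta_mul_sub (u r : ℝ) : |eta u * r - (|u|)| = |r - u| := by
  rw [eta]
  split_ifs with h
  · rw [abs_of_nonneg h, one_mul]
  · rw [abs_of_neg (not_le.1 h), ← abs_neg]
    congr 1
    ring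

end

section

/-! ### Partitions and Riemann sums -/

/-- `0 = q_0 ≤ … ≤ q_T = 1` is a partition of mesh at most `μ` that contains `v = q_J`. -/
structure IsPartition (q : ℕ → ℝ) (v μ : ℝ) (J T : ℕ) : Prop where
  mono : Monotone q
  mem : ∀ i, q i ∈ Icc (0 : ℝ) 1
  zero : q 0 = 0
  mid : q J = v
  top : q T = 1
  pos : 0 < J
  le : J ≤ T
  mesh : ∀ i, q (i + 1) - q i ≤ μ

lemma exists_isPartition {v μ : ℝ} (hv : v ∈ Icc (0 : ℝ) 1) (hμ : 0 < μ) :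
    ∃ (q : ℕ → ℝ) (J T : ℕ), IsPartition q v μ J T := by
  obtain ⟨k, hk⟩ := exists_nat_one_div_lt hμ
  set δ : ℝ := 1 / ((k : ℝ) + 1) with hδ
  have hδ0 : 0 < δ := by positivity
  have hδ1 : ((k + 1 : ℕ) : ℝ) * δ = 1 := by
    rw [hδ]
    push_cast
    field_simp
  have hv0 := hv.1
  have hv1 : 0 ≤ 1 - v := by linarith [hv.2]
  have key : ∀ a : ℝ, min (a + δ) 1 - min a 1 ≤ δ ∧ max (a + δ) 0 ≤ max a 0 + δ := fun a => by
    constructor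
    · rcases le_total a 1 with h | h
      · rw [min_eq_left h]
        linarith [min_le_left (a + δ) 1]
      · rw [min_eq_right h]
        linarith [min_le_right (a + δ) 1]
    · exact max_le (by linarith [le_max_left a 0]) (by linarith [le_max_right a 0])
  -- The first k+1 steps divide [0,v] equally, the next k+1 divide [v,1], and the sequence stays at
  -- 1 afterwards. Repeated points are allowed, so J > 0 even when v = 0.
  refine ⟨fun i => v * min (i * δ) 1 + (1 - v) * min (max (i * δ - 1) 0) 1, k + 1,
    2 * (k + 1), ⟨fun i j hij => ?_, fun i => ⟨?_, ?_⟩, ?_, ?_, ?_, k.succ_pos, by omega,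
      fun i => ?_⟩⟩
  · have : (i : ℝ) ≤ j := by exact_mod_cast hij
    gcongr
  · positivity
  · nlinarith [min_le_right (i * δ) 1, min_le_right (max (i * δ - 1) 0) 1]
  · simp
  · rw [hδ1]
    simp
  · rw [show ((2 * (k + 1) : ℕ) : ℝ) * δ = 2 by
      rw [Nat.cast_mul, mul_assoc, hδ1]
      norm_num]
    norm_num
  · have h1 := (key (i * δ)).1
    have h2 : min (max (((i + 1 : ℕ) : ℝ) * δ - 1) 0) 1 - min (max (i * δ - 1) 0) 1 ≤ δ := by
      have h3 := (key (i * δ - 1)).2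
      have h4 := (key (max (i * δ - 1) 0)).1
      have h5 : ((i + 1 : ℕ) : ℝ) * δ - 1 = i * δ - 1 + δ := by
        push_cast
        ring
      rw [h5]
      linarith [min_le_min_right 1 h3]
    have h6 : ((i + 1 : ℕ) : ℝ) * δ = i * δ + δ := by
      push_cast
      ring
    rw [h6] at h2 ⊢
    nlinarith

section

variable {q : ℕ → ℝ} {v μ : ℝ} {J T : ℕ}

lemma IsPartition.incMin_of_lt (hq : IsPartition q v μ J T) (f : ℝ → ℝ) {i : ℕ} (hi : i < J) :
    incMin f v q i = inc f q i := by
  rw [incMin, inc, min_eq_left (hq.mid ▸ hq.mono hi), min_eq_left (hq.mid ▸ hq.mono hi.le)]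

lemma IsPartition.incMin_of_le (hq : IsPartition q v μ J T) (f : ℝ → ℝ) {i : ℕ} (hi : J ≤ i) :
    incMin f v q i = 0 := by
  rw [incMin, min_eq_right (hq.mid ▸ hq.mono (hi.trans i.le_succ)),
    min_eq_right (hq.mid ▸ hq.mono hi),
    sub_self]

/-- A Stieltjes sum against a function with derivative `w ≥ 0` is bounded by an integral. -/
lemma IsPartition.sum_inc_mul_le (hq : IsPartition q v μ J T) {Ψ w F : ℝ → ℝ} {G : ℕ → ℝ}
    (hΨ : ∀ i, ∫ s in (q i)..(q (i + 1)), w s = inc Ψ q i)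
    (hw : IntervalIntegrable w volume 0 1) (hw0 : ∀ s ∈ Icc (0 : ℝ) 1, 0 ≤ w s)
    (hF : IntervalIntegrable (fun s => w s * F s) volume 0 1) {m n : ℕ} (hmn : m ≤ n)
    (hG : ∀ i ∈ Finset.Ico m n, ∀ s ∈ Icc (q i) (q (i + 1)), G i ≤ F s) :
    ∑ i ∈ Finset.Ico m n, inc Ψ q i * G i ≤ ∫ s in (q m)..(q n), w s * F s := by
  rw [← intervalIntegral.sum_integral_adjacent_intervals_Ico hmn fun k _ =>
    intervalIntegrable_of_mem hF (hq.mem k) (hq.mem (k + 1))]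
  refine Finset.sum_le_sum fun i hi => ?_
  rw [← hΨ, ← intervalIntegral.integral_mul_const]
  refine intervalIntegral.integral_mono_on (hq.mono i.le_succ)
    ((intervalIntegrable_of_mem hw (hq.mem _) (hq.mem _)).mul_const _)
    (intervalIntegrable_of_mem hF (hq.mem _) (hq.mem _)) fun s hs => ?_
  exact mul_le_mul_of_nonneg_left (hG i hi s hs)
    (hw0 s ⟨(hq.mem i).1.trans hs.1, hs.2.trans (hq.mem _).2⟩)

end

/-! ### The distribution function and its integrals -/

section

variable {ξ x : ℝ → ℝ}

lemma IsDistributionFunction.mem_Icc (hx : IsDistributionFunction x) {s : ℝ}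
    (hs : s ∈ Icc (0 : ℝ) 1) : x s ∈ Icc (0 : ℝ) 1 :=
  ⟨hx.zero_le.trans (hx.monotoneOn ⟨le_rfl, zero_le_one⟩ hs hs.1),
    hx.at_one ▸ hx.monotoneOn hs ⟨zero_le_one, le_rfl⟩ hs.2⟩

lemma IsDistributionFunction.intervalIntegrable_mul (hx : IsDistributionFunction x) {f : ℝ → ℝ}
    (hf : ContinuousOn f (Icc 0 1)) : IntervalIntegrable (fun s => f s * x s) volume 0 1 := by
  have h1 : IntervalIntegrable x volume 0 1 :=
    MonotoneOn.intervalIntegrable (by rw [uIcc_of_le zero_le_one]; exact hx.monotoneOn)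
  exact h1.continuousOn_mul (by rwa [uIcc_of_le zero_le_one])

lemma IsMixture.integrable_xi2_mul (hξ : IsMixture ξ) (hx : IsDistributionFunction x) :
    IntervalIntegrable (fun s => xi2 ξ s * x s) volume 0 1 :=
  hx.intervalIntegrable_mul hξ.continuousOn_xi2

lemma dFun_one : dFun ξ x 1 = 0 := intervalIntegral.integral_same

lemma IsMixture.dFun_eq_add (hξ : IsMixture ξ) (hx : IsDistributionFunction x) {a b : ℝ}
    (ha : a ∈ Icc (0 : ℝ) 1) (hb : b ∈ Icc (0 : ℝ) 1) :
    dFun ξ x a = (∫ s in a..b, xi2 ξ s * x s) + dFun ξ x b :=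
  (intervalIntegral.integral_add_adjacent_intervals
    (intervalIntegrable_of_mem (hξ.integrable_xi2_mul hx) ha hb)
    (intervalIntegrable_of_mem (hξ.integrable_xi2_mul hx) hb ⟨zero_le_one, le_rfl⟩)).symm

lemma IsMixture.dFun_anti (hξ : IsMixture ξ) (hx : IsDistributionFunction x) :
    AntitoneOn (dFun ξ x) (Icc 0 1) := fun a ha b hb hab => by
  rw [hξ.dFun_eq_add hx ha hb]
  have : 0 ≤ ∫ s in a..b, xi2 ξ s * x s := intervalIntegral.integral_nonneg hab fun s hs =>
    have hs' : s ∈ Icc (0 : ℝ) 1 := ⟨ha.1.trans hs.1, hs.2.trans hb.2⟩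
    mul_nonneg (hξ.xi2_nonneg hs') (hx.mem_Icc hs').1
  linarith

lemma IsMixture.continuousOn_dFun (hξ : IsMixture ξ) (hx : IsDistributionFunction x) :
    ContinuousOn (dFun ξ x) (Icc 0 1) := by
  have h := intervalIntegral.continuousOn_primitive_interval_left (a := (0 : ℝ)) (b := 1)
    (f := fun s => xi2 ξ s * x s) (μ := volume)
    (by
      rw [uIcc_of_le zero_le_one]
      exact (intervalIntegrable_iff_integrableOn_Icc_of_le zero_le_one).1
        (hξ.integrable_xi2_mul hx))
  rwa [uIcc_of_le zero_le_one] at h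

lemma IsMixture.exists_bound (hξ : IsMixture ξ) : ∃ W : ℝ, 0 ≤ W ∧
    ∀ s ∈ Icc (0 : ℝ) 1, xi2 ξ s ≤ W := by
  obtain ⟨W, hW⟩ := isCompact_Icc.exists_bound_of_continuousOn hξ.continuousOn_xi2
  exact ⟨W, (norm_nonneg _).trans (hW 0 ⟨le_rfl, zero_le_one⟩), fun s hs =>
    (le_abs_self _).trans (hW s hs)⟩

lemma IsMixture.dFun_le_add (hξ : IsMixture ξ) (hx : IsDistributionFunction x) {W a b : ℝ}
    (hW : ∀ s ∈ Icc (0 : ℝ) 1, xi2 ξ s ≤ W) (ha : a ∈ Icc (0 : ℝ) 1) (hb : b ∈ Icc (0 : ℝ) 1)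
    (hab : a ≤ b) : dFun ξ x a ≤ dFun ξ x b + W * (b - a) := by
  rw [hξ.dFun_eq_add hx ha hb]
  have : ∫ s in a..b, xi2 ξ s * x s ≤ ∫ _ in a..b, W := by
    refine intervalIntegral.integral_mono_on hab
      (intervalIntegrable_of_mem (hξ.integrable_xi2_mul hx) ha hb) (by simp) fun s hs => ?_
    have hs' : s ∈ Icc (0 : ℝ) 1 := ⟨ha.1.trans hs.1, hs.2.trans hb.2⟩
    exact (mul_le_of_le_one_right (hξ.xi2_nonneg hs') (hx.mem_Icc hs').2).trans (hW s hs')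
  rw [intervalIntegral.integral_const, smul_eq_mul] at this
  linarith

end

/-! ### The discretized order parameter -/

/-- The discretization of the distribution function `x`, bounded below by `ε`. -/
def stepFun (x : ℝ → ℝ) (ε : ℝ) (q : ℕ → ℝ) (i : ℕ) : ℝ := max (x (q (i + 1))) ε

/-- The discretization of `d`. -/
def stepSum (ξ x : ℝ → ℝ) (ε : ℝ) (q : ℕ → ℝ) (T i : ℕ) : ℝ :=
  ∑ k ∈ Finset.Ico i T, stepFun x ε q k * inc (xi1 ξ) q k

section

variable {ξ x : ℝ → ℝ} {q : ℕ → ℝ} {v μ ε W : ℝ} {J T : ℕ}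

lemma stepSum_eq_add {i : ℕ} (hi : i < T) : stepSum ξ x ε q T i =
    stepFun x ε q i * inc (xi1 ξ) q i + stepSum ξ x ε q T (i + 1) :=
  Finset.sum_eq_sum_Ico_succ_bot hi _

lemma IsPartition.inc_le (hq : IsPartition q v μ J T) (hξ : IsMixture ξ)
    (hW : ∀ s ∈ Icc (0 : ℝ) 1, xi2 ξ s ≤ W) (i : ℕ) :
    inc (xi1 ξ) q i ≤ W * (q (i + 1) - q i) := by
  rw [inc, ← hξ.integral_xi2 (hq.mem i) (hq.mem (i + 1)) (hq.mono i.le_succ)]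
  have : ∫ s in (q i)..(q (i + 1)), xi2 ξ s ≤ ∫ _ in (q i)..(q (i + 1)), W := by
    refine intervalIntegral.integral_mono_on (hq.mono i.le_succ)
      (intervalIntegrable_of_mem (intervalIntegrable_of_continuousOn hξ.continuousOn_xi2)
        (hq.mem _) (hq.mem _)) (by simp) fun s hs => ?_
    exact hW s ⟨(hq.mem i).1.trans hs.1, hs.2.trans (hq.mem _).2⟩
  rw [intervalIntegral.integral_const, smul_eq_mul] at this
  linarith

/-- Backward induction over the cells. Taking x at the right end overestimates a cell by at most
Wμ(x(q_{i+1})-x(q_i)); these errors telescope because x is monotone, so its jumps do no harm. The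
floor ε contributes at most εW per unit length. -/
lemma IsPartition.stepSum_le (hq : IsPartition q v μ J T) (hξ : IsMixture ξ)
    (hx : IsDistributionFunction x) (hε : 0 ≤ ε) (hW0 : 0 ≤ W)
    (hW : ∀ s ∈ Icc (0 : ℝ) 1, xi2 ξ s ≤ W) {i : ℕ} (hi : i ≤ T) :
    stepSum ξ x ε q T i ≤
      dFun ξ x (q i) + W * μ * (1 - x (q i)) + ε * W * (1 - q i) := by
  induction hi using Nat.decreasingInduction with
  | self =>
    rw [hq.top, dFun_one, hx.at_one, stepSum]
    simp
  | of_succ i hi ih =>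
    rw [stepSum_eq_add hi, hξ.dFun_eq_add hx (hq.mem i) (hq.mem (i + 1))]
    have hm := hq.mono i.le_succ
    have h0 : 0 ≤ inc (xi1 ξ) q i := inc_nonneg hξ.isProfile.psi_mono hq.mono hq.mem i
    have h1 := hq.inc_le hξ hW i
    have h2 : inc (xi1 ξ) q i ≤ W * μ := h1.trans (mul_le_mul_of_nonneg_left (hq.mesh i) hW0)
    have hxm : x (q i) ≤ x (q (i + 1)) := hx.monotoneOn (hq.mem _) (hq.mem _) hm
    have h3 : stepFun x ε q i ≤ x (q (i + 1)) + ε :=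
      max_le (by linarith) (by linarith [(hx.mem_Icc (hq.mem (i + 1))).1])
    have h4 : inc (xi1 ξ) q i * x (q i) ≤ ∫ s in (q i)..(q (i + 1)), xi2 ξ s * x s := by
      rw [inc, ← hξ.integral_xi2 (hq.mem i) (hq.mem (i + 1)) hm,
        ← intervalIntegral.integral_mul_const]
      refine intervalIntegral.integral_mono_on hm
        ((intervalIntegrable_of_mem (intervalIntegrable_of_continuousOn hξ.continuousOn_xi2)
        (hq.mem _) (hq.mem _)).mul_const _)
        (intervalIntegrable_of_mem (hξ.integrable_xi2_mul hx) (hq.mem _) (hq.mem _)) fun s hs => ?_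
      have hs' : s ∈ Icc (0 : ℝ) 1 := ⟨(hq.mem i).1.trans hs.1, hs.2.trans (hq.mem _).2⟩
      exact mul_le_mul_of_nonneg_left (hx.monotoneOn (hq.mem i) hs' hs.1) (hξ.xi2_nonneg hs')
    have h5 : stepFun x ε q i * inc (xi1 ξ) q i ≤ (x (q (i + 1)) + ε) * inc (xi1 ξ) q i := by
      gcongr
    have h6 : (x (q (i + 1)) - x (q i)) * inc (xi1 ξ) q i ≤
        (x (q (i + 1)) - x (q i)) * (W * μ) := mul_le_mul_of_nonneg_left h2 (by linarith)
    have h7 : ε * inc (xi1 ξ) q i ≤ ε * (W * (q (i + 1) - q i)) := by gcongr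
    nlinarith

lemma IsPartition.stepSum_le_dFun (hq : IsPartition q v μ J T) (hξ : IsMixture ξ)
    (hx : IsDistributionFunction x) (hε : 0 ≤ ε) (hμ : 0 ≤ μ) (hW0 : 0 ≤ W)
    (hW : ∀ s ∈ Icc (0 : ℝ) 1, xi2 ξ s ≤ W) {i : ℕ} (hi : i ≤ T) {s : ℝ}
    (hs : s ∈ Icc (q i) (q (i + 1))) :
    stepSum ξ x ε q T i ≤ dFun ξ x s + W * (2 * μ + ε) := by
  have hs' : s ∈ Icc (0 : ℝ) 1 := ⟨(hq.mem i).1.trans hs.1, hs.2.trans (hq.mem _).2⟩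
  have h1 := hq.stepSum_le hξ hx hε hW0 hW hi
  have h2 := hξ.dFun_le_add hx hW (hq.mem i) hs' hs.1
  have h3 : W * (s - q i) ≤ W * μ :=
    mul_le_mul_of_nonneg_left (by linarith [hq.mesh i, hs.2]) hW0
  have h4 : W * μ * (1 - x (q i)) ≤ W * μ :=
    mul_le_of_le_one_right (by positivity) (by linarith [(hx.mem_Icc (hq.mem i)).1])
  have h5 : ε * W * (1 - q i) ≤ ε * W :=
    mul_le_of_le_one_right (by positivity) (by linarith [(hq.mem i).1])
  linarith

end

end

/-! ### Exponents, precisions and Riemann sums of the discretized bound -/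

section

/-- The exponents `n_i` attached to the discretized order parameter. -/
def levelWeight (x : ℝ → ℝ) (ε t : ℝ) (q : ℕ → ℝ) (J i : ℕ) : ℝ :=
  if i < J then stepFun x ε q i / (1 + t) else stepFun x ε q i

/-- The precisions of the two kinds of Gaussian factors at level `i`. -/
def levelPrec (ξ x : ℝ → ℝ) (ε t b c : ℝ) (q : ℕ → ℝ) (J T i : ℕ) (k : Bool) : ℝ :=
  if k then b - c - stepSum ξ x ε q T i
  else b + c - if J ≤ i then stepSum ξ x ε q T i else
    stepSum ξ x ε q T J + (1 - t) / (1 + t) * (stepSum ξ x ε q T i - stepSum ξ x ε q T J)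

/-- As e ≤ g/2, both y and y-e are at least g/2, and y is at least g, so the error of inversion is
linear in e. -/
lemma inv_le_inv_add {g e y γ : ℝ} (hg : 0 < g) (he : 0 ≤ e) (heg : e ≤ g / 2) (hy : g ≤ y)
    (hγ : y - e ≤ γ) : γ⁻¹ ≤ y⁻¹ + 2 * e / g ^ 2 := by
  have h1 : 0 < y - e := by linarith
  have h2 : 0 < y := by linarith
  have h3 : γ⁻¹ ≤ (y - e)⁻¹ := inv_anti₀ h1 hγ
  have h4 : (y - e)⁻¹ = y⁻¹ + e / (y * (y - e)) := by
    field_simp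
    ring
  have h5 : e / (y * (y - e)) ≤ e / (g * (g / 2)) := by
    have h6 : g / 2 ≤ y - e := by linarith
    gcongr
  have h6 : e / (g * (g / 2)) = 2 * e / g ^ 2 := by
    field_simp
  linarith

section

variable {ξ x : ℝ → ℝ} {q : ℕ → ℝ} {v μ ε t b c g e : ℝ} {J T : ℕ}

lemma stepFun_pos (hε : 0 < ε) (i : ℕ) : 0 < stepFun x ε q i := lt_max_of_lt_right hε

lemma levelWeight_pos (hε : 0 < ε) (ht : 0 ≤ t) (i : ℕ) : 0 < levelWeight x ε t q J i := by
  have := stepFun_pos (x := x) (q := q) hε i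
  rw [levelWeight]
  split_ifs <;> positivity

lemma IsPartition.stepFun_mono (hq : IsPartition q v μ J T) (hx : IsDistributionFunction x) :
    Monotone (stepFun x ε q) := fun i j hij =>
  max_le_max_right _ (hx.monotoneOn (hq.mem _) (hq.mem _) (hq.mono (by omega)))

lemma IsPartition.levelWeight_mono (hq : IsPartition q v μ J T) (hx : IsDistributionFunction x)
    (hε : 0 < ε) (ht : 0 ≤ t) : Monotone (levelWeight x ε t q J) := fun i j hij => by
  have h1 := hq.stepFun_mono hx (ε := ε) hij
  have h2 := stepFun_pos (x := x) (q := q) hε i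
  simp only [levelWeight]
  split_ifs
  · gcongr
  · exact (div_le_self h2.le (by linarith)).trans h1
  · omega
  · exact h1

lemma IsPartition.levelWeight_top (hq : IsPartition q v μ J T) (hx : IsDistributionFunction x)
    (hε : ε ≤ 1) : levelWeight x ε t q J T = 1 := by
  have h1 : q (T + 1) = 1 := le_antisymm (hq.mem _).2 (hq.top ▸ hq.mono T.le_succ)
  rw [levelWeight, if_neg (not_lt.2 hq.le), stepFun, h1, hx.at_one, max_eq_left hε]

/-- Below v the variances are (1±t) times the increment of ξ', while the exponent carries 1/(1+t).
The first kind of coordinate thus loses exactly a step of the discretized `dFun`, the second the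
fraction (1-t)/(1+t) of it, the slope of `phiFun`. Above v the cross increments vanish and both
kinds behave alike. -/
lemma IsPartition.levelPrec_eq (hq : IsPartition q v μ J T) (ht : 0 ≤ t) {i : ℕ} (hi : i < T)
    (k : Bool) : levelPrec ξ x ε t b c q J T i k = levelPrec ξ x ε t b c q J T (i + 1) k -
      levelWeight x ε t q J i * cellVar (xi1 ξ) t v q i k := by
  have hS := stepSum_eq_add (ξ := ξ) (x := x) (ε := ε) (q := q) hi
  have ht' : 1 + t ≠ 0 := by positivity
  rcases lt_or_ge i J with h | h
  · rw [levelWeight, if_pos h, cellVar, hq.incMin_of_lt _ h]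
    cases k
    · simp only [levelPrec, Bool.false_eq_true, if_false, if_neg (not_le.2 h)]
      -- At i+1 = J the two branches agree, so the lower formula may be used throughout.
      have h1 : (if J ≤ i + 1 then stepSum ξ x ε q T (i + 1) else stepSum ξ x ε q T J +
          (1 - t) / (1 + t) * (stepSum ξ x ε q T (i + 1) - stepSum ξ x ε q T J)) =
          stepSum ξ x ε q T J +
          (1 - t) / (1 + t) * (stepSum ξ x ε q T (i + 1) - stepSum ξ x ε q T J) := by
        split_ifs with h2
        · rw [show i + 1 = J by omega]
          ring
        · rfl
      rw [h1, hS]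
      field_simp
      ring
    · simp only [levelPrec, if_true]
      rw [hS]
      field_simp
      ring
  · rw [levelWeight, if_neg (not_lt.2 h), cellVar, hq.incMin_of_le _ h]
    cases k
    · simp only [levelPrec, Bool.false_eq_true, if_false, if_pos h, if_pos (h.trans i.le_succ)]
      rw [hS]
      ring
    · simp only [levelPrec, if_true]
      rw [hS]
      ring

lemma IsPartition.levelPrec_top (hq : IsPartition q v μ J T) (k : Bool) :
    levelPrec ξ x ε t b c q J T T k = if k then b - c else b + c := by
  cases k <;> simp [levelPrec, stepSum, hq.le]

lemma IsMixture.phiFun_le (hξ : IsMixture ξ) (hx : IsDistributionFunction x) (ht : t ∈ Icc (0 : ℝ) 1)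
    (hv : v ∈ Icc (0 : ℝ) 1) {s : ℝ} (hs : s ∈ Icc (0 : ℝ) 1) :
    phiFun ξ x t v s ≤ dFun ξ x 0 := by
  have h0 : (0 : ℝ) ∈ Icc (0 : ℝ) 1 := ⟨le_rfl, zero_le_one⟩
  have h1 := hξ.dFun_anti hx h0 hv hv.1
  have h2 := hξ.dFun_anti hx h0 hs hs.1
  have h3 : 0 ≤ (1 - t) / (1 + t) := div_nonneg (by linarith [ht.2]) (by linarith [ht.1])
  have h4 : (1 - t) / (1 + t) ≤ 1 := div_le_one_of_le₀ (by linarith [ht.1]) (by linarith [ht.1])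
  rw [phiFun]
  nlinarith

lemma IsPartition.sum_inc_mul_inv_le (hq : IsPartition q v μ J T) (hξ : IsMixture ξ) {y : ℝ → ℝ}
    {γ : ℕ → ℝ} (hy : ContinuousOn y (Icc 0 1)) (hg : 0 < g) (he : 0 ≤ e) (heg : e ≤ g / 2)
    (hgy : ∀ s ∈ Icc (0 : ℝ) 1, g ≤ y s) {m n : ℕ} (hmn : m ≤ n)
    (hγ : ∀ i ∈ Finset.Ico m n, ∀ s ∈ Icc (q i) (q (i + 1)), y s - e ≤ γ i) :
    ∑ i ∈ Finset.Ico m n, inc (xi1 ξ) q i * (γ i)⁻¹ ≤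
      (∫ s in (q m)..(q n), xi2 ξ s / y s) +
        2 * e / g ^ 2 * (xi1 ξ (q n) - xi1 ξ (q m)) := by
  have hw := hξ.continuousOn_xi2
  have hc : ContinuousOn (fun s => (y s)⁻¹) (Icc 0 1) :=
    hy.inv₀ fun s hs => (hg.trans_le (hgy s hs)).ne'
  have h1 := hq.sum_inc_mul_le (Ψ := xi1 ξ) (w := xi2 ξ)
    (F := fun s => (y s)⁻¹ + 2 * e / g ^ 2) (G := fun i => (γ i)⁻¹)
    (fun i => hξ.integral_xi2 (hq.mem _) (hq.mem _) (hq.mono i.le_succ))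
    (intervalIntegrable_of_continuousOn hw) (fun s hs => hξ.xi2_nonneg hs)
    (intervalIntegrable_of_continuousOn (hw.mul (hc.add continuousOn_const))) hmn
    fun i hi s hs => inv_le_inv_add hg he heg
      (hgy s ⟨(hq.mem i).1.trans hs.1, hs.2.trans (hq.mem _).2⟩) (hγ i hi s hs)
  refine h1.trans_eq ?_
  rw [← hξ.integral_xi2 (hq.mem m) (hq.mem n) (hq.mono hmn), ← intervalIntegral.integral_const_mul,
    ← intervalIntegral.integral_add]
  · refine intervalIntegral.integral_congr fun s _ => ?_
    ring
  · exact intervalIntegrable_of_mem (intervalIntegrable_of_continuousOn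
      (hw.div hy fun s hs => (hg.trans_le (hgy s hs)).ne')) (hq.mem _) (hq.mem _)
  · exact (intervalIntegrable_of_mem (intervalIntegrable_of_continuousOn hw)
      (hq.mem _) (hq.mem _)).const_mul _

/-- The step function takes x at the right end of the cell and hence dominates it, so the negative
sign gives an upper bound with no error term. The exponent 1/(1+t) below v cancels the factor 1+t
formed by the two increments of θ. -/
lemma IsPartition.neg_sum_theta_le (hq : IsPartition q v μ J T) (hξ : IsMixture ξ)
    (hx : IsDistributionFunction x) (ht : 0 ≤ t) :
    -∑ i ∈ Finset.range T, levelWeight x ε t q J i *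
        (inc (theta ξ (xi1 ξ)) q i + t * incMin (theta ξ (xi1 ξ)) v q i) ≤
      -∫ s in (0 : ℝ)..1, s * xi2 ξ s * x s := by
  have ht' : 1 + t ≠ 0 := by positivity
  have hc : ContinuousOn (fun s => s * xi2 ξ s) (Icc 0 1) := continuousOn_id.mul hξ.continuousOn_xi2
  have h1 := hq.sum_inc_mul_le (Ψ := theta ξ (xi1 ξ)) (w := fun s => s * xi2 ξ s)
    (F := fun s => -x s) (G := fun i => -stepFun x ε q i) (m := 0) (n := T)
    (fun i => hξ.integral_mul_xi2 (hq.mem _) (hq.mem _) (hq.mono i.le_succ))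
    (intervalIntegrable_of_continuousOn hc) (fun s hs => mul_nonneg hs.1 (hξ.xi2_nonneg hs))
    ((hx.intervalIntegrable_mul hc).neg.congr fun s _ => (mul_neg _ _).symm) T.zero_le
    fun i _ s hs => neg_le_neg ((hx.monotoneOn
      ⟨(hq.mem i).1.trans hs.1, hs.2.trans (hq.mem _).2⟩ (hq.mem _) hs.2).trans (le_max_left _ _))
  simp only [mul_neg, intervalIntegral.integral_neg, hq.zero, hq.top] at h1
  refine le_trans (le_of_eq ?_) h1
  rw [← Finset.sum_neg_distrib, Finset.range_eq_Ico]
  refine Finset.sum_congr rfl fun i _ => ?_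
  rw [levelWeight]
  split_ifs with h
  · rw [hq.incMin_of_lt _ h]
    field_simp
  · rw [hq.incMin_of_le _ (not_lt.1 h)]
    ring

lemma IsPartition.sum_cellVar_div (hq : IsPartition q v μ J T) (ψ : ℝ → ℝ) (γ : ℕ → Bool → ℝ) :
    ∑ i ∈ Finset.range T, ∑ k, cellVar ψ t v q i k / (2 * γ i k) =
      (1 + t) / 2 * (∑ i ∈ Finset.Ico 0 J, inc ψ q i * (γ i true)⁻¹) +
      (1 - t) / 2 * (∑ i ∈ Finset.Ico 0 J, inc ψ q i * (γ i false)⁻¹) +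
      1 / 2 * (∑ i ∈ Finset.Ico J T, inc ψ q i * (γ i true)⁻¹) +
      1 / 2 * (∑ i ∈ Finset.Ico J T, inc ψ q i * (γ i false)⁻¹) := by
  rw [Finset.range_eq_Ico, ← Finset.sum_Ico_consecutive _ J.zero_le hq.le, Finset.mul_sum,
    Finset.mul_sum, Finset.mul_sum, Finset.mul_sum, ← Finset.sum_add_distrib, add_assoc,
    ← Finset.sum_add_distrib]
  congr 1
  · refine Finset.sum_congr rfl fun i hi => ?_
    simp only [Fintype.sum_bool, cellVar, if_true, Bool.false_eq_true, if_false,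
      hq.incMin_of_lt ψ (Finset.mem_Ico.1 hi).2, div_eq_mul_inv, mul_inv]
    ring
  · refine Finset.sum_congr rfl fun i hi => ?_
    simp only [Fintype.sum_bool, cellVar, if_true, Bool.false_eq_true, if_false,
      hq.incMin_of_le ψ (Finset.mem_Ico.1 hi).1, div_eq_mul_inv, mul_inv]
    ring

/-- The field acts along (1,1), which is (1,η) when η = 1 and (1,-η) when η = -1. Only one kind of
coordinate feels it, and this produces the two cases of `PFun`. -/
lemma sum_fieldCoef_sq_div {h η : ℝ} (hη : η = 1 ∨ η = -1) (γ : Bool → ℝ) :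
    ∑ k, fieldCoef h η k ^ 2 / (2 * γ k) =
      h ^ 2 * (γ (if η = 1 then true else false))⁻¹ := by
  have h2 : (√(2 : ℝ))⁻¹ ^ 2 = 1 / 2 := by
    rw [inv_pow, Real.sq_sqrt (by norm_num)]
    norm_num
  rcases hη with rfl | rfl
  · simp only [Fintype.sum_bool, fieldCoef, if_true, Bool.false_eq_true, if_false, div_eq_mul_inv,
      mul_inv]
    linear_combination (2 * h ^ 2 * (γ true)⁻¹) * h2
  · simp only [Fintype.sum_bool, fieldCoef, if_true, Bool.false_eq_true, if_false, div_eq_mul_inv,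
      mul_inv, show ¬ (-1 : ℝ) = 1 by norm_num]
    linear_combination (2 * h ^ 2 * (γ false)⁻¹) * h2

end

end

/-! ### Convergence of the discretized bound -/

section

section

variable {ξ x : ℝ → ℝ} {q : ℕ → ℝ} {v μ ε t b c g e W : ℝ} {J T : ℕ}

lemma IsPartition.le_levelPrec_true (hq : IsPartition q v μ J T) (hξ : IsMixture ξ)
    (hx : IsDistributionFunction x) (hε : 0 ≤ ε) (hμ : 0 ≤ μ) (hW0 : 0 ≤ W)
    (hW : ∀ s ∈ Icc (0 : ℝ) 1, xi2 ξ s ≤ W) {i : ℕ} (hi : i ≤ T) {s : ℝ}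
    (hs : s ∈ Icc (q i) (q (i + 1))) :
    b - c - dFun ξ x s - W * (2 * μ + ε) ≤ levelPrec ξ x ε t b c q J T i true := by
  have h1 := hq.stepSum_le_dFun hξ hx hε hμ hW0 hW hi hs
  simp only [levelPrec, if_true]
  linarith

lemma IsPartition.le_levelPrec_false (hq : IsPartition q v μ J T) (hξ : IsMixture ξ)
    (hx : IsDistributionFunction x) (hε : 0 ≤ ε) (hμ : 0 ≤ μ) (hW0 : 0 ≤ W)
    (hW : ∀ s ∈ Icc (0 : ℝ) 1, xi2 ξ s ≤ W) {i : ℕ} (hi : i ≤ T) (hJi : J ≤ i) {s : ℝ}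
    (hs : s ∈ Icc (q i) (q (i + 1))) :
    b + c - dFun ξ x s - W * (2 * μ + ε) ≤ levelPrec ξ x ε t b c q J T i false := by
  have h1 := hq.stepSum_le_dFun hξ hx hε hμ hW0 hW hi hs
  simp only [levelPrec, Bool.false_eq_true, if_false, if_pos hJi]
  linarith

/-- `phiFun` is a convex combination of `dFun` at s and at v, so its discretization error is no
larger than that of `dFun`. -/
lemma IsPartition.le_levelPrec_false_of_lt (hq : IsPartition q v μ J T) (hξ : IsMixture ξ)
    (hx : IsDistributionFunction x) (hε : 0 ≤ ε) (hμ : 0 ≤ μ) (hW0 : 0 ≤ W)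
    (hW : ∀ s ∈ Icc (0 : ℝ) 1, xi2 ξ s ≤ W) (ht : t ∈ Icc (0 : ℝ) 1) {i : ℕ} (hi : i < J) {s : ℝ}
    (hs : s ∈ Icc (q i) (q (i + 1))) :
    b + c - phiFun ξ x t v s - W * (2 * μ + ε) ≤ levelPrec ξ x ε t b c q J T i false := by
  have h1 := hq.stepSum_le_dFun hξ hx hε hμ hW0 hW (hi.le.trans hq.le) hs
  have h2 := hq.stepSum_le_dFun hξ hx hε hμ hW0 hW hq.le
    (left_mem_Icc.2 (hq.mono J.le_succ))
  rw [hq.mid] at h2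
  have h3 : 0 ≤ (1 - t) / (1 + t) := div_nonneg (by linarith [ht.2]) (by linarith [ht.1])
  have h4 : (1 - t) / (1 + t) ≤ 1 := div_le_one_of_le₀ (by linarith [ht.1]) (by linarith [ht.1])
  simp only [levelPrec, Bool.false_eq_true, if_false, if_neg (not_le.2 hi), phiFun]
  have h5 := mul_le_mul_of_nonneg_left h1 h3
  have h6 := mul_le_mul_of_nonneg_left h2 (sub_nonneg.2 h4)
  linarith

/-- All denominators of `PFun` are at least g = b - |l| - d(0) > 0. A fine partition keeps every
precision within e of its continuous counterpart from below, so the sums exceed the integrals by at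
most a multiple of e/g². -/
theorem exists_levelBound_le (hξ : IsMixture ξ) (hx : IsDistributionFunction x)
    (ht : t ∈ Icc (0 : ℝ) 1) (h : ℝ) {l u δ : ℝ} (hb : dFun ξ x 0 + |l| < b)
    (hu : u ∈ Icc (-1 : ℝ) 1) (hδ : 0 < δ) :
    ∃ (q n : ℕ → ℝ) (T : ℕ) (γ : ℕ → Bool → ℝ), Monotone q ∧ (∀ i, q i ∈ Icc (0 : ℝ) 1) ∧
      q 0 = 0 ∧ q T = 1 ∧ (∀ i, 0 < n i) ∧ Monotone n ∧ n T = 1 ∧ (∀ i ≤ T, ∀ k, 0 < γ i k) ∧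
      (∀ i < T, ∀ k, γ i k = γ (i + 1) k - n i * cellVar (xi1 ξ) t |u| q i k) ∧
      (∀ k : Bool, γ T k = if k then b - eta u * l else b + eta u * l) ∧
      levelBound ξ (xi1 ξ) t |u| h (eta u) q n T γ ≤
        PFun ξ x t h u b l - (Real.log √(b ^ 2 / (b ^ 2 - l ^ 2)) - l * u + b - 1 - Real.log b) +
          δ := by
  obtain ⟨W, hW0, hW⟩ := hξ.exists_bound
  have h01 : (1 : ℝ) ∈ Icc (0 : ℝ) 1 := ⟨zero_le_one, le_rfl⟩
  have hv : |u| ∈ Icc (0 : ℝ) 1 := ⟨abs_nonneg u, abs_le.2 hu⟩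
  have hψ1 := hξ.isProfile.psi_nonneg h01
  set g := b - |l| - dFun ξ x 0 with hgdef
  have hg : 0 < g := by linarith
  -- The first entry keeps the precisions away from 0; the second makes the total error 2e/g²
  -- (ξ'(1)+h²) at most δ, the added 1 ensuring a positive denominator. The same μ serves as mesh
  -- and as lower bound for the step function, whence e = W(2μ+μ).
  set e₀ := min (g / 2) (δ * g ^ 2 / (2 * (xi1 ξ 1 + h ^ 2 + 1))) with he₀
  have he₀' : 0 < e₀ := lt_min (by positivity) (by positivity)
  set μ := min 1 (e₀ / (3 * W + 1)) with hμdef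
  have hμ : 0 < μ := lt_min one_pos (by positivity)
  have hμ1 : μ ≤ 1 := min_le_left _ _
  set e := W * (2 * μ + μ) with hedef
  have he : 0 ≤ e := by positivity
  have hee : e ≤ e₀ := by
    have h1 : μ * (3 * W + 1) ≤ e₀ := by
      rw [← le_div_iff₀ (by positivity)]
      exact min_le_right _ _
    nlinarith
  have heg : e ≤ g / 2 := hee.trans (min_le_left _ _)
  have heδ : 2 * e / g ^ 2 * (xi1 ξ 1 + h ^ 2) ≤ δ := by
    have h1 : e * (2 * (xi1 ξ 1 + h ^ 2 + 1)) ≤ δ * g ^ 2 := by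
      rw [← le_div_iff₀ (by positivity)]
      exact hee.trans (min_le_right _ _)
    rw [div_mul_eq_mul_div, div_le_iff₀ (by positivity)]
    nlinarith
  obtain ⟨q, J, T, hq⟩ := exists_isPartition hv hμ
  have hc : |eta u * l| = |l| := by rcases eta_eq u with h1 | h1 <;> simp [h1]
  set c := eta u * l with hcdef
  have hc1 : c ≤ |l| := hc ▸ le_abs_self c
  have hc2 : -c ≤ |l| := hc ▸ neg_le_abs c
  have hd : ∀ s ∈ Icc (0 : ℝ) 1, dFun ξ x s ≤ dFun ξ x 0 := fun s hs =>
    hξ.dFun_anti hx ⟨le_rfl, zero_le_one⟩ hs hs.1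
  have hφ : ∀ s ∈ Icc (0 : ℝ) 1, phiFun ξ x t |u| s ≤ dFun ξ x 0 := fun s hs =>
    hξ.phiFun_le hx ht hv hs
  have hdc := hξ.continuousOn_dFun hx
  have hφc : ContinuousOn (phiFun ξ x t |u|) (Icc 0 1) :=
    continuousOn_const.add (continuousOn_const.mul (hdc.sub continuousOn_const))
  set γ := levelPrec ξ x μ t b c q J T with hγdef
  have ht1 : ∀ i ≤ T, ∀ s ∈ Icc (q i) (q (i + 1)), b - c - dFun ξ x s - e ≤ γ i true :=
    fun i hi s hs => hq.le_levelPrec_true hξ hx hμ.le hμ.le hW0 hW hi hs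
  have hf1 : ∀ i ≤ T, J ≤ i → ∀ s ∈ Icc (q i) (q (i + 1)), b + c - dFun ξ x s - e ≤ γ i false :=
    fun i hi hJi s hs => hq.le_levelPrec_false hξ hx hμ.le hμ.le hW0 hW hi hJi hs
  have hf2 : ∀ i < J, ∀ s ∈ Icc (q i) (q (i + 1)),
      b + c - phiFun ξ x t |u| s - e ≤ γ i false :=
    fun i hi s hs => hq.le_levelPrec_false_of_lt hξ hx hμ.le hμ.le hW0 hW ht hi hs
  have hl : ∀ i, q i ∈ Icc (q i) (q (i + 1)) := fun i => left_mem_Icc.2 (hq.mono i.le_succ)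
  refine ⟨q, levelWeight x μ t q J, T, γ, hq.mono, hq.mem, hq.zero, hq.top,
    fun i => levelWeight_pos hμ ht.1 i, hq.levelWeight_mono hx hμ ht.1,
    hq.levelWeight_top hx hμ1, fun i hi k => ?_, fun i hi k => hq.levelPrec_eq ht.1 hi k,
    fun k => hq.levelPrec_top k, ?_⟩
  · cases k
    · rcases lt_or_ge i J with h1 | h1
      · linarith [hf2 i h1 _ (hl i), hφ _ (hq.mem i)]
      · linarith [hf1 i hi h1 _ (hl i), hd _ (hq.mem i)]
    · linarith [ht1 i hi _ (hl i), hd _ (hq.mem i)]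
  have k1 := hq.sum_inc_mul_inv_le hξ (y := fun s => b - c - dFun ξ x s) (γ := fun i => γ i true)
    (continuousOn_const.sub hdc) hg he heg (fun s hs => by linarith [hd s hs]) J.zero_le
    fun i hi => ht1 i ((Finset.mem_Ico.1 hi).2.le.trans hq.le)
  have k2 := hq.sum_inc_mul_inv_le hξ (y := fun s => b + c - phiFun ξ x t |u| s)
    (γ := fun i => γ i false)
    (continuousOn_const.sub hφc) hg he heg (fun s hs => by linarith [hφ s hs]) J.zero_le
    fun i hi => hf2 i (Finset.mem_Ico.1 hi).2
  have k3 := hq.sum_inc_mul_inv_le hξ (y := fun s => b - c - dFun ξ x s) (γ := fun i => γ i true)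
    (continuousOn_const.sub hdc) hg he heg (fun s hs => by linarith [hd s hs]) hq.le
    fun i hi => ht1 i (Finset.mem_Ico.1 hi).2.le
  have k4 := hq.sum_inc_mul_inv_le hξ (y := fun s => b + c - dFun ξ x s) (γ := fun i => γ i false)
    (continuousOn_const.sub hdc) hg he heg (fun s hs => by linarith [hd s hs]) hq.le
    fun i hi => hf1 i (Finset.mem_Ico.1 hi).2.le (Finset.mem_Ico.1 hi).1
  have k5 := hq.neg_sum_theta_le hξ hx (ε := μ) ht.1
  rw [hq.zero, hq.mid, hξ.isProfile.psi_zero] at k1 k2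
  rw [hq.top, hq.mid] at k3 k4
  -- The weights (1±t)/2 on [0,|u|], and 1/2 twice on [|u|,1], each add up to 1, so the four errors
  -- together involve only ξ'(1).
  have k1' := mul_le_mul_of_nonneg_left k1 (show 0 ≤ (1 + t) / 2 by linarith [ht.1])
  have k2' := mul_le_mul_of_nonneg_left k2 (show 0 ≤ (1 - t) / 2 by linarith [ht.2])
  have m0 : (0 : ℝ) ∈ Icc (q 0) (q (0 + 1)) := hq.zero ▸ hl 0
  have m1 : (0 : ℝ) ∈ Icc (0 : ℝ) 1 := ⟨le_rfl, zero_le_one⟩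
  rw [levelBound, hq.sum_cellVar_div, sum_fieldCoef_sq_div (eta_eq u)]
  rcases le_or_gt 0 u with hu0 | hu0
  · have hη : eta u = 1 := if_pos hu0
    have hc' : c = l := by rw [hcdef, hη, one_mul]
    have k6 := inv_le_inv_add hg he heg
      (show g ≤ b - c - dFun ξ x 0 by linarith) (ht1 0 T.zero_le 0 m0)
    have k6' := mul_le_mul_of_nonneg_left k6 (sq_nonneg h)
    rw [PFun, if_pos hu0, TFun, if_pos hη, ← hcdef, div_eq_mul_inv (h ^ 2)]
    rw [hc'] at k1' k2' k3 k4 k6' ⊢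
    linarith
  · have hη : eta u = -1 := if_neg (not_le.2 hu0)
    have hc' : c = -l := by rw [hcdef, hη, neg_one_mul]
    have k6 := inv_le_inv_add hg he heg
      (show g ≤ b + c - phiFun ξ x t |u| 0 by linarith [hφ 0 m1]) (hf2 0 hq.pos 0 m0)
    have k6' := mul_le_mul_of_nonneg_left k6 (sq_nonneg h)
    rw [PFun, if_neg (not_le.2 hu0), TFun, if_neg (by rw [hη]; norm_num), ← hcdef,
      div_eq_mul_inv (h ^ 2)]
    simp only [hc', sub_neg_eq_add, ← sub_eq_add_neg] at k1' k2' k3 k4 k6' ⊢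
    linarith

end

end

section

/-! ### The limit of large systems -/

/-- The error (|l| + 3ξ'(1) + 1)α collects the relaxation of the overlap constraint, the gap of the
cross overlap, and the discretization, whose tolerance is chosen equal to α. The partition is fixed
before N tends to infinity. -/
theorem limsup_coupledFreeEnergy_le {Ω : ℕ → Type*} [∀ N, MeasurableSpace (Ω N)]
    {P : ∀ N, Measure (Ω N)} {ξ : ℝ → ℝ} (hξ : IsMixture ξ) {t : ℝ} (ht : t ∈ Icc (0 : ℝ) 1)
    (h : ℝ) {X : ∀ N, Fin 2 → Config N → Ω N → ℝ}
    (hX : ∀ N, 1 ≤ N → IsCoupledPair (P N) ξ t N (X N)) {x : ℝ → ℝ}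
    (hx : IsDistributionFunction x) {l b : ℝ} (hb : dFun ξ x 0 + |l| < b) {u : ℝ}
    (hu : u ∈ Icc (-1 : ℝ) 1) {α : ℝ} (hα : 0 < α) :
    limsup (fun N : ℕ => ((coupledFreeEnergy (P N) h (X N) u α : ℝ) : EReal)) atTop ≤
      ((PFun ξ x t h u b l + (|l| + 3 * xi1 ξ 1 + 1) * α : ℝ) : EReal) := by
  have hv : |u| ∈ Icc (0 : ℝ) 1 := ⟨abs_nonneg u, abs_le.2 hu⟩
  have hd0 : 0 ≤ dFun ξ x 0 :=
    dFun_one (ξ := ξ) (x := x) ▸ hξ.dFun_anti hx ⟨le_rfl, zero_le_one⟩ ⟨zero_le_one, le_rfl⟩ zero_le_one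
  have hlb : |l| < b := by linarith
  obtain ⟨q, n, T, γ, hq, hq01, hq0, hqT, hn, hnm, hnT, hγ, hγa, hγT, hL⟩ :=
    exists_levelBound_le hξ hx ht h hb hu hα
  have hη : ∀ r ∈ Icc (-1 : ℝ) 1, eta u * r ∈ Icc (-1 : ℝ) 1 := fun r hr => by
    rcases eta_eq u with e | e <;> rw [e] <;> constructor <;> linarith [hr.1, hr.2]
  have hlim := (tendsto_pairCost hlb).add_const
    ((|l| * α - l * u) + levelBound ξ (xi1 ξ) t |u| h (eta u) q n T γ + 3 * α * xi1 ξ 1)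
  refine le_trans (limsup_le_limsup (v := fun N : ℕ => (((N : ℝ)⁻¹ * pairCost b l N +
    ((|l| * α - l * u) + levelBound ξ (xi1 ξ) t |u| h (eta u) q n T γ +
      3 * α * xi1 ξ 1) : ℝ) : EReal)) ?_) ?_
  · filter_upwards [eventually_ge_atTop 2] with N hN
    refine EReal.coe_le_coe_iff.2 (coupledFreeEnergy_le (hX N (by omega)) hN hξ.isProfile hq hq01
      hq0 hv ht (eta_eq u) hqT hn hnm hnT hu hα hlb (fun r hr hrα => ?_) hγ hγa hγT)
    exact hξ.isProfile.slack_le (hη r hr) hv ((eta_mul_sub u r).trans_le hrα.le)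
  · refine ((continuous_coe_real_ereal.tendsto _).comp hlim).limsup_eq.trans_le ?_
    refine EReal.coe_le_coe_iff.2 ?_
    linarith

end

end SphericalSpinGlass

end

theorem proposition2p1 {Ω : ℕ → Type*} [∀ N, MeasurableSpace (Ω N)]
    (P : ∀ N, Measure (Ω N)) [∀ N, IsProbabilityMeasure (P N)]
    (ξ : ℝ → ℝ) (hξ : SphericalSpinGlass.IsMixture ξ)
    (t : ℝ) (ht : t ∈ Icc (0 : ℝ) 1) (h : ℝ)
    (X : ∀ N, Fin 2 → SphericalSpinGlass.Config N → Ω N → ℝ)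
    (hX : ∀ N, 1 ≤ N → SphericalSpinGlass.IsCoupledPair (P N) ξ t N (X N))
    (x : ℝ → ℝ) (hx : SphericalSpinGlass.IsDistributionFunction x)
    (l b : ℝ) (hb : (∫ s in (0 : ℝ)..1, SphericalSpinGlass.xi2 ξ s * x s) + |l| < b)
    (u : ℝ) (hu : u ∈ Icc (-1 : ℝ) 1) :
    (∀ N, 2 ≤ N → ∀ α, 0 < α →
      (∀ᵐ ω ∂(P N), 0 < SphericalSpinGlass.coupledPartition h (X N) u α ω) ∧
      Integrable (fun ω => Real.log (SphericalSpinGlass.coupledPartition h (X N) u α ω)) (P N)) ∧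
    limsup (fun α : ℝ => limsup (fun N : ℕ =>
        ((SphericalSpinGlass.coupledFreeEnergy (P N) h (X N) u α : ℝ) : EReal)) atTop) (𝓝[>] 0)
      ≤ ((SphericalSpinGlass.PFun ξ x t h u b l : ℝ) : EReal) := by
  refine ⟨fun N hN α hα => ?_, ?_⟩
  · have hρ := SphericalSpinGlass.isProbabilityMeasure_pairMeasure hN hu hα
    have hW := SphericalSpinGlass.isWeight_pairWeight (h := h) (hX N (by omega)) hN hu hα
    simp only [SphericalSpinGlass.coupledPartition_eq hN hu hα]
    exact ⟨hW.avgOver_pos, hW.integrable_log_avgOver⟩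
  · refine le_trans (limsup_le_limsup (v := fun α : ℝ => ((SphericalSpinGlass.PFun ξ x t h u b l +
      (|l| + 3 * SphericalSpinGlass.xi1 ξ 1 + 1) * α : ℝ) : EReal)) ?_) ?_
    · filter_upwards [self_mem_nhdsWithin] with α hα
      exact SphericalSpinGlass.limsup_coupledFreeEnergy_le hξ ht h hX hx hb hu hα
    · have hc : Continuous fun α : ℝ => ((SphericalSpinGlass.PFun ξ x t h u b l +
          (|l| + 3 * SphericalSpinGlass.xi1 ξ 1 + 1) * α : ℝ) : EReal) :=
        continuous_coe_real_ereal.comp (by fun_prop)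
      have h0 : Tendsto (fun α : ℝ => ((SphericalSpinGlass.PFun ξ x t h u b l +
          (|l| + 3 * SphericalSpinGlass.xi1 ξ 1 + 1) * α : ℝ) : EReal)) (𝓝[>] 0)
          (𝓝 ((SphericalSpinGlass.PFun ξ x t h u b l : ℝ) : EReal)) := by
        have := (hc.tendsto 0).mono_left (nhdsWithin_le_nhds (s := Ioi 0))
        simpa using this
      exact h0.limsup_eq.le
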